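/- Let $d\ge 1$, $j\in\{1,\dots,d\}$, and let $\alpha\in\mathbb R^d$ satisfy $\alpha_j>-3/2$ and $\alpha_i>-1$ for $i\ne j$. On $\mathbb R_+^d=(0,\infty)^d$ let $$dm_\alpha(x)=\Big(\prod_{i=1}^d x_i^{\alpha_i}e^{-x_i}\Big)dx .$$ For $\beta\in(-1,\infty)^d$ and $k\in\mathbb N^d$ ($\mathbb N=\{0,1,2,\dots\}$) put $\widehat L_k^\beta(x)=\prod_{i=1}^d\big(\tfrac{\Gamma(k_i+1)}{\Gamma(k_i+\beta_i+1)}\big)^{1/2}L_{k_i}^{\beta_i}(x_i)$, where $L_n^{b}$ is the Laguerre polynomial of degree $n$ and order $b$, and let $$G_t^{\beta,\widehat L}(x,y)=\sum_{n=0}^\infty e^{-tn}\sum_{|k|=n}\widehat L_k^\beta(x)\widehat L_k^\beta(y),\qquad t>0,\ x,y\in\mathbb R^d_+,\quad |k|=k_1+\dots+k_d .$$ The modified Laguerre polynomial semigroup is given by $\widetilde T_0^{\alpha,\widehat L,j}=\mathrm{Id}$ and, for $t>0$, $$\widetilde T_t^{\alpha,\widehat L,j}f(x)=e^{-t}\int_{\mathbb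 R^d_+}\sqrt{x_jy_j}\,G_t^{\alpha+e_j,\widehat L}(x,y)f(y)\,dm_\alpha(y),\qquad x\in\mathbb R_+^d,$$ where $e_j$ is the $j$th coordinate vector. The functions $f$ are real- or complex-valued, and $L^p=L^p(\mathbb R^d_+,m_\alpha)$. A *symmetric diffusion semigroup* is a family $\{T_t\}_{t\ge0}$ of linear operators from $L^1+L^\infty$ to measurable functions with $T_0=\mathrm{Id}$ such that (i) for each $1\le p\le\infty$ every $T_t$ is a contraction on $L^p$ and $\{T_t\}$ is a semigroup there; (ii) each $T_t$ is self-adjoint on $L^2$; (iii) $\lim_{t\to0^+}T_tf=f$ in $L^2$ for each $f\in L^2$. It is *submarkovian* (respectively *Markovian*) if moreover $T_tf\ge0$ whenever $f\ge0$, and $T_t\mathbf 1\le\mathbf 1$ (respectively $T_t\mathbf 1=\mathbf 1$) for all $t$. A family $\{T_t\}$ is *$L^p$-contractive* if $\|T_tf\|_p\le\|f\|_p$ for all $1\le p\le\infty$, $t\ge0$ and $f\in L^2\cap L^p$. **Proposition.** For every $f\in L^1+L^\infty$, $t>0$ and $x\in\mathbb R^d_+$ the integral defining $\widetilde T_t^{\alpha,\widehat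 L,j}f(x)$ converges absolutely. Moreover: 1. If $\alpha_j\ge-1/2$, then $\{\widetilde T_t^{\alpha,\widehat L,j}\}$ is a submarkovian (but not Markovian) symmetric diffusion semigroup, and for each $1\le p\le\infty$ $$\|\widetilde T_t^{\alpha,\widehat L,j}\|_{p\to p}\le e^{-t/2},\qquad t>0.$$ 2. If $\alpha_j<-1/2$, then $\{\widetilde T_t^{\alpha,\widehat L,j}\}$ is not $L^p$-contractive (that is, the inequality above fails for some $p\in[1,\infty]$, $t\ge 0$ and $f\in L^2\cap L^p$), but there is a constant $c=c(\alpha)>1$ such that for each $1\le p\le\infty$ $$\|\widetilde T_t^{\alpha,\widehat L,j}\|_{p\to p}\le c\,e^{-t/2},\qquad t>0.$$ -/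

import Mathlib

open MeasureTheory Filter Topology
open scoped ENNReal ComplexOrder

noncomputable section

/-! ### Symmetric diffusion semigroups

Operators act on functions `X → 𝕜`; all statements are up to `μ`-a.e. equality.
The index `t` of a family `T : ℝ → (X → 𝕜) → (X → 𝕜)` is used for `0 ≤ t` only. -/

section Semigroups

variable {X : Type*} [MeasurableSpace X] {𝕜 : Type*} [RCLike 𝕜]

/-- The space `L¹(μ) + L^∞(μ)`. -/
def InL1AddLinfty (μ : Measure X) (f : X → 𝕜) : Prop :=
  ∃ g h : X → 𝕜, MemLp g 1 μ ∧ MemLp h ∞ μ ∧ f = g + h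

/-- `A` maps `L^p(μ)` into itself and `‖A‖_{p → p} ≤ B`. -/
def LpNormLE (μ : Measure X) (A : (X → 𝕜) → (X → 𝕜)) (p : ℝ≥0∞) (B : ℝ) : Prop :=
  ∀ f : X → 𝕜, MemLp f p μ →
    MemLp (A f) p μ ∧ eLpNorm (A f) p μ ≤ ENNReal.ofReal B * eLpNorm f p μ

/-- `A` is a linear operator from `L¹(μ) + L^∞(μ)` to the space of (a.e. classes of)
measurable functions. -/
structure IsLinearOnL1AddLinfty (μ : Measure X) (A : (X → 𝕜) → (X → 𝕜)) : Prop where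
  measurable : ∀ f, InL1AddLinfty μ f → AEStronglyMeasurable (A f) μ
  congr : ∀ f g, InL1AddLinfty μ f → InL1AddLinfty μ g → f =ᵐ[μ] g → A f =ᵐ[μ] A g
  add : ∀ f g, InL1AddLinfty μ f → InL1AddLinfty μ g → A (f + g) =ᵐ[μ] A f + A g
  smul : ∀ (c : 𝕜) (f), InL1AddLinfty μ f → A (c • f) =ᵐ[μ] c • A f

/-- Symmetric diffusion semigroups, with domain `L¹(μ) + L^∞(μ)`. -/
structure IsSymmetricDiffusionSemigroup (μ : Measure X) (T : ℝ → (X → 𝕜) → (X → 𝕜)) :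
    Prop where
  linear : ∀ t, 0 ≤ t → IsLinearOnL1AddLinfty μ (T t)
  zero : ∀ f, InL1AddLinfty μ f → T 0 f =ᵐ[μ] f
  contraction : ∀ p : ℝ≥0∞, 1 ≤ p → ∀ t, 0 ≤ t → LpNormLE μ (T t) p 1
  semigroup : ∀ p : ℝ≥0∞, 1 ≤ p → ∀ s t, 0 ≤ s → 0 ≤ t →
    ∀ f, MemLp f p μ → T (s + t) f =ᵐ[μ] T s (T t f)
  selfAdjoint : ∀ t, 0 ≤ t → ∀ f g, MemLp f 2 μ → MemLp g 2 μ →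
    ∫ x, inner 𝕜 (T t f x) (g x) ∂μ = ∫ x, inner 𝕜 (f x) (T t g x) ∂μ
  continuous : ∀ f, MemLp f 2 μ →
    Tendsto (fun t => eLpNorm (T t f - f) 2 μ) (𝓝[>] 0) (𝓝 0)

/-- `T_t f ≥ 0` whenever `f ≥ 0`. -/
def IsPositiveFamily (μ : Measure X) (T : ℝ → (X → 𝕜) → (X → 𝕜)) : Prop :=
  ∀ t, 0 ≤ t → ∀ f, InL1AddLinfty μ f → (∀ᵐ x ∂μ, 0 ≤ f x) → ∀ᵐ x ∂μ, 0 ≤ T t f x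

/-- Markovian symmetric diffusion semigroups: positive and `T_t 1 = 1`. -/
def IsMarkovian (μ : Measure X) (T : ℝ → (X → 𝕜) → (X → 𝕜)) : Prop :=
  IsSymmetricDiffusionSemigroup μ T ∧ IsPositiveFamily μ T ∧
    ∀ t, 0 ≤ t → ∀ᵐ x ∂μ, T t (fun _ => 1) x = 1

/-- Submarkovian symmetric diffusion semigroups: positive and `T_t 1 ≤ 1`. -/
def IsSubmarkovian (μ : Measure X) (T : ℝ → (X → 𝕜) → (X → 𝕜)) : Prop :=
  IsSymmetricDiffusionSemigroup μ T ∧ IsPositiveFamily μ T ∧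
    ∀ t, 0 ≤ t → ∀ᵐ x ∂μ, T t (fun _ => 1) x ≤ 1

/-- `L^p`-contractivity: `‖T_t f‖_p ≤ ‖f‖_p` for all `1 ≤ p ≤ ∞`, `t ≥ 0`, `f ∈ L² ∩ L^p`. -/
def IsLpContractive (μ : Measure X) (T : ℝ → (X → 𝕜) → (X → 𝕜)) : Prop :=
  ∀ p : ℝ≥0∞, 1 ≤ p → ∀ t, 0 ≤ t → ∀ f, MemLp f 2 μ → MemLp f p μ →
    eLpNorm (T t f) p μ ≤ eLpNorm f p μ

end Semigroups

/-! ### Laguerre polynomials and the modified Laguerre semigroup -/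

/-- The Laguerre polynomial `L_n^a(x)` of degree `n` and order `a > -1`. -/
def laguerre (n : ℕ) (a x : ℝ) : ℝ :=
  ∑ m ∈ Finset.range (n + 1),
    Real.Gamma (n + a + 1) / (Real.Gamma (m + a + 1) * (n - m).factorial * m.factorial) *
      (-x) ^ m

/-- The normalized Laguerre polynomial
`(Γ(n + 1) / Γ(n + a + 1))^{1/2} L_n^a(x)`. -/
def normLaguerre (n : ℕ) (a x : ℝ) : ℝ :=
  Real.sqrt (Real.Gamma (n + 1) / Real.Gamma (n + a + 1)) * laguerre n a x

variable {d : ℕ}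

/-- The open orthant `(0, ∞)^d`. -/
def posOrthant (d : ℕ) : Set (Fin d → ℝ) := {x | ∀ i, 0 < x i}

/-- Tensor products of normalized Laguerre polynomials. -/
def normLaguerreProd (k : Fin d → ℕ) (α x : Fin d → ℝ) : ℝ :=
  ∏ i, normLaguerre (k i) (α i) (x i)

/-- The measure `dm_α(x) = ∏ x_i^{α_i} e^{-x_i} dx` on `(0, ∞)^d`. -/
def laguerreMeasure (α : Fin d → ℝ) : Measure (Fin d → ℝ) :=
  (volume.restrict (posOrthant d)).withDensity
    fun x => ENNReal.ofReal (∏ i, x i ^ α i * Real.exp (-x i))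

/-- The heat kernel `∑_n e^{-tn} ∑_{|k| = n} L̂_k^α(x) L̂_k^α(y)` of the Laguerre polynomial
semigroup. -/
def laguerreHeatKernel (α : Fin d → ℝ) (t : ℝ) (x y : Fin d → ℝ) : ℝ :=
  ∑' n : ℕ, Real.exp (-t * n) *
    ∑ k ∈ Finset.piAntidiag (Finset.univ : Finset (Fin d)) n,
      normLaguerreProd k α x * normLaguerreProd k α y

/-- The kernel `e^{-t} (x_j y_j)^{1/2} G_t^{α + e_j}(x, y)` (with respect to `m_α`). -/
def modifiedKernel (α : Fin d → ℝ) (j : Fin d) (t : ℝ) (x y : Fin d → ℝ) : ℝ :=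
  Real.exp (-t) * (Real.sqrt (x j * y j) * laguerreHeatKernel (α + Pi.single j 1) t x y)

/-- The modified Laguerre polynomial semigroup, with `T_0 = Id`. -/
def modifiedSemigroup (𝕜 : Type*) [RCLike 𝕜] (α : Fin d → ℝ) (j : Fin d) (t : ℝ)
    (f : (Fin d → ℝ) → 𝕜) : (Fin d → ℝ) → 𝕜 :=
  if t = 0 then f
  else fun x => ∫ y, (modifiedKernel α j t x y : 𝕜) * f y ∂(laguerreMeasure α)

/-- The admissible parameters: `α_j > -3/2` and `α_i > -1` for `i ≠ j`. -/
def IsAdmissible (α : Fin d → ℝ) (j : Fin d) : Prop :=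
  -3 / 2 < α j ∧ ∀ i, i ≠ j → -1 < α i

end

/-! ### Double series over antidiagonals -/

/-! Put r = e^{-t}. By the Hille–Hardy formula (`hasSum_normLaguerre_mul`) the heat kernel of order
β is a product over the coordinates of Mehler kernels, each an explicit exponential times a modified
Bessel series (`laguerreHeatKernel_eq_prod`). So the modified kernel is a product of ordinary Mehler
kernels of order α_i, which are positive with total mass 1, and of one special factor r √(x_j y_j)
K_r^{α_j+1}(x_j, y_j). It is positive and symmetric, and everything is decided by its total mass.

That mass is computed in `integral_modifiedMehlerKernel`: it equals √r Φ_b(z), where b = α_j + 1, z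
= r x_j / (1 - r), and Φ_b is `modifiedMass`. The factor √r = e^{-t/2} is the decay rate of the
proposition. A Beta integral gives Φ_b(z) = √(z/π) ∫_0^1 e^{-zv} v^{-1/2} (1 - v)^{b-1/2} dv. If b ≥
1/2, dropping (1 - v)^{b-1/2} ≤ 1 and extending the integral to the half-line gives Φ_b ≤ 1
(`modifiedMass_le_one`). If b < 1/2, the factor exceeds 1 and Φ_b(z) > 1 for large z, with leading
gain (1/2 - b)/(2z) (`exists_one_lt_modifiedMass`); still Φ_b ≤ (b + 1)/(b + 1/2), by a termwise
comparison with Φ_{b+1} (`modifiedMass_le`). The threshold b = 1/2 is α_j = -1/2.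

A bound C on the mass of a positive symmetric kernel bounds the operator by C on every L^p
(`IsSymmKernel.lpNormLE_kernelOp`), which gives both norm estimates and, applied to the constant 1,
the failure of the Markov property. The semigroup law is the Chapman–Kolmogorov identity, a
consequence of the orthonormality of Laguerre polynomials. Strong continuity holds because the
Mehler kernel is a probability kernel whose mean square distance from x tends to 0 as r → 1. When
α_j < -1/2, a short time t is chosen for which the mass exceeds 1 on an open set, which contradicts
contractivity on L^∞. -/

theorem hasSum_sum_antidiagonal {f : ℕ × ℕ → ℝ} {S : ℝ} (h : HasSum f S) :
    HasSum (fun n => ∑ p ∈ Finset.HasAntidiagonal.antidiagonal n, f p) S := by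
  have h' := (Finset.HasAntidiagonal.sigmaAntidiagonalEquivProd (A := ℕ)).hasSum_iff.2 h
  have := h'.sigma (g := fun n => ∑ p ∈ Finset.HasAntidiagonal.antidiagonal n, f p) (fun n => by
    have := hasSum_fintype (fun c : Finset.HasAntidiagonal.antidiagonal n => f c)
    rw [Finset.univ_eq_attach, Finset.sum_attach (Finset.HasAntidiagonal.antidiagonal n) f] at this
    exact this)
  exact this

theorem summable_of_summable_sum_antidiagonal {f : ℕ × ℕ → ℝ} (h0 : ∀ p, 0 ≤ f p)
    (h : Summable fun n => ∑ p ∈ Finset.HasAntidiagonal.antidiagonal n, f p) : Summable f := by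
  rw [← (Finset.HasAntidiagonal.sigmaAntidiagonalEquivProd (A := ℕ)).summable_iff]
  refine (summable_sigma_of_nonneg fun x => h0 _).2 ⟨fun n => ?_, ?_⟩
  · exact (hasSum_fintype _).summable
  · refine h.congr fun n => ?_
    rw [tsum_fintype, Finset.univ_eq_attach]
    exact (Finset.sum_attach (Finset.HasAntidiagonal.antidiagonal n) f).symm

theorem summable_of_hasSum_abs_prod {f : ℕ × ℕ → ℝ} {g : ℕ → ℝ} {S : ℝ}
    (hg : ∀ k, HasSum (fun j => |f (k, j)|) (g k)) (hS : HasSum g S) : Summable f := by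
  rw [← summable_abs_iff]
  refine (summable_prod_of_nonneg fun _ => abs_nonneg _).2 ⟨fun k => (hg k).summable, ?_⟩
  exact hS.summable.congr fun k => (hg k).tsum_eq.symm

/-! ### Power series -/

theorem hasFPowerSeriesAt_ofScalars_of_hasSum {c : ℕ → ℝ} {f : ℝ → ℝ} {ε : ℝ} (hε : 0 < ε)
    (h : ∀ s, |s| < ε → HasSum (fun n => c n * s ^ n) (f s)) :
    HasFPowerSeriesAt f (FormalMultilinearSeries.ofScalars ℝ c) 0 := by
  -- The series is known to converge only for |s| < ε; at radius ε / 2 the boundary point is itself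
  -- a point of convergence, which bounds the radius from below.
  refine ⟨ENNReal.ofReal (ε / 2), ?_, by simpa using hε, ?_⟩
  · rw [ENNReal.ofReal]
    refine FormalMultilinearSeries.le_radius_of_summable_norm _ ?_
    have h1 : |ε / 2| < ε := by rw [abs_of_pos (by positivity)]; linarith
    refine (h _ h1).summable.norm.congr fun n => ?_
    simp [abs_of_pos hε, max_eq_left (half_pos hε).le]
  · intro y hy
    have h1 : |y| < ε := by
      rw [Metric.mem_eball, edist_zero_right, ← ofReal_norm,
        ENNReal.ofReal_lt_ofReal_iff (by positivity), Real.norm_eq_abs] at hy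
      linarith
    have := h y h1
    simpa [FormalMultilinearSeries.ofScalars_apply_eq, mul_comm] using this

/-- Comparison of coefficients, by uniqueness of power series expansions. It extracts single
Laguerre series from the generating function in `hasSum_choose_mul_laguerre`. -/
theorem eq_of_hasSum_mul_pow {c c' : ℕ → ℝ} {f : ℝ → ℝ} {ε : ℝ} (hε : 0 < ε)
    (h : ∀ s, |s| < ε → HasSum (fun n => c n * s ^ n) (f s))
    (h' : ∀ s, |s| < ε → HasSum (fun n => c' n * s ^ n) (f s)) : c = c' := by
  have := (hasFPowerSeriesAt_ofScalars_of_hasSum hε h).eq_formalMultilinearSeries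
    (hasFPowerSeriesAt_ofScalars_of_hasSum hε h')
  exact FormalMultilinearSeries.ofScalars_series_injective ℝ ℝ this

/-! ### Gamma function estimates, the binomial series and the Bessel series. -/

theorem Real.Gamma_add_natCast {s : ℝ} (hs : 0 < s) (n : ℕ) :
    Real.Gamma (s + n) = (ascPochhammer ℝ n).eval s * Real.Gamma s := by
  induction n with
  | zero => simp
  | succ n ih =>
    rw [ascPochhammer_succ_eval, Nat.cast_succ, ← add_assoc,
      Real.Gamma_add_one (by positivity), ih]
    ring

theorem hasSum_one_sub_rpow_neg {b s : ℝ} (hb : 0 < b) (hs : |s| < 1) :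
    HasSum (fun n : ℕ => Real.Gamma (b + n) / (Real.Gamma b * n.factorial) * s ^ n)
      ((1 - s) ^ (-b)) := by
  have h := (Real.one_div_one_sub_rpow_hasFPowerSeriesOnBall_zero b).hasSum (y := s)
    (by simpa [enorm_eq_nnnorm, ← NNReal.coe_lt_coe] using hs)
  have h1 : 0 ≤ 1 - s := by linarith [(abs_lt.1 hs).2]
  rw [zero_add, one_div, ← Real.rpow_neg h1] at h
  refine h.congr_fun fun n => ?_
  rw [FormalMultilinearSeries.ofScalars_apply_eq, smul_eq_mul]
  congr 1
  rw [Real.Gamma_add_natCast hb]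
  have h2 : (n.factorial : ℝ) * Ring.choose (b + n - 1) n = (ascPochhammer ℝ n).eval b := by
    have := Ring.factorial_nsmul_multichoose_eq_ascPochhammer b n
    rw [nsmul_eq_mul, Polynomial.ascPochhammer_smeval_eq_eval] at this
    rw [← this, Ring.choose]
    congr 2
    ring
  rw [← h2]
  have := (Real.Gamma_pos_of_pos hb).ne'
  field_simp

theorem Real.hasSum_exp' (x : ℝ) : HasSum (fun n : ℕ => x ^ n / n.factorial) (Real.exp x) := by
  rw [Real.exp_eq_exp_ℝ]
  exact NormedSpace.expSeries_div_hasSum_exp x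

/-- Passing from m to m + 1 multiplies the left side by m + 1 and the right side by m + a + 2, which
is larger. The shift a + 2 matters: with a + 1 the comparison of factors fails for negative a. -/
theorem factorial_mul_Gamma_le {a : ℝ} (ha : -1 < a) (m : ℕ) :
    m.factorial * Real.Gamma (a + 2) ≤ Real.Gamma (m + a + 2) := by
  induction m with
  | zero => simp
  | succ n ih =>
    have h1 : ((n + 1 : ℕ) : ℝ) + a + 2 = (n + a + 2) + 1 := by push_cast; ring
    have h2 : (0 : ℝ) < n + a + 2 := by have : (0 : ℝ) ≤ n := by positivity
                                        linarith
    rw [h1, Real.Gamma_add_one h2.ne', Nat.factorial_succ, Nat.cast_mul, mul_assoc]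
    have h3 : ((n + 1 : ℕ) : ℝ) ≤ n + a + 2 := by push_cast; linarith
    have h4 : 0 < Real.Gamma (a + 2) := Real.Gamma_pos_of_pos (by linarith)
    exact mul_le_mul h3 ih (by positivity) h2.le

theorem Gamma_natCast_add_pos {a : ℝ} (ha : -1 < a) (m : ℕ) : 0 < Real.Gamma (m + a + 1) :=
  Real.Gamma_pos_of_pos (by have : (0 : ℝ) ≤ m := by positivity
                            linarith)

/-- Superexponential growth of Γ. It gives convergence of the Bessel series, the majorant in the
Hille–Hardy formula, and the decay of the Mehler kernel. -/
theorem exists_pow_div_Gamma_le {a D : ℝ} (ha : -1 < a) (hD : 0 ≤ D) :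
    ∃ C, 0 < C ∧ ∀ m : ℕ, D ^ m / Real.Gamma (m + a + 1) ≤ C := by
  have h1 : 0 < Real.Gamma (a + 1) := Real.Gamma_pos_of_pos (by linarith)
  have h2 : 0 < Real.Gamma (a + 2) := Real.Gamma_pos_of_pos (by linarith)
  refine ⟨1 / Real.Gamma (a + 1) + D * Real.exp D / Real.Gamma (a + 2), by positivity, ?_⟩
  rintro (_ | m)
  · simp only [pow_zero, Nat.cast_zero, zero_add]
    exact le_add_of_nonneg_right (by positivity)
  · refine le_trans ?_ (le_add_of_nonneg_left (by positivity))
    have h3 : ((m + 1 : ℕ) : ℝ) + a + 1 = m + a + 2 := by push_cast; ring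
    rw [h3, pow_succ']
    calc D * D ^ m / Real.Gamma (m + a + 2)
        ≤ D * D ^ m / (m.factorial * Real.Gamma (a + 2)) := by
          gcongr
          exact factorial_mul_Gamma_le ha m
      _ = D * (D ^ m / m.factorial) / Real.Gamma (a + 2) := by field_simp
      _ ≤ _ := by
          gcongr
          exact le_hasSum (Real.hasSum_exp' D) m fun j _ => by positivity

theorem summable_pow_div_factorial_mul_Gamma {a : ℝ} (w : ℝ) (ha : -1 < a) :
    Summable fun m : ℕ => w ^ m / (m.factorial * Real.Gamma (m + a + 1)) := by
  obtain ⟨C, hC, h⟩ := exists_pow_div_Gamma_le ha (abs_nonneg w)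
  refine Summable.of_norm_bounded ((Real.hasSum_exp' 1).summable.mul_left C) fun m => ?_
  have := Gamma_natCast_add_pos ha m
  rw [Real.norm_eq_abs, abs_div, abs_pow, abs_of_pos (by positivity : 0 < m.factorial * Real.Gamma (m + a + 1)), one_pow]
  calc |w| ^ m / (m.factorial * Real.Gamma (m + a + 1))
      = |w| ^ m / Real.Gamma (m + a + 1) * (1 / m.factorial) := by field_simp
    _ ≤ _ := by gcongr; exact h m

/-- The entire function `∑ w^m / (m! Γ(m + a + 1))`, that is `w^{-a/2} I_a(2√w)`. -/
noncomputable def besselSeries (a w : ℝ) : ℝ :=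
  ∑' m : ℕ, w ^ m / (m.factorial * Real.Gamma (m + a + 1))

theorem hasSum_besselSeries {a : ℝ} (ha : -1 < a) (w : ℝ) :
    HasSum (fun m : ℕ => w ^ m / (m.factorial * Real.Gamma (m + a + 1))) (besselSeries a w) :=
  (summable_pow_div_factorial_mul_Gamma w ha).hasSum

/-! ### Generating functions of Laguerre polynomials -/

theorem laguerre_eq_sum_antidiagonal (n : ℕ) (a x : ℝ) :
    laguerre n a x = ∑ p ∈ Finset.HasAntidiagonal.antidiagonal n,
      Real.Gamma (n + a + 1) / (Real.Gamma (p.1 + a + 1) * p.2.factorial * p.1.factorial) *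
        (-x) ^ p.1 := by
  rw [Finset.Nat.sum_antidiagonal_eq_sum_range_succ (fun k j =>
    Real.Gamma (n + a + 1) / (Real.Gamma (k + a + 1) * j.factorial * k.factorial) * (-x) ^ k)]
  rfl

/-- The coefficients alternate in sign, so at -|x| all terms are nonnegative. Absolute convergence
of Laguerre series thus follows from the generating function at -|x|. -/
theorem abs_laguerre_le {a : ℝ} (ha : -1 < a) (n : ℕ) (x : ℝ) :
    |laguerre n a x| ≤ laguerre n a (-|x|) := by
  refine (Finset.abs_sum_le_sum_abs _ _).trans (Finset.sum_le_sum fun m _ => ?_)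
  have h1 := Gamma_natCast_add_pos ha m
  have h2 := Gamma_natCast_add_pos ha n
  rw [abs_mul, abs_pow, abs_neg, neg_neg, abs_of_nonneg (by positivity)]

/-- Write n = k + j with k the power of x. For fixed k the sum over j is a binomial series with
exponent -(k + a + 1); the remaining sum over k is an exponential series. The same computation at
|s| and -|x| justifies the rearrangement. -/
theorem hasSum_laguerre_mul_pow {a : ℝ} (ha : -1 < a) (x : ℝ) {s : ℝ} (hs : |s| < 1) :
    HasSum (fun n => laguerre n a x * s ^ n)
      ((1 - s) ^ (-a - 1) * Real.exp (-(s * x / (1 - s)))) := by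
  have key : ∀ y t : ℝ, |t| < 1 → ∀ k : ℕ, HasSum (fun j : ℕ => Real.Gamma (k + j + a + 1) /
      (Real.Gamma (k + a + 1) * j.factorial * k.factorial) * (-y) ^ k * t ^ (k + j))
      ((1 - t) ^ (-a - 1) * ((-(t * y / (1 - t))) ^ k / k.factorial)) := by
    intro y t ht k
    have ht1 : 0 < 1 - t := by linarith [(abs_lt.1 ht).2]
    have hk : (0 : ℝ) < k + a + 1 := by
      have : (0 : ℝ) ≤ k := by positivity
      linarith
    have h := (hasSum_one_sub_rpow_neg hk ht).mul_left ((-(y * t)) ^ k / k.factorial)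
    convert! h using 1
    · ext j
      rw [show (k : ℝ) + j + a + 1 = k + a + 1 + j by ring, pow_add,
        show -(y * t) = -y * t by ring, mul_pow]
      have := (Gamma_natCast_add_pos ha k).ne'
      field_simp
    · rw [show -((k : ℝ) + a + 1) = (-a - 1) - k by ring, Real.rpow_sub ht1 (-a - 1) k, Real.rpow_natCast,
        show -(t * y / (1 - t)) = -(y * t) / (1 - t) by ring, div_pow]
      ring
  have hsum : Summable fun p : ℕ × ℕ => Real.Gamma (p.1 + p.2 + a + 1) /
      (Real.Gamma (p.1 + a + 1) * p.2.factorial * p.1.factorial) * (-x) ^ p.1 *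
        s ^ (p.1 + p.2) := by
    refine summable_of_hasSum_abs_prod (fun k => ?_)
      ((Real.hasSum_exp' (-(|s| * -|x| / (1 - |s|)))).mul_left ((1 - |s|) ^ (-a - 1)))
    have := key (-|x|) |s| (by rwa [abs_abs]) k
    convert! this using 1
    ext j
    have h1 := Gamma_natCast_add_pos ha k
    have h2 := Gamma_natCast_add_pos ha (k + j)
    push_cast at h2
    rw [abs_mul, abs_mul, abs_pow, abs_pow, abs_neg, neg_neg, abs_of_nonneg (by positivity)]
  have htot := (hsum.hasSum.prod_fiberwise (key x s hs)).unique
    ((Real.hasSum_exp' (-(s * x / (1 - s)))).mul_left ((1 - s) ^ (-a - 1)))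
  have := hasSum_sum_antidiagonal hsum.hasSum
  rw [htot] at this
  convert! this using 1
  ext n
  rw [laguerre_eq_sum_antidiagonal, Finset.sum_mul]
  refine Finset.sum_congr rfl fun p hp => ?_
  rw [← Finset.HasAntidiagonal.mem_antidiagonal.1 hp]
  push_cast
  rfl

theorem summable_abs_laguerre_mul_pow {a : ℝ} (ha : -1 < a) (x : ℝ) {s : ℝ} (hs0 : 0 ≤ s)
    (hs : s < 1) : Summable fun n => |laguerre n a x| * s ^ n :=
  Summable.of_nonneg_of_le (fun n => by positivity)
    (fun n => mul_le_mul_of_nonneg_right (abs_laguerre_le ha n x) (by positivity))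
    (hasSum_laguerre_mul_pow ha (-|x|) (by rwa [abs_of_nonneg hs0])).summable

/-- Expand the generating function at r + s in powers of s in two ways. The binomial theorem for (r
+ s)^n produces the series in question; the factorisation 1 - (r + s) = (1 - r)(1 - s/(1 - r))
produces the generating function at x/(1 - r). The coefficients of s^m must agree. -/
theorem hasSum_choose_mul_laguerre {a : ℝ} (ha : -1 < a) (x : ℝ) {r : ℝ} (hr0 : 0 ≤ r)
    (hr : r < 1) (m : ℕ) :
    HasSum (fun l => ((l + m).choose m : ℝ) * r ^ l * laguerre (l + m) a x)
      ((1 - r) ^ (-a - 1) * Real.exp (-(r * x / (1 - r))) *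
        (laguerre m a (x / (1 - r)) / (1 - r) ^ m)) := by
  have h1r : 0 < 1 - r := by linarith
  have hsum : ∀ s, |s| < 1 - r → Summable fun p : ℕ × ℕ =>
      ((p.2 + p.1).choose p.1 : ℝ) * r ^ p.2 * laguerre (p.2 + p.1) a x * s ^ p.1 := by
    intro s hs
    rw [← summable_abs_iff]
    refine summable_of_summable_sum_antidiagonal (fun _ => abs_nonneg _) ?_
    refine (summable_abs_laguerre_mul_pow ha x (s := |s| + r) (by positivity)
      (by linarith)).congr fun n => ?_
    rw [(Commute.all |s| r).add_pow', Finset.mul_sum]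
    refine Finset.sum_congr rfl fun p hp => ?_
    rw [← Finset.HasAntidiagonal.mem_antidiagonal.1 hp, nsmul_eq_mul, abs_mul, abs_mul, abs_mul,
      abs_pow, abs_pow, abs_of_nonneg hr0, Nat.abs_cast, add_comm p.2]
    ring
  have hinner : ∀ m : ℕ, Summable fun l =>
      ((l + m).choose m : ℝ) * r ^ l * laguerre (l + m) a x := by
    intro m
    have h := (hsum ((1 - r) / 2) (by rw [abs_of_pos (by positivity)]; linarith)).prod_factor m
    have h0 : ((1 - r) / 2) ^ m ≠ 0 := (pow_pos (half_pos h1r) m).ne'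
    exact (summable_mul_right_iff h0).1 h
  have hM : ∀ s, |s| < 1 - r → HasSum
      (fun m => (∑' l : ℕ, ((l + m).choose m : ℝ) * r ^ l * laguerre (l + m) a x) * s ^ m)
      ((1 - (r + s)) ^ (-a - 1) * Real.exp (-((r + s) * x / (1 - (r + s))))) := by
    intro s hs
    have h0 : ∀ m : ℕ, HasSum
        (fun l => ((l + m).choose m : ℝ) * r ^ l * laguerre (l + m) a x * s ^ m)
        ((∑' l : ℕ, ((l + m).choose m : ℝ) * r ^ l * laguerre (l + m) a x) * s ^ m) :=
      fun m => (hinner m).hasSum.mul_right (s ^ m)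
    have h1 := (hsum s hs).hasSum.prod_fiberwise h0
    have h2 := hasSum_sum_antidiagonal (hsum s hs).hasSum
    have h3 := hasSum_laguerre_mul_pow ha x (s := r + s) (by
      have := abs_add_le r s
      rw [abs_of_nonneg hr0] at this
      linarith)
    have h4 : HasSum (fun n => laguerre n a x * (r + s) ^ n) (∑' p : ℕ × ℕ,
        ((p.2 + p.1).choose p.1 : ℝ) * r ^ p.2 * laguerre (p.2 + p.1) a x * s ^ p.1) := by
      refine h2.congr_fun fun n => ?_
      rw [add_comm r s, (Commute.all s r).add_pow', Finset.mul_sum]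
      refine Finset.sum_congr rfl fun p hp => ?_
      rw [← Finset.HasAntidiagonal.mem_antidiagonal.1 hp, nsmul_eq_mul, add_comm p.2]
      ring
    rw [h3.unique h4]
    exact h1
  have hG : ∀ s, |s| < 1 - r → HasSum
      (fun m => ((1 - r) ^ (-a - 1) * Real.exp (-(r * x / (1 - r))) *
        (laguerre m a (x / (1 - r)) / (1 - r) ^ m)) * s ^ m)
      ((1 - (r + s)) ^ (-a - 1) * Real.exp (-((r + s) * x / (1 - (r + s))))) := by
    intro s hs
    have hs' : |s / (1 - r)| < 1 := by rwa [abs_div, abs_of_pos h1r, div_lt_one h1r]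
    have h1 : 0 < 1 - (r + s) := by linarith [(abs_lt.1 hs).2]
    have h2 : 1 - s / (1 - r) = (1 - (r + s)) / (1 - r) := by field_simp; ring
    have h := (hasSum_laguerre_mul_pow ha (x / (1 - r)) hs').mul_left
      ((1 - r) ^ (-a - 1) * Real.exp (-(r * x / (1 - r))))
    rw [h2, Real.div_rpow h1.le h1r.le] at h
    convert! h using 1
    · ext m
      rw [div_pow]
      ring
    · have h4 : -((r + s) * x / (1 - (r + s))) = -(r * x / (1 - r)) +
          -(s / (1 - r) * (x / (1 - r)) / ((1 - (r + s)) / (1 - r))) := by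
        field_simp
        ring
      rw [h4, Real.exp_add]
      have := (Real.rpow_pos_of_pos h1r (-a - 1)).ne'
      field_simp
  have := congrFun (eq_of_hasSum_mul_pow h1r hM hG) m
  rw [← this]
  exact (hinner m).hasSum

/-! ### The Mehler kernel and the Hille–Hardy formula. -/

/-- The Mehler kernel of order `a`, extended evenly in both variables. -/
noncomputable def mehlerKernel (a r x y : ℝ) : ℝ :=
  (1 - r) ^ (-a - 1) * Real.exp (-(r * (|x| + |y|) / (1 - r))) *
    besselSeries a (r * (|x| * |y|) / (1 - r) ^ 2)

/-- This is the Cauchy product of the exponential series in w and the Bessel series in -xw. -/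
theorem hasSum_laguerre_div_Gamma {a : ℝ} (ha : -1 < a) (x w : ℝ) :
    HasSum (fun m : ℕ => w ^ m * laguerre m a x / Real.Gamma (m + a + 1))
      (Real.exp w * besselSeries a (-(x * w))) := by
  have h1 := hasSum_besselSeries ha (-(x * w))
  have h2 := Real.hasSum_exp' w
  have h3 := summable_mul_of_summable_norm h1.summable.norm h2.summable.norm
  have h4 := hasSum_sum_antidiagonal (h1.mul h2 h3)
  rw [mul_comm (besselSeries _ _)] at h4
  refine h4.congr_fun fun m => ?_
  rw [laguerre_eq_sum_antidiagonal, Finset.mul_sum, Finset.sum_div]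
  refine Finset.sum_congr rfl fun p hp => ?_
  have h5 := (Gamma_natCast_add_pos ha m).ne'
  have h6 := (Gamma_natCast_add_pos ha p.1).ne'
  rw [← Finset.HasAntidiagonal.mem_antidiagonal.1 hp] at h5 ⊢
  rw [show -(x * w) = -x * w by ring, mul_pow, pow_add]
  field_simp

theorem normLaguerre_mul_normLaguerre {a : ℝ} (ha : -1 < a) (n : ℕ) (x y : ℝ) :
    normLaguerre n a x * normLaguerre n a y =
      n.factorial / Real.Gamma (n + a + 1) * laguerre n a x * laguerre n a y := by
  have h1 := Gamma_natCast_add_pos ha n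
  have h2 : 0 < Real.Gamma (n + 1) := Real.Gamma_pos_of_pos (by positivity)
  have h3 := Real.mul_self_sqrt (div_pos h2 h1).le
  rw [← Real.Gamma_nat_eq_factorial, ← h3, normLaguerre, normLaguerre]
  ring

/-- With this normalisation the coefficients are binomial, so in the Hille–Hardy series the sum over
n at a fixed power of y is the one in `hasSum_choose_mul_laguerre`. -/
theorem factorial_div_Gamma_mul_laguerre {a : ℝ} (ha : -1 < a) (n : ℕ) (y : ℝ) :
    n.factorial / Real.Gamma (n + a + 1) * laguerre n a y =
      ∑ p ∈ Finset.HasAntidiagonal.antidiagonal n,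
        (n.choose p.1 : ℝ) * ((-y) ^ p.1 / Real.Gamma (p.1 + a + 1)) := by
  rw [laguerre_eq_sum_antidiagonal, Finset.mul_sum]
  refine Finset.sum_congr rfl fun p hp => ?_
  have h5 := (Gamma_natCast_add_pos ha n).ne'
  have h6 := (Gamma_natCast_add_pos ha p.1).ne'
  rw [← Finset.HasAntidiagonal.mem_antidiagonal.1 hp] at h5 ⊢
  rw [Nat.cast_choose ℝ (Nat.le_add_right _ _), Nat.add_sub_cancel_left]
  field_simp

/-- The Hille–Hardy formula. -/
theorem hasSum_normLaguerre_mul {a : ℝ} (ha : -1 < a) {r : ℝ} (hr0 : 0 ≤ r) (hr : r < 1)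
    {x y : ℝ} (hx : 0 ≤ x) (hy : 0 ≤ y) :
    (Summable fun n => |r ^ n * (normLaguerre n a x * normLaguerre n a y)|) ∧
    HasSum (fun n => r ^ n * (normLaguerre n a x * normLaguerre n a y))
      (mehlerKernel a r x y) := by
  have h1r : 0 < 1 - r := by linarith
  -- Here p.1 is the power of y and p.2 = n - p.1. Sums along antidiagonals give the Hille–Hardy
  -- series; summing over p.2 first and then over p.1 gives its closed form, by
  -- `hasSum_choose_mul_laguerre` and `hasSum_laguerre_div_Gamma`.
  set J : ℕ × ℕ → ℝ := fun p => (p.2 + p.1).choose p.1 * r ^ p.2 * laguerre (p.2 + p.1) a x *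
    (r ^ p.1 * ((-y) ^ p.1 / Real.Gamma (p.1 + a + 1))) with hJ
  have hJn : ∀ n, ∑ p ∈ Finset.HasAntidiagonal.antidiagonal n, J p =
      r ^ n * (normLaguerre n a x * normLaguerre n a y) := by
    intro n
    rw [normLaguerre_mul_normLaguerre ha, mul_right_comm, factorial_div_Gamma_mul_laguerre ha,
      Finset.sum_mul, Finset.mul_sum]
    refine Finset.sum_congr rfl fun p hp => ?_
    rw [← Finset.HasAntidiagonal.mem_antidiagonal.1 hp, hJ, pow_add]
    simp only [add_comm p.2]
    ring
  have hJabs : Summable fun p => |J p| := by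
    refine summable_of_summable_sum_antidiagonal (fun _ => abs_nonneg _) ?_
    -- Growth of Γ gives y^m / Γ(m + a + 1) ≤ C δ^m, and the binomial coefficients then sum to (δ +
    -- 1)^n. A small δ keeps r (δ + 1) inside the disc of convergence of the generating function.
    obtain ⟨δ, hδ, hδr⟩ : ∃ δ, 0 < δ ∧ r * (δ + 1) < 1 := by
      refine ⟨(1 - r) / 2, by positivity, ?_⟩
      nlinarith
    obtain ⟨C, hC, hCb⟩ := exists_pow_div_Gamma_le ha (D := y / δ) (by positivity)
    refine Summable.of_nonneg_of_le (fun n => Finset.sum_nonneg fun _ _ => abs_nonneg _)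
      (fun n => ?_) ((summable_abs_laguerre_mul_pow ha x (s := r * (δ + 1)) (by positivity)
        hδr).mul_left C)
    rw [mul_pow, (Commute.all δ 1).add_pow', Finset.mul_sum, Finset.mul_sum, Finset.mul_sum]
    refine Finset.sum_le_sum fun p hp => ?_
    rw [← Finset.HasAntidiagonal.mem_antidiagonal.1 hp, hJ, pow_add, one_pow, mul_one,
      nsmul_eq_mul, add_comm p.1 p.2]
    have h6 := Gamma_natCast_add_pos ha p.1
    simp only [abs_mul, abs_div, abs_pow, abs_neg, abs_of_nonneg hr0, abs_of_nonneg hy,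
      abs_of_pos h6, Nat.abs_cast]
    have h7 : y ^ p.1 / Real.Gamma (p.1 + a + 1) ≤ C * δ ^ p.1 := by
      have := hCb p.1
      rw [div_pow, div_div, div_le_iff₀ (by positivity)] at this
      rw [div_le_iff₀ h6]
      linarith
    calc _ ≤ ((p.2 + p.1).choose p.1 : ℝ) * r ^ p.2 * |laguerre (p.2 + p.1) a x| *
          (r ^ p.1 * (C * δ ^ p.1)) := by gcongr
      _ = _ := by ring
  have hinner : ∀ m : ℕ, HasSum (fun l => J (m, l)) ((1 - r) ^ (-a - 1) *
      Real.exp (-(r * x / (1 - r))) * ((-(r * y / (1 - r))) ^ m * laguerre m a (x / (1 - r)) /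
        Real.Gamma (m + a + 1))) := by
    intro m
    have := (hasSum_choose_mul_laguerre ha x hr0 hr m).mul_right
      (r ^ m * ((-y) ^ m / Real.Gamma (m + a + 1)))
    convert! this using 1
    have h6 := (Gamma_natCast_add_pos ha m).ne'
    rw [show -(r * y / (1 - r)) = r * (-y) / (1 - r) by ring, div_pow, mul_pow]
    ring
  have hS := hJabs.of_abs.hasSum
  have htot := (hS.prod_fiberwise hinner).unique
    ((hasSum_laguerre_div_Gamma ha (x / (1 - r)) (-(r * y / (1 - r)))).mul_left _)
  have hval : (1 - r) ^ (-a - 1) * Real.exp (-(r * x / (1 - r))) *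
      (Real.exp (-(r * y / (1 - r))) * besselSeries a (-(x / (1 - r) * -(r * y / (1 - r))))) =
      mehlerKernel a r x y := by
    rw [mehlerKernel, abs_of_nonneg hx, abs_of_nonneg hy,
      show -(r * (x + y) / (1 - r)) = -(r * x / (1 - r)) + -(r * y / (1 - r)) by ring,
      Real.exp_add, show -(x / (1 - r) * -(r * y / (1 - r))) = r * (x * y) / (1 - r) ^ 2 by field_simp]
    ring
  rw [hval] at htot
  rw [htot] at hS
  constructor
  · refine Summable.of_nonneg_of_le (fun n => abs_nonneg _) (fun n => ?_)
      (hasSum_sum_antidiagonal hJabs.hasSum).summable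
    rw [← hJn]
    exact Finset.abs_sum_le_sum_abs _ _
  · exact (hasSum_sum_antidiagonal hS).congr_fun fun n => (hJn n).symm

/-! ### Integration with respect to one-dimensional Laguerre measures -/

/-- Termwise integration in which integrability of the sum is concluded rather than assumed: the
integral of the sum of the absolute values is finite. -/
theorem integrable_and_integral_eq_of_hasSum {X ι : Type*} [MeasurableSpace X] [Countable ι]
    {μ : Measure X} {F : ι → X → ℝ} {f : X → ℝ} {S : ℝ} (hF : ∀ i, Integrable (F i) μ)
    (hn : Summable fun i => ∫ x, ‖F i x‖ ∂μ) (hS : HasSum (fun i => ∫ x, F i x ∂μ) S)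
    (hf : ∀ᵐ x ∂μ, HasSum (fun i => F i x) (f x)) : Integrable f μ ∧ ∫ x, f x ∂μ = S := by
  have h1 := hasSum_integral_of_summable_integral_norm hF hn
  have h2 : ∫ x, f x ∂μ = ∫ x, ∑' i, F i x ∂μ :=
    integral_congr_ae (hf.mono fun x hx => hx.tsum_eq.symm)
  refine ⟨?_, by rw [h2, h1.unique hS]⟩
  have h3 : ∀ i, ∫⁻ x, ‖F i x‖ₑ ∂μ = ENNReal.ofReal (∫ x, ‖F i x‖ ∂μ) := fun i =>
    (ofReal_integral_norm_eq_lintegral_enorm (hF i)).symm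
  have h4 : ∫⁻ x, ∑' i, ‖F i x‖ₑ ∂μ ≠ ∞ := by
    rw [lintegral_tsum fun i => (hF i).1.enorm, tsum_congr h3]
    exact hn.tsum_ofReal_ne_top
  refine ⟨?_, ?_⟩
  · rw [aestronglyMeasurable_congr (hf.mono fun x hx => hx.tsum_eq.symm)]
    exact (AEMeasurable.tsum fun i => (hF i).1.aemeasurable).aestronglyMeasurable
  · refine lt_of_le_of_lt (lintegral_mono_ae (hf.mono fun x hx => ?_)) h4.lt_top
    rw [← hx.tsum_eq]
    exact enorm_tsum_le_tsum_enorm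

/-- The measure `x^a e^{-x} dx` on `(0, ∞)`. -/
noncomputable def laguerreMeasureReal (a : ℝ) : Measure ℝ :=
  (volume.restrict (Set.Ioi 0)).withDensity fun x => ENNReal.ofReal (x ^ a * Real.exp (-x))

theorem ae_laguerreMeasureReal_pos (a : ℝ) : ∀ᵐ y ∂laguerreMeasureReal a, 0 < y :=
  (withDensity_absolutelyContinuous _ _).ae_le (ae_restrict_mem measurableSet_Ioi)

instance (a : ℝ) : SigmaFinite (laguerreMeasureReal a) := by
  unfold laguerreMeasureReal
  infer_instance

theorem integrable_laguerreMeasureReal_iff {a : ℝ} {f : ℝ → ℝ} :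
    Integrable f (laguerreMeasureReal a) ↔
      IntegrableOn (fun y => y ^ a * Real.exp (-y) * f y) (Set.Ioi 0) := by
  rw [laguerreMeasureReal, integrable_withDensity_iff_integrable_smul' (by fun_prop)
    (by simp), IntegrableOn]
  refine integrable_congr ?_
  filter_upwards [ae_restrict_mem measurableSet_Ioi] with y hy
  have : (0 : ℝ) < y := hy
  rw [ENNReal.toReal_ofReal (by positivity), smul_eq_mul]

theorem integral_laguerreMeasureReal (a : ℝ) (f : ℝ → ℝ) :
    ∫ y, f y ∂laguerreMeasureReal a = ∫ y in Set.Ioi 0, y ^ a * Real.exp (-y) * f y := by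
  rw [laguerreMeasureReal, integral_withDensity_eq_integral_toReal_smul (by fun_prop)
    (by simp)]
  refine integral_congr_ae ?_
  filter_upwards [ae_restrict_mem measurableSet_Ioi] with y hy
  have : (0 : ℝ) < y := hy
  rw [ENNReal.toReal_ofReal (by positivity), smul_eq_mul]

/-- A power of y is absorbed by a change of order of the measure. In this way the weight √y and the
moments of the Mehler kernel all reduce to `integral_mehlerKernel`. -/
theorem integrable_rpow_mul_laguerreMeasureReal_iff {a σ : ℝ} {f : ℝ → ℝ} :
    Integrable (fun y => y ^ σ * f y) (laguerreMeasureReal a) ↔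
      Integrable f (laguerreMeasureReal (a + σ)) := by
  rw [integrable_laguerreMeasureReal_iff, integrable_laguerreMeasureReal_iff]
  refine integrableOn_congr_fun (fun y hy => ?_) measurableSet_Ioi
  simp only [Real.rpow_add (Set.mem_Ioi.1 hy)]
  ring

theorem integral_rpow_mul_laguerreMeasureReal (a σ : ℝ) (f : ℝ → ℝ) :
    ∫ y, y ^ σ * f y ∂laguerreMeasureReal a = ∫ y, f y ∂laguerreMeasureReal (a + σ) := by
  rw [integral_laguerreMeasureReal, integral_laguerreMeasureReal]
  refine setIntegral_congr_fun measurableSet_Ioi fun y hy => ?_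
  simp only [Real.rpow_add (Set.mem_Ioi.1 hy)]
  ring

theorem integrable_exp_mul_pow_laguerreMeasureReal {a κ : ℝ} (ha : -1 < a) (hκ : -1 < κ)
    (m : ℕ) :
    Integrable (fun y => Real.exp (-(κ * y)) * y ^ m) (laguerreMeasureReal a) ∧
    ∫ y, Real.exp (-(κ * y)) * y ^ m ∂laguerreMeasureReal a =
      Real.Gamma (m + a + 1) / (1 + κ) ^ (m + a + 1) := by
  have hm : (0 : ℝ) ≤ m := by positivity
  have heq : Set.EqOn (fun y : ℝ => y ^ a * Real.exp (-y) * (Real.exp (-(κ * y)) * y ^ m))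
      (fun y => y ^ (m + a + 1 - 1) * Real.exp (-((1 + κ) * y))) (Set.Ioi 0) := by
    intro y hy
    have hy' : (0 : ℝ) < y := hy
    simp only
    rw [show (m : ℝ) + a + 1 - 1 = a + m by ring, Real.rpow_add hy', Real.rpow_natCast,
      show -((1 + κ) * y) = -y + -(κ * y) by ring, Real.exp_add]
    ring
  constructor
  · rw [integrable_laguerreMeasureReal_iff, integrableOn_congr_fun heq measurableSet_Ioi]
    have := integrableOn_rpow_mul_exp_neg_mul_rpow (p := 1) (s := m + a + 1 - 1) (b := 1 + κ)
      (by linarith) one_pos (by linarith)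
    simpa only [Real.rpow_one, neg_mul] using this
  · rw [integral_laguerreMeasureReal, setIntegral_congr_fun measurableSet_Ioi heq,
      Real.integral_rpow_mul_exp_neg_mul_Ioi (by linarith) (by linarith),
      Real.div_rpow zero_le_one (by linarith), Real.one_rpow]
    ring

theorem integrable_pow_laguerreMeasureReal {a : ℝ} (ha : -1 < a) (m : ℕ) :
    Integrable (fun y => y ^ m) (laguerreMeasureReal a) := by
  simpa using (integrable_exp_mul_pow_laguerreMeasureReal ha (κ := 0) (by norm_num) m).1

theorem integral_pow_laguerreMeasureReal {a : ℝ} (ha : -1 < a) (m : ℕ) :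
    ∫ y, y ^ m ∂laguerreMeasureReal a = Real.Gamma (m + a + 1) := by
  simpa using (integrable_exp_mul_pow_laguerreMeasureReal ha (κ := 0) (by norm_num) m).2

/-! ### Orthonormality of Laguerre polynomials -/

theorem laguerre_eq_sum (n : ℕ) (a y : ℝ) : laguerre n a y = ∑ m ∈ Finset.range (n + 1),
    (-1) ^ m * (Real.Gamma (n + a + 1) /
      (Real.Gamma (m + a + 1) * (n - m).factorial * m.factorial)) * y ^ m := by
  rw [laguerre]
  refine Finset.sum_congr rfl fun m _ => ?_
  rw [neg_pow]
  ring

theorem integrable_laguerre_mul_pow {a : ℝ} (ha : -1 < a) (n k : ℕ) :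
    Integrable (fun y => laguerre n a y * y ^ k) (laguerreMeasureReal a) := by
  simp only [laguerre_eq_sum, Finset.sum_mul, mul_assoc _ (_ ^ _) (_ ^ k), ← pow_add]
  exact integrable_finsetSum _ fun m _ => (integrable_pow_laguerreMeasureReal ha _).const_mul _

/-- The moment Γ(m + k + a + 1) is Γ(m + a + 1), which cancels the denominator of the m-th
coefficient, times the rising factorial of length k at m + a + 1. What remains is an alternating
binomial sum, that is, an n-th difference of a monic polynomial of degree k: it is 0 for k < n and
n! for k = n. -/
theorem integral_laguerre_mul_pow {a : ℝ} (ha : -1 < a) (n k : ℕ) :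
    ∫ y, laguerre n a y * y ^ k ∂laguerreMeasureReal a = (-1) ^ n * (Real.Gamma (n + a + 1) /
      n.factorial) * ((fwdDiff 1)^[n] (ascPochhammer ℝ k).eval) (a + 1) := by
  simp only [laguerre_eq_sum, Finset.sum_mul, mul_assoc _ (_ ^ _) (_ ^ k), ← pow_add]
  rw [integral_finsetSum _ fun m _ => (integrable_pow_laguerreMeasureReal ha _).const_mul _,
    fwdDiff_iter_eq_sum_shift, Finset.mul_sum]
  refine Finset.sum_congr rfl fun m hm => ?_
  have hmn : m ≤ n := Nat.lt_succ_iff.1 (Finset.mem_range.1 hm)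
  have h1 := Gamma_natCast_add_pos ha m
  have h2 := Real.Gamma_add_natCast (show 0 < m + a + 1 by
    have : (0 : ℝ) ≤ m := by positivity
    linarith) k
  rw [integral_const_mul, integral_pow_laguerreMeasureReal ha,
    show ((m + k : ℕ) : ℝ) + a + 1 = m + a + 1 + k by push_cast; ring, h2, zsmul_eq_mul,
    nsmul_eq_mul, mul_one, show a + 1 + (m : ℝ) = m + a + 1 by ring]
  push_cast
  rw [Nat.cast_choose ℝ hmn]
  have h3 : ((-1 : ℝ)) ^ n * (-1) ^ (n - m) = (-1) ^ m := by
    obtain ⟨j, rfl⟩ := Nat.exists_eq_add_of_le hmn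
    rw [Nat.add_sub_cancel_left, pow_add, mul_assoc, ← mul_pow]
    simp
  rw [← h3]
  field_simp

theorem integral_laguerre_mul_laguerre {a : ℝ} (ha : -1 < a) (n m : ℕ) :
    Integrable (fun y => laguerre n a y * laguerre m a y) (laguerreMeasureReal a) ∧
    ∫ y, laguerre n a y * laguerre m a y ∂laguerreMeasureReal a =
      if n = m then Real.Gamma (n + a + 1) / n.factorial else 0 := by
  -- The polynomial of lower degree is the one expanded in powers, so at most its top power
  -- survives.
  wlog hmn : m ≤ n generalizing n m
  · have := this m n (by omega)
    simp only [mul_comm (laguerre n a _)]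
    refine ⟨this.1, this.2.trans ?_⟩
    rw [if_neg (by omega), if_neg (by omega)]
  have hi : ∀ k ∈ Finset.range (m + 1), Integrable (fun y => (-1) ^ k * (Real.Gamma (m + a + 1) /
      (Real.Gamma (k + a + 1) * (m - k).factorial * k.factorial)) * (laguerre n a y * y ^ k))
      (laguerreMeasureReal a) := fun k _ => (integrable_laguerre_mul_pow ha n k).const_mul _
  have he : (fun y => laguerre n a y * laguerre m a y) = fun y => ∑ k ∈ Finset.range (m + 1),
      (-1) ^ k * (Real.Gamma (m + a + 1) /
      (Real.Gamma (k + a + 1) * (m - k).factorial * k.factorial)) * (laguerre n a y * y ^ k) := by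
    ext y
    rw [laguerre_eq_sum m, Finset.mul_sum]
    exact Finset.sum_congr rfl fun k _ => by ring
  have hz : ∀ k, k < n → ∫ y, laguerre n a y * y ^ k ∂laguerreMeasureReal a = 0 := fun k hk => by
    rw [integral_laguerre_mul_pow ha, Polynomial.fwdDiff_iter_eq_zero_of_degree_lt (by
      rwa [ascPochhammer_natDegree])]
    simp
  rw [he]
  refine ⟨integrable_finsetSum _ hi, ?_⟩
  rw [integral_finsetSum _ hi]
  simp only [integral_const_mul]
  rw [Finset.sum_range_succ, Finset.sum_eq_zero fun k hk => by
    rw [hz k (by have := Finset.mem_range.1 hk; omega), mul_zero], zero_add]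
  rcases hmn.eq_or_lt with rfl | hlt
  · have h1 := Polynomial.fwdDiff_iter_degree_eq_factorial (ascPochhammer ℝ m)
    rw [ascPochhammer_natDegree, (monic_ascPochhammer ℝ m).leadingCoeff, one_smul] at h1
    have h2 := (Gamma_natCast_add_pos ha m).ne'
    rw [if_pos rfl, integral_laguerre_mul_pow ha, h1]
    simp only [Pi.natCast_apply, Nat.sub_self, Nat.factorial_zero, Nat.cast_one]
    have h3 : ((-1 : ℝ)) ^ m * (-1) ^ m = 1 := by rw [← mul_pow]; simp
    field_simp
    linear_combination h3
  · rw [hz m hlt, mul_zero, if_neg hlt.ne']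

theorem integral_normLaguerre_mul {a : ℝ} (ha : -1 < a) (n m : ℕ) :
    Integrable (fun y => normLaguerre n a y * normLaguerre m a y) (laguerreMeasureReal a) ∧
    ∫ y, normLaguerre n a y * normLaguerre m a y ∂laguerreMeasureReal a =
      if n = m then 1 else 0 := by
  obtain ⟨h1, h2⟩ := integral_laguerre_mul_laguerre ha n m
  have he : (fun y => normLaguerre n a y * normLaguerre m a y) = fun y =>
      √(Real.Gamma (n + 1) / Real.Gamma (n + a + 1)) *
        √(Real.Gamma (m + 1) / Real.Gamma (m + a + 1)) * (laguerre n a y * laguerre m a y) := by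
    ext y
    rw [normLaguerre, normLaguerre]
    ring
  rw [he]
  refine ⟨h1.const_mul _, ?_⟩
  rw [integral_const_mul, h2]
  split_ifs with h
  · subst h
    have h3 := Gamma_natCast_add_pos ha n
    have h4 : 0 < Real.Gamma (n + 1) := Real.Gamma_pos_of_pos (by positivity)
    rw [Real.mul_self_sqrt (by positivity), ← Real.Gamma_nat_eq_factorial]
    field_simp
  · simp

/-! ### Integrals of the Mehler kernel -/

/-- Termwise integration of the Bessel series. The order ρ of the measure is kept free: ρ = b gives
the total mass, ρ = b + 1 and b + 2 the moments, ρ = b - 1/2 the mass of the modified kernel. The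
remaining sum depends on ρ and is left as a hypothesis. -/
theorem integral_mehlerKernel {b ρ r x S : ℝ} (hb : -1 < b) (hρ : -1 < ρ) (hr0 : 0 ≤ r)
    (hr : r < 1) (hS : HasSum (fun m : ℕ => (r * |x| / (1 - r)) ^ m / m.factorial *
      (Real.Gamma (m + ρ + 1) / Real.Gamma (m + b + 1))) S) :
    Integrable (mehlerKernel b r x) (laguerreMeasureReal ρ) ∧
    ∫ y, mehlerKernel b r x y ∂laguerreMeasureReal ρ =
      Real.exp (-(r * |x| / (1 - r))) * (1 - r) ^ (ρ - b) * S := by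
  have h1r : 0 < 1 - r := by linarith
  have hκ : 0 ≤ r / (1 - r) := by positivity
  have hG := fun m => integrable_exp_mul_pow_laguerreMeasureReal hρ (κ := r / (1 - r))
    (by linarith) m
  set c : ℕ → ℝ := fun m => (1 - r) ^ (-b - 1) * Real.exp (-(r * |x| / (1 - r))) *
    ((r * |x| / (1 - r) ^ 2) ^ m / (m.factorial * Real.Gamma (m + b + 1))) with hc
  have hc0 : ∀ m, 0 ≤ c m := fun m => by
    have := Gamma_natCast_add_pos hb m
    have := Real.rpow_nonneg h1r.le (-b - 1)
    positivity
  have hval : ∀ m, ∫ y, c m * (Real.exp (-(r / (1 - r) * y)) * y ^ m) ∂laguerreMeasureReal ρ =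
      Real.exp (-(r * |x| / (1 - r))) * (1 - r) ^ (ρ - b) * ((r * |x| / (1 - r)) ^ m /
        m.factorial * (Real.Gamma (m + ρ + 1) / Real.Gamma (m + b + 1))) := by
    intro m
    rw [integral_const_mul, (hG m).2, show 1 + r / (1 - r) = (1 - r)⁻¹ by field_simp; ring,
      Real.inv_rpow h1r.le, show (m : ℝ) + ρ + 1 = (ρ - b) + (m - (-b - 1)) by ring,
      Real.rpow_add h1r, Real.rpow_sub h1r m, Real.rpow_natCast, hc]
    have h2 := (Gamma_natCast_add_pos hb m).ne'
    have h3 := (Real.rpow_pos_of_pos h1r (-b - 1)).ne'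
    have h4 : (r * |x| / (1 - r) ^ 2) ^ m = (r * |x| / (1 - r)) ^ m / (1 - r) ^ m := by
      rw [← div_pow]
      congr 1
      field_simp
    simp only [h4]
    have h5 := (pow_pos h1r m).ne'
    field_simp
  have hint : ∀ m, Integrable (fun y => c m * (Real.exp (-(r / (1 - r) * y)) * y ^ m))
      (laguerreMeasureReal ρ) := fun m => (hG m).1.const_mul _
  have hsum := hS.mul_left (Real.exp (-(r * |x| / (1 - r))) * (1 - r) ^ (ρ - b))
  refine integrable_and_integral_eq_of_hasSum hint ?_ (hsum.congr_fun hval) ?_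
  · refine (hsum.congr_fun hval).summable.congr fun m => integral_congr_ae ?_
    filter_upwards [ae_laguerreMeasureReal_pos ρ] with y hy
    rw [Real.norm_of_nonneg]
    have := hc0 m
    positivity
  · filter_upwards [ae_laguerreMeasureReal_pos ρ] with y hy
    have h2 := (hasSum_besselSeries hb (r * (|x| * |y|) / (1 - r) ^ 2)).mul_left
      ((1 - r) ^ (-b - 1) * Real.exp (-(r * (|x| + |y|) / (1 - r))))
    refine h2.congr_fun fun m => ?_
    rw [abs_of_pos hy, show -(r * (|x| + y) / (1 - r)) =
      -(r * |x| / (1 - r)) + -(r / (1 - r) * y) by ring, Real.exp_add,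
      show r * (|x| * y) / (1 - r) ^ 2 = r * |x| / (1 - r) ^ 2 * y by ring, mul_pow]
    ring

/-! ### Properties of the Mehler kernel -/

theorem mehlerKernel_abs_left (a r x y : ℝ) : mehlerKernel a r |x| y = mehlerKernel a r x y := by
  simp [mehlerKernel]

theorem mehlerKernel_symm (a r x y : ℝ) : mehlerKernel a r x y = mehlerKernel a r y x := by
  simp only [mehlerKernel, mul_comm |x| |y|, add_comm |x| |y|]

theorem mehlerKernel_abs_right (a r x y : ℝ) :
    mehlerKernel a r x |y| = mehlerKernel a r x y := by
  simp [mehlerKernel]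

theorem besselSeries_nonneg {a w : ℝ} (ha : -1 < a) (hw : 0 ≤ w) : 0 ≤ besselSeries a w :=
  tsum_nonneg fun m => by
    have := Gamma_natCast_add_pos ha m
    positivity

theorem mehlerKernel_nonneg {a r : ℝ} (ha : -1 < a) (hr0 : 0 ≤ r) (hr : r < 1) (x y : ℝ) :
    0 ≤ mehlerKernel a r x y := by
  have h1 : 0 < 1 - r := by linarith
  have := besselSeries_nonneg (w := r * (|x| * |y|) / (1 - r) ^ 2) ha (by positivity)
  have := Real.rpow_nonneg h1.le (-a - 1)
  unfold mehlerKernel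
  positivity

theorem measurable_mehlerKernel (a r : ℝ) :
    Measurable fun p : ℝ × ℝ => mehlerKernel a r p.1 p.2 := by
  have h : Measurable (besselSeries a) := by
    unfold besselSeries
    exact Measurable.tsum fun m => by fun_prop
  unfold mehlerKernel
  fun_prop

/-- With δ = r/(2(1 - r)) the exponential factor is at most e^{-2δ|y|}, while the Bessel factor
grows at most like e^{δ|y|}: its argument is 2|x|/(1 - r) times δ|y|, and the powers of the first
number are beaten by Γ. -/
theorem exists_mehlerKernel_le {a r : ℝ} (ha : -1 < a) (hr0 : 0 < r) (hr : r < 1) (x : ℝ) :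
    ∃ C δ, 0 < C ∧ 0 < δ ∧ ∀ y, mehlerKernel a r x y ≤ C * Real.exp (-(δ * |y|)) := by
  have h1r : 0 < 1 - r := by linarith
  obtain ⟨C, hC, hb⟩ := exists_pow_div_Gamma_le ha (D := 2 * |x| / (1 - r)) (by positivity)
  have hp := Real.rpow_pos_of_pos h1r (-a - 1)
  refine ⟨(1 - r) ^ (-a - 1) * C, r / (2 * (1 - r)), by positivity, by positivity, fun y => ?_⟩
  have hbes : besselSeries a (r * (|x| * |y|) / (1 - r) ^ 2) ≤
      C * Real.exp (r / (2 * (1 - r)) * |y|) := by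
    refine hasSum_le (fun m => ?_) (hasSum_besselSeries ha _)
      ((Real.hasSum_exp' (r / (2 * (1 - r)) * |y|)).mul_left C)
    have hG := Gamma_natCast_add_pos ha m
    have he : r * (|x| * |y|) / (1 - r) ^ 2 =
        2 * |x| / (1 - r) * (r / (2 * (1 - r)) * |y|) := by field_simp
    rw [he, mul_pow]
    calc _ = (2 * |x| / (1 - r)) ^ m / Real.Gamma (m + a + 1) *
          ((r / (2 * (1 - r)) * |y|) ^ m / m.factorial) := by field_simp
      _ ≤ _ := by gcongr; exact hb m
  have hbes0 : 0 ≤ besselSeries a (r * (|x| * |y|) / (1 - r) ^ 2) :=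
    besselSeries_nonneg ha (by positivity)
  rw [mehlerKernel]
  have h3 : Real.exp (-(r * (|x| + |y|) / (1 - r))) ≤
      Real.exp (-(r / (2 * (1 - r)) * |y|)) * Real.exp (-(r / (2 * (1 - r)) * |y|)) := by
    rw [← Real.exp_add, Real.exp_le_exp]
    have : r * (|x| + |y|) / (1 - r) =
      r * |x| / (1 - r) + (r / (2 * (1 - r)) * |y| + r / (2 * (1 - r)) * |y|) := by field_simp; ring
    rw [this]
    have : 0 ≤ r * |x| / (1 - r) := by positivity
    linarith
  calc _ ≤ (1 - r) ^ (-a - 1) * (Real.exp (-(r / (2 * (1 - r)) * |y|)) *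
        Real.exp (-(r / (2 * (1 - r)) * |y|))) * (C * Real.exp (r / (2 * (1 - r)) * |y|)) := by
        gcongr
    _ = _ := by
        have : Real.exp (-(r / (2 * (1 - r)) * |y|)) * Real.exp (r / (2 * (1 - r)) * |y|) = 1 := by
          rw [← Real.exp_add]; simp
        linear_combination (1 - r) ^ (-a - 1) * C * Real.exp (-(r / (2 * (1 - r)) * |y|)) * this

theorem exists_sqrt_mul_mehlerKernel_le {a r : ℝ} (ha : -1 < a) (hr0 : 0 < r) (hr : r < 1)
    (x : ℝ) : ∃ M, ∀ y, mehlerKernel a r x y ≤ M ∧ √|y| * mehlerKernel a r x y ≤ M := by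
  obtain ⟨C, δ, hC, hδ, h⟩ := exists_mehlerKernel_le ha hr0 hr x
  refine ⟨C * (1 + 1 / δ), fun y => ?_⟩
  have hexp : Real.exp (-(δ * |y|)) ≤ 1 := Real.exp_le_one_iff.2 (by
    have : 0 ≤ δ * |y| := by positivity
    linarith)
  have h1 : |y| * Real.exp (-(δ * |y|)) ≤ 1 / δ := by
    rw [Real.exp_neg, ← div_eq_mul_inv, div_le_div_iff₀ (Real.exp_pos _) hδ]
    have := Real.add_one_le_exp (δ * |y|)
    linarith
  have h2 : √|y| ≤ 1 + |y| := Real.sqrt_le_iff.2 ⟨by positivity, by nlinarith [abs_nonneg y]⟩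
  have h3 : (1 + |y|) * Real.exp (-(δ * |y|)) ≤ 1 + 1 / δ := by linarith
  constructor
  · refine (h y).trans ?_
    gcongr
    exact hexp.trans (by have : 0 < 1 / δ := by positivity
                         linarith)
  · calc √|y| * mehlerKernel a r x y ≤ (1 + |y|) * (C * Real.exp (-(δ * |y|))) := by
          gcongr
          · exact mehlerKernel_nonneg ha hr0.le hr x y
          · exact h y
      _ = C * ((1 + |y|) * Real.exp (-(δ * |y|))) := by ring
      _ ≤ _ := by gcongr

/-! ### The Chapman–Kolmogorov identity and the one-dimensional modified kernel. -/

theorem summable_pow_mul_abs_normLaguerre {a : ℝ} (ha : -1 < a) {r : ℝ} (hr0 : 0 ≤ r)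
    (hr : r < 1) {x : ℝ} (hx : 0 ≤ x) : Summable fun n => r ^ n * |normLaguerre n a x| := by
  have h1 := (hasSum_normLaguerre_mul ha hr0 hr hx hx).2.summable
  refine Summable.of_nonneg_of_le (fun n => by positivity) (fun n => ?_)
    (h1.add (summable_geometric_of_lt_one hr0 hr))
  -- The bound |u| ≤ u² + 1 reduces the claim to the Hille–Hardy series on the diagonal plus a
  -- geometric series.
  have h2 : |normLaguerre n a x| ≤ normLaguerre n a x * normLaguerre n a x + 1 := by
    rw [← abs_mul_abs_self]
    nlinarith [abs_nonneg (normLaguerre n a x), sq_nonneg (|normLaguerre n a x| - 1)]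
  calc _ ≤ r ^ n * (normLaguerre n a x * normLaguerre n a x + 1) := by gcongr
    _ = _ := by ring

/-- Expand both kernels in Laguerre polynomials and integrate the double series term by term;
orthonormality leaves only the diagonal, which is the expansion for rs. Products of two normalised
polynomials have L^1 norm at most 1, so the coefficients alone provide absolute convergence. -/
theorem integral_mehlerKernel_mul_mehlerKernel {a r s : ℝ} (ha : -1 < a) (hr0 : 0 ≤ r)
    (hr : r < 1) (hs0 : 0 ≤ s) (hs : s < 1) (x z : ℝ) :
    Integrable (fun y => mehlerKernel a r x y * mehlerKernel a s y z) (laguerreMeasureReal a) ∧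
    ∫ y, mehlerKernel a r x y * mehlerKernel a s y z ∂laguerreMeasureReal a =
      mehlerKernel a (r * s) x z := by
  wlog h0 : 0 ≤ x ∧ 0 ≤ z generalizing x z
  · simpa only [mehlerKernel_abs_left, mehlerKernel_abs_right] using
      this |x| |z| ⟨abs_nonneg x, abs_nonneg z⟩
  obtain ⟨hx, hz⟩ := h0
  have hrs : r * s < 1 := by nlinarith
  set c : ℕ × ℕ → ℝ := fun p => r ^ p.1 * normLaguerre p.1 a x * (s ^ p.2 * normLaguerre p.2 a z)
    with hc
  have hcs : Summable fun p => |c p| := by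
    have h1 := summable_pow_mul_abs_normLaguerre ha hr0 hr hx
    have h2 := summable_pow_mul_abs_normLaguerre ha hs0 hs hz
    refine (h1.mul_of_nonneg h2 (fun _ => by positivity) (fun _ => by positivity)).congr fun p => ?_
    rw [hc, abs_mul, abs_mul, abs_mul, abs_pow, abs_pow, abs_of_nonneg hr0, abs_of_nonneg hs0]
  have hI : ∀ p : ℕ × ℕ, Integrable (fun y => c p * (normLaguerre p.1 a y * normLaguerre p.2 a y))
      (laguerreMeasureReal a) := fun p => (integral_normLaguerre_mul ha p.1 p.2).1.const_mul _
  have hn : ∀ p : ℕ × ℕ, ∫ y, ‖normLaguerre p.1 a y * normLaguerre p.2 a y‖ ∂laguerreMeasureReal a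
      ≤ 1 := by
    intro p
    obtain ⟨h1, h2⟩ := integral_normLaguerre_mul ha p.1 p.1
    obtain ⟨h3, h4⟩ := integral_normLaguerre_mul ha p.2 p.2
    rw [if_pos rfl] at h2 h4
    calc _ ≤ ∫ y, 1 / 2 * (normLaguerre p.1 a y * normLaguerre p.1 a y +
          normLaguerre p.2 a y * normLaguerre p.2 a y) ∂laguerreMeasureReal a := by
          refine integral_mono (integral_normLaguerre_mul ha p.1 p.2).1.norm
            ((h1.add h3).const_mul _) fun y => ?_
          simp only [Real.norm_eq_abs, abs_mul]
          rw [← abs_mul_abs_self (normLaguerre p.1 a y), ← abs_mul_abs_self (normLaguerre p.2 a y)]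
          nlinarith [sq_nonneg (|normLaguerre p.1 a y| - |normLaguerre p.2 a y|)]
      _ = 1 := by
          rw [integral_const_mul, integral_add h1 h3, h2, h4]
          norm_num
  have hval : ∀ p : ℕ × ℕ, ∫ y, c p * (normLaguerre p.1 a y * normLaguerre p.2 a y)
      ∂laguerreMeasureReal a = if p.2 = p.1 then c p else 0 := by
    intro p
    rw [integral_const_mul, (integral_normLaguerre_mul ha p.1 p.2).2]
    simp only [mul_ite, mul_one, mul_zero, eq_comm]
  refine integrable_and_integral_eq_of_hasSum hI ?_ ?_ ?_
  · refine Summable.of_nonneg_of_le (fun p => integral_nonneg fun _ => norm_nonneg _)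
      (fun p => ?_) hcs
    simp only [norm_mul (c p)]
    rw [integral_const_mul]
    exact (mul_le_mul_of_nonneg_left (hn p) (norm_nonneg _)).trans (by simp)
  · simp only [hval]
    have hs1 : Summable fun p : ℕ × ℕ => if p.2 = p.1 then c p else 0 := by
      refine Summable.of_norm_bounded hcs fun p => ?_
      split_ifs <;> simp
    have h2 : ∀ n : ℕ, HasSum (fun m => if m = n then c (n, m) else 0)
        ((r * s) ^ n * (normLaguerre n a x * normLaguerre n a z)) := by
      intro n
      have he : (fun m => if m = n then c (n, m) else 0) = fun m =>
          if m = n then (r * s) ^ n * (normLaguerre n a x * normLaguerre n a z) else 0 := by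
        ext m
        split_ifs with h
        · subst h
          simp only [hc, mul_pow]
          ring
        · rfl
      rw [he]
      exact hasSum_ite_eq n _
    have h3 := hs1.hasSum.prod_fiberwise h2
    rw [(hasSum_normLaguerre_mul ha (by positivity) hrs hx hz).2.unique h3]
    exact hs1.hasSum
  · filter_upwards [ae_laguerreMeasureReal_pos a] with y hy
    obtain ⟨h1, h2⟩ := hasSum_normLaguerre_mul ha hr0 hr hx hy.le
    obtain ⟨h3, h4⟩ := hasSum_normLaguerre_mul ha hs0 hs hy.le hz
    refine (h2.mul h4 (summable_mul_of_summable_norm (f := fun n => r ^ n *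
      (normLaguerre n a x * normLaguerre n a y)) (g := fun n => s ^ n *
      (normLaguerre n a y * normLaguerre n a z)) h1 h3)).congr_fun fun p => ?_
    simp only [hc]
    ring

/-- The kernel `r √(xy) K_r^{a+1}(x, y)` of the modified one-dimensional semigroup. -/
noncomputable def modifiedMehlerKernel (a r x y : ℝ) : ℝ :=
  r * (√|x| * √|y| * mehlerKernel (a + 1) r x y)

/-- The two factors √y multiply to y, which turns the measure of order a into the one of order a +
1, where the kernels of order a + 1 reproduce. -/
theorem integral_modifiedMehlerKernel_mul {a r s : ℝ} (ha : -2 < a) (hr0 : 0 ≤ r)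
    (hr : r < 1) (hs0 : 0 ≤ s) (hs : s < 1) (x z : ℝ) :
    ∫ y, modifiedMehlerKernel a r x y * modifiedMehlerKernel a s y z ∂laguerreMeasureReal a =
      modifiedMehlerKernel a (r * s) x z := by
  have h := (integral_mehlerKernel_mul_mehlerKernel (a := a + 1) (by linarith) hr0 hr hs0 hs x z).2
  rw [← integral_rpow_mul_laguerreMeasureReal] at h
  rw [modifiedMehlerKernel, ← h, ← integral_const_mul, ← integral_const_mul]
  refine integral_congr_ae ?_
  filter_upwards [ae_laguerreMeasureReal_pos a] with y hy
  have h1 : √y * √y = y := Real.mul_self_sqrt hy.le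
  simp only [modifiedMehlerKernel, abs_of_pos hy, Real.rpow_one]
  linear_combination r * √|x| * √|z| * s * mehlerKernel (a + 1) r x y *
    mehlerKernel (a + 1) s y z * h1

theorem integral_mehlerKernel_self {a r : ℝ} (ha : -1 < a) (hr0 : 0 ≤ r) (hr : r < 1) (x : ℝ) :
    Integrable (mehlerKernel a r x) (laguerreMeasureReal a) ∧
    ∫ y, mehlerKernel a r x y ∂laguerreMeasureReal a = 1 := by
  have h := integral_mehlerKernel (x := x) ha ha hr0 hr
    ((Real.hasSum_exp' (r * |x| / (1 - r))).congr_fun fun m => by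
      rw [div_self (Gamma_natCast_add_pos ha m).ne', mul_one])
  refine ⟨h.1, h.2.trans ?_⟩
  rw [sub_self, Real.rpow_zero, mul_one, ← Real.exp_add]
  simp

/-! ### The mass of the modified kernel -/

/-- The Beta integral, read off from the fact that the Beta density has total mass 1. -/
theorem integral_rpow_mul_one_sub_rpow {p q : ℝ} (hp : 0 < p) (hq : 0 < q) :
    IntegrableOn (fun v : ℝ => v ^ (p - 1) * (1 - v) ^ (q - 1)) (Set.Ioo 0 1) ∧
    ∫ v in Set.Ioo (0 : ℝ) 1, v ^ (p - 1) * (1 - v) ^ (q - 1) =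
      Real.Gamma p * Real.Gamma q / Real.Gamma (p + q) := by
  have hB := ProbabilityTheory.beta_pos hp hq
  have h := ProbabilityTheory.lintegral_betaPDF_eq_one hp hq
  rw [ProbabilityTheory.lintegral_betaPDF] at h
  have h0 : 0 ≤ᵐ[volume.restrict (Set.Ioo (0 : ℝ) 1)]
      fun v => 1 / ProbabilityTheory.beta p q * v ^ (p - 1) * (1 - v) ^ (q - 1) := by
    filter_upwards [ae_restrict_mem measurableSet_Ioo] with v hv
    have h1 : 0 < v := hv.1
    have h2 : 0 < 1 - v := by linarith [hv.2]
    have := Real.rpow_pos_of_pos h2 (q - 1)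
    positivity
  have hm : AEStronglyMeasurable
      (fun v => 1 / ProbabilityTheory.beta p q * v ^ (p - 1) * (1 - v) ^ (q - 1))
      (volume.restrict (Set.Ioo (0 : ℝ) 1)) := Measurable.aestronglyMeasurable (by fun_prop)
  have hi : Integrable
      (fun v => 1 / ProbabilityTheory.beta p q * v ^ (p - 1) * (1 - v) ^ (q - 1))
      (volume.restrict (Set.Ioo (0 : ℝ) 1)) :=
    (lintegral_ofReal_ne_top_iff_integrable hm h0).1 (by rw [h]; simp)
  have hval := integral_eq_lintegral_of_nonneg_ae h0 hm
  rw [h, ENNReal.toReal_one] at hval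
  simp only [mul_assoc] at hi hval
  rw [integral_const_mul] at hval
  refine ⟨?_, ?_⟩
  · refine (hi.const_mul (ProbabilityTheory.beta p q)).congr (ae_of_all _ fun v => ?_)
    simp only
    field_simp
  · rw [← ProbabilityTheory.beta]
    field_simp at hval
    exact hval

/-- The function `√z e^{-z} ∑ z^m / m! Γ(m + b + 1/2) / Γ(m + b + 1)`. -/
noncomputable def modifiedMass (b z : ℝ) : ℝ :=
  √z * Real.exp (-z) * ∑' m : ℕ, z ^ m / m.factorial *
    (Real.Gamma (m + (b - 1 / 2) + 1) / Real.Gamma (m + b + 1))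

theorem Gamma_ratio_pos {b : ℝ} (hb : -1 / 2 < b) (m : ℕ) :
    0 < Real.Gamma (m + (b - 1 / 2) + 1) / Real.Gamma (m + b + 1) :=
  div_pos (Gamma_natCast_add_pos (by linarith) m) (Gamma_natCast_add_pos (by linarith) m)

/-- Raising b by one is the same as raising m by one. The recursion thus yields both monotonicity in
m (`Gamma_ratio_le`) and the comparison of the masses at b and b + 1. -/
theorem Gamma_ratio_add_one {b : ℝ} (hb : -1 / 2 < b) (m : ℕ) :
    Real.Gamma (m + (b + 1 - 1 / 2) + 1) / Real.Gamma (m + (b + 1) + 1) =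
      (m + b + 1 / 2) / (m + b + 1) *
        (Real.Gamma (m + (b - 1 / 2) + 1) / Real.Gamma (m + b + 1)) := by
  have hm : (0 : ℝ) ≤ m := by positivity
  have h1 : (0 : ℝ) < m + (b - 1 / 2) + 1 := by linarith
  have h2 : (0 : ℝ) < m + b + 1 := by linarith
  rw [show (m : ℝ) + (b + 1 - 1 / 2) + 1 = m + (b - 1 / 2) + 1 + 1 by ring,
    show (m : ℝ) + (b + 1) + 1 = m + b + 1 + 1 by ring, Real.Gamma_add_one h1.ne',
    Real.Gamma_add_one h2.ne', mul_div_mul_comm]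
  congr 2
  ring

theorem Gamma_ratio_le {b : ℝ} (hb : -1 / 2 < b) (m : ℕ) :
    Real.Gamma (m + (b - 1 / 2) + 1) / Real.Gamma (m + b + 1) ≤
      Real.Gamma (b - 1 / 2 + 1) / Real.Gamma (b + 1) := by
  induction m with
  | zero => simp
  | succ n ih =>
    refine le_trans ?_ ih
    have h := Gamma_ratio_add_one hb n
    rw [show ((n : ℝ) + (b + 1 - 1 / 2) + 1) = ((n + 1 : ℕ) : ℝ) + (b - 1 / 2) + 1 by
      push_cast; ring, show ((n : ℝ) + (b + 1) + 1) = ((n + 1 : ℕ) : ℝ) + b + 1 by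
      push_cast; ring] at h
    rw [h]
    refine mul_le_of_le_one_left (Gamma_ratio_pos hb n).le ?_
    have hn : (0 : ℝ) ≤ n := by positivity
    rw [div_le_one (by linarith)]
    linarith

theorem hasSum_modifiedMass {b z : ℝ} (hb : -1 / 2 < b) (hz : 0 ≤ z) :
    HasSum (fun m : ℕ => z ^ m / m.factorial *
      (Real.Gamma (m + (b - 1 / 2) + 1) / Real.Gamma (m + b + 1)))
      (∑' m : ℕ, z ^ m / m.factorial *
        (Real.Gamma (m + (b - 1 / 2) + 1) / Real.Gamma (m + b + 1))) := by
  refine (Summable.of_nonneg_of_le (fun m => ?_) (fun m => ?_) ((Real.hasSum_exp' z).summable.mul_right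
    (Real.Gamma (b - 1 / 2 + 1) / Real.Gamma (b + 1)))).hasSum
  · have := Gamma_ratio_pos hb m
    positivity
  · exact mul_le_mul_of_nonneg_left (Gamma_ratio_le hb m) (by positivity)

/-- The factor √y is moved into the measure, so `integral_mehlerKernel` applies with ρ = b - 1/2, b
= a + 1, and contributes (1 - r)^{-1/2}. Then r √|x| / √(1 - r) = √r √z. -/
theorem integral_modifiedMehlerKernel {a r : ℝ} (ha : -3 / 2 < a) (hr0 : 0 ≤ r) (hr : r < 1)
    (x : ℝ) :
    Integrable (modifiedMehlerKernel a r x) (laguerreMeasureReal a) ∧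
    ∫ y, modifiedMehlerKernel a r x y ∂laguerreMeasureReal a =
      √r * modifiedMass (a + 1) (r * |x| / (1 - r)) := by
  have h1r : 0 < 1 - r := by linarith
  obtain ⟨h1, h2⟩ := integral_mehlerKernel (b := a + 1) (ρ := a + 1 / 2) (x := x) (by linarith)
    (by linarith) hr0 hr ((hasSum_modifiedMass (b := a + 1) (z := r * |x| / (1 - r))
      (by linarith) (by positivity)).congr_fun fun m => by
        rw [show a + 1 - 1 / 2 = a + 1 / 2 by ring])
  rw [← integrable_rpow_mul_laguerreMeasureReal_iff] at h1
  rw [← integral_rpow_mul_laguerreMeasureReal] at h2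
  have he : modifiedMehlerKernel a r x =ᵐ[laguerreMeasureReal a]
      fun y => r * √|x| * (y ^ (1 / 2 : ℝ) * mehlerKernel (a + 1) r x y) := by
    filter_upwards [ae_laguerreMeasureReal_pos a] with y hy
    rw [modifiedMehlerKernel, abs_of_pos hy, ← Real.sqrt_eq_rpow]
    ring
  refine ⟨(h1.const_mul _).congr he.symm, ?_⟩
  rw [integral_congr_ae he, integral_const_mul, h2, modifiedMass,
    show a + 1 / 2 - (a + 1) = -(1 / 2) by ring, Real.rpow_neg h1r.le, ← Real.sqrt_eq_rpow,
    Real.sqrt_div (by positivity), Real.sqrt_mul hr0]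
  have h3 := Real.mul_self_sqrt hr0
  have h4 := (Real.sqrt_pos.2 h1r).ne'
  generalize (∑' m : ℕ, _ : ℝ) = S
  field_simp
  rw [Real.sq_sqrt hr0]
  ring

/-- Up to the factor √π, each ratio of Gamma values is a Beta integral of v^{-1/2} (1 -
v)^{m+b-1/2}; summing over m under the integral produces e^{z(1-v)}. -/
theorem modifiedMass_eq_integral {b z : ℝ} (hb : -1 / 2 < b) (hz : 0 ≤ z) :
    IntegrableOn (fun v => Real.exp (-(z * v)) * (v ^ (-(1 / 2) : ℝ) * (1 - v) ^ (b - 1 / 2)))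
      (Set.Ioo 0 1) ∧
    modifiedMass b z = √z / √Real.pi * ∫ v in Set.Ioo (0 : ℝ) 1,
      Real.exp (-(z * v)) * (v ^ (-(1 / 2) : ℝ) * (1 - v) ^ (b - 1 / 2)) := by
  have hB : ∀ m : ℕ, IntegrableOn (fun v : ℝ => v ^ (-(1 / 2) : ℝ) * (1 - v) ^ (b - 1 / 2) *
      (1 - v) ^ m) (Set.Ioo 0 1) ∧ ∫ v in Set.Ioo (0 : ℝ) 1, v ^ (-(1 / 2) : ℝ) *
        (1 - v) ^ (b - 1 / 2) * (1 - v) ^ m =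
      √Real.pi * (Real.Gamma (m + (b - 1 / 2) + 1) / Real.Gamma (m + b + 1)) := by
    intro m
    have hm : (0 : ℝ) ≤ m := by positivity
    have h := integral_rpow_mul_one_sub_rpow (p := 1 / 2) (q := m + (b - 1 / 2) + 1) (by norm_num)
      (by linarith)
    have he : Set.EqOn (fun v : ℝ => v ^ ((1 / 2 : ℝ) - 1) *
        (1 - v) ^ ((m : ℝ) + (b - 1 / 2) + 1 - 1)) (fun v : ℝ => v ^ (-(1 / 2) : ℝ) *
        (1 - v) ^ (b - 1 / 2) * (1 - v) ^ m) (Set.Ioo 0 1) := by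
      intro v hv
      have h2 : 0 < 1 - v := by linarith [hv.2]
      simp only
      rw [show (m : ℝ) + (b - 1 / 2) + 1 - 1 = (b - 1 / 2) + m by ring, Real.rpow_add h2,
        Real.rpow_natCast, show ((1 / 2 : ℝ) - 1) = -(1 / 2) by norm_num]
      ring
    rw [integrableOn_congr_fun he measurableSet_Ioo,
      setIntegral_congr_fun measurableSet_Ioo he, Real.Gamma_one_half_eq,
      show 1 / 2 + ((m : ℝ) + (b - 1 / 2) + 1) = m + b + 1 by ring, mul_div_assoc] at h
    exact h
  have hpos : ∀ᵐ v ∂volume.restrict (Set.Ioo (0 : ℝ) 1), 0 < v ∧ 0 < 1 - v := by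
    filter_upwards [ae_restrict_mem measurableSet_Ioo] with v hv
    exact ⟨hv.1, by linarith [hv.2]⟩
  have hval : ∀ m : ℕ, ∫ v in Set.Ioo (0 : ℝ) 1, √z * Real.exp (-z) / √Real.pi *
      (z ^ m / m.factorial) * (v ^ (-(1 / 2) : ℝ) * (1 - v) ^ (b - 1 / 2) * (1 - v) ^ m) =
      √z * Real.exp (-z) * (z ^ m / m.factorial *
        (Real.Gamma (m + (b - 1 / 2) + 1) / Real.Gamma (m + b + 1))) := by
    intro m
    rw [integral_const_mul, (hB m).2]
    have := (Real.sqrt_pos.2 Real.pi_pos).ne'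
    field_simp
  have hsum := ((hasSum_modifiedMass hb hz).mul_left (√z * Real.exp (-z)))
  rw [← modifiedMass] at hsum
  have hn : Summable fun m : ℕ => ∫ v in Set.Ioo (0 : ℝ) 1, ‖√z * Real.exp (-z) / √Real.pi *
      (z ^ m / m.factorial) * (v ^ (-(1 / 2) : ℝ) * (1 - v) ^ (b - 1 / 2) * (1 - v) ^ m)‖ := by
    refine hsum.summable.congr fun m => ?_
    rw [← hval m]
    refine integral_congr_ae ?_
    filter_upwards [hpos] with v hv
    have h1 := hv.1
    have h2 := Real.rpow_pos_of_pos hv.2 (b - 1 / 2)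
    have h3 := pow_pos hv.2 m
    rw [Real.norm_of_nonneg (by positivity)]
  have hsum' := integrable_and_integral_eq_of_hasSum
    (f := fun v => √z / √Real.pi * (Real.exp (-(z * v)) *
      (v ^ (-(1 / 2) : ℝ) * (1 - v) ^ (b - 1 / 2))))
    (fun m => (hB m).1.const_mul (√z * Real.exp (-z) / √Real.pi * (z ^ m / m.factorial))) hn
    (hsum.congr_fun hval) (ae_of_all _ fun v => by
      have h := (Real.hasSum_exp' (z * (1 - v))).mul_left (√z * Real.exp (-z) / √Real.pi *
        (v ^ (-(1 / 2) : ℝ) * (1 - v) ^ (b - 1 / 2)))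
      convert! h using 1
      · ext m
        rw [mul_pow]
        ring
      · rw [show -(z * v) = -z + z * (1 - v) by ring, Real.exp_add]
        ring)
  rw [integral_const_mul] at hsum'
  refine ⟨?_, hsum'.2.symm⟩
  have hm : AEStronglyMeasurable (fun v : ℝ => Real.exp (-(z * v)))
      (volume.restrict (Set.Ioo 0 1)) := (by fun_prop : Measurable _).aestronglyMeasurable
  have h0 := (hB 0).1
  simp only [pow_zero, mul_one] at h0
  refine h0.bdd_mul (c := 1) hm ?_
  filter_upwards [hpos] with v hv
  rw [Real.norm_of_nonneg (by positivity), Real.exp_le_one_iff]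
  have := mul_nonneg hz hv.1.le
  linarith

/-! ### Upper and lower bounds for the mass. -/

theorem integral_Ioi_exp_neg_mul_rpow {z c : ℝ} (hz : 0 < z) (hc : -1 < c) :
    IntegrableOn (fun v => Real.exp (-(z * v)) * v ^ c) (Set.Ioi 0) ∧
    ∫ v in Set.Ioi (0 : ℝ), Real.exp (-(z * v)) * v ^ c = Real.Gamma (c + 1) / z ^ (c + 1) := by
  constructor
  · have := integrableOn_rpow_mul_exp_neg_mul_rpow (p := 1) (s := c) (b := z) hc one_pos hz
    simpa only [Real.rpow_one, neg_mul, mul_comm (Real.exp _)] using this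
  · have := Real.integral_rpow_mul_exp_neg_mul_Ioi (a := c + 1) (by linarith) hz
    rw [Real.div_rpow zero_le_one hz.le, Real.one_rpow, add_sub_cancel_right] at this
    simp only [mul_comm (Real.exp _), this]
    ring

/-- For b ≥ 1/2 the factor (1 - v)^{b-1/2} is at most 1, and the integral without it, extended to
the half-line, is exactly √π / √z. -/
theorem modifiedMass_le_one {b z : ℝ} (hb : 1 / 2 ≤ b) (hz : 0 ≤ z) : modifiedMass b z ≤ 1 := by
  rcases hz.eq_or_lt with rfl | hz
  · simp [modifiedMass]
  obtain ⟨h1, h2⟩ := modifiedMass_eq_integral (b := b) (by linarith) hz.le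
  obtain ⟨h3, h4⟩ := integral_Ioi_exp_neg_mul_rpow hz (c := -(1 / 2)) (by norm_num)
  have hpi := Real.sqrt_pos.2 Real.pi_pos
  have hsz := Real.sqrt_pos.2 hz
  have h5 : ∫ v in Set.Ioo (0 : ℝ) 1,
      Real.exp (-(z * v)) * (v ^ (-(1 / 2) : ℝ) * (1 - v) ^ (b - 1 / 2)) ≤
      ∫ v in Set.Ioi (0 : ℝ), Real.exp (-(z * v)) * v ^ (-(1 / 2) : ℝ) := by
    refine le_trans (setIntegral_mono_on h1 (h3.mono_set Set.Ioo_subset_Ioi_self)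
      measurableSet_Ioo fun v hv => ?_) (setIntegral_mono_set h3 ?_
        Set.Ioo_subset_Ioi_self.eventuallyLE)
    · have h6 : 0 < v := hv.1
      have h7 : (1 - v) ^ (b - 1 / 2) ≤ 1 :=
        Real.rpow_le_one (by linarith [hv.2]) (by linarith) (by linarith)
      gcongr
      exact mul_le_of_le_one_right (by positivity) h7
    · filter_upwards [ae_restrict_mem measurableSet_Ioi] with v hv
      have : (0 : ℝ) < v := hv
      simp only [Pi.zero_apply]
      positivity
  rw [h4, show (-(1 / 2) + 1 : ℝ) = 1 / 2 by norm_num, Real.Gamma_one_half_eq,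
    ← Real.sqrt_eq_rpow] at h5
  rw [h2]
  calc _ ≤ √z / √Real.pi * (√Real.pi / √z) := by gcongr
    _ = 1 := by field_simp

/-- Termwise comparison: (m + b + 1/2)/(m + b + 1) increases with m, so the constant is the one
making the terms at m = 0 equal. -/
theorem modifiedMass_le_add_one {b z : ℝ} (hb : -1 / 2 < b) (hz : 0 ≤ z) :
    modifiedMass b z ≤ (b + 1) / (b + 1 / 2) * modifiedMass (b + 1) z := by
  have h := hasSum_le (fun m => ?_) (hasSum_modifiedMass hb hz)
    ((hasSum_modifiedMass (b := b + 1) (by linarith) hz).mul_left ((b + 1) / (b + 1 / 2)))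
  · rw [modifiedMass, modifiedMass, mul_left_comm]
    exact mul_le_mul_of_nonneg_left h (by positivity)
  · rw [Gamma_ratio_add_one hb]
    have h1 := Gamma_ratio_pos hb m
    have hm : (0 : ℝ) ≤ m := by positivity
    have h2 : 1 ≤ (b + 1) / (b + 1 / 2) * ((m + b + 1 / 2) / (m + b + 1)) := by
      rw [div_mul_div_comm, one_le_div (mul_pos (by linarith) (by linarith))]
      nlinarith
    calc _ = 1 * (z ^ m / m.factorial *
          (Real.Gamma (m + (b - 1 / 2) + 1) / Real.Gamma (m + b + 1))) := by ring
      _ ≤ ((b + 1) / (b + 1 / 2) * ((m + b + 1 / 2) / (m + b + 1))) * (z ^ m / m.factorial *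
          (Real.Gamma (m + (b - 1 / 2) + 1) / Real.Gamma (m + b + 1))) := by gcongr
      _ = _ := by ring

/-- Since b + 1 ≥ 1/2, the mass at b + 1 is at most 1. -/
theorem modifiedMass_le {b z : ℝ} (hb : -1 / 2 < b) (hz : 0 ≤ z) :
    modifiedMass b z ≤ (b + 1) / (b + 1 / 2) := by
  refine (modifiedMass_le_add_one hb hz).trans ?_
  have : 0 < (b + 1) / (b + 1 / 2) := div_pos (by linarith) (by linarith)
  exact mul_le_of_le_one_right this.le (modifiedMass_le_one (by linarith) hz)

/-- Let c = 1/2 - b. Replace (1 - v)^{-c} by its lower bound 1 + cv and integrate over the whole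
half-line, which gives exactly 1 + c/(2z); the subtracted term bounds the part over [1, ∞),
exponentially small in z. -/
theorem le_modifiedMass {b z : ℝ} (hb : -1 / 2 < b) (hb' : b ≤ 1 / 2) (hz : 1 ≤ z) :
    1 + (1 / 2 - b) / (2 * z) - √z / √Real.pi * ((1 + (1 / 2 - b)) * Real.exp (1 - z)) ≤
      modifiedMass b z := by
  set c := 1 / 2 - b with hc
  have hc0 : 0 ≤ c := by linarith
  have hz0 : 0 < z := by linarith
  obtain ⟨h1, h2⟩ := modifiedMass_eq_integral (b := b) (by linarith) hz0.le
  obtain ⟨h3, h4⟩ := integral_Ioi_exp_neg_mul_rpow hz0 (c := -(1 / 2)) (by norm_num)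
  obtain ⟨h5, h6⟩ := integral_Ioi_exp_neg_mul_rpow hz0 (c := 1 / 2) (by norm_num)
  obtain ⟨h7, h8⟩ := integral_Ioi_exp_neg_mul_rpow one_pos (c := 1) (by norm_num)
  have hpi := Real.sqrt_pos.2 Real.pi_pos
  have hsz := Real.sqrt_pos.2 hz0
  rw [show (-(1 / 2) + 1 : ℝ) = 1 / 2 by norm_num, Real.Gamma_one_half_eq,
    ← Real.sqrt_eq_rpow] at h4
  rw [show (1 / 2 + 1 : ℝ) = 1 + 1 / 2 by norm_num, Real.rpow_add hz0, Real.rpow_one,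
    ← Real.sqrt_eq_rpow, add_comm (1 : ℝ), Real.Gamma_add_one (by norm_num),
    Real.Gamma_one_half_eq] at h6
  norm_num at h8
  set g : ℝ → ℝ := fun v => Real.exp (-(z * v)) * v ^ (-(1 / 2) : ℝ) +
    c * (Real.exp (-(z * v)) * v ^ (1 / 2 : ℝ)) with hg
  have hgi : IntegrableOn g (Set.Ioi 0) := h3.add (h5.const_mul c)
  have hgv : ∫ v in Set.Ioi (0 : ℝ), g v = √Real.pi / √z + c * (1 / 2 * √Real.pi / (z * √z)) := by
    rw [hg, integral_add h3 (h5.const_mul c), integral_const_mul, h4, h6]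
  have hsub : Set.Ici (1 : ℝ) ⊆ Set.Ioi 0 := fun v hv => Set.mem_Ioi.2 (one_pos.trans_le hv)
  have hsplit : ∫ v in Set.Ioi (0 : ℝ), g v =
      (∫ v in Set.Ioo (0 : ℝ) 1, g v) + ∫ v in Set.Ici (1 : ℝ), g v := by
    have hdisj : Disjoint (Set.Ioo (0 : ℝ) 1) (Set.Ici 1) :=
      Set.disjoint_left.2 fun v hv hv' => not_le.2 hv.2 hv'
    rw [← setIntegral_union hdisj
      measurableSet_Ici (hgi.mono_set Set.Ioo_subset_Ioi_self) (hgi.mono_set hsub)]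
    congr 2
    ext v
    simp only [Set.mem_Ioi, Set.mem_union, Set.mem_Ioo, Set.mem_Ici]
    constructor
    · intro h
      rcases lt_or_ge v 1 with h' | h'
      · exact Or.inl ⟨h, h'⟩
      · exact Or.inr h'
    · rintro (h | h)
      · exact h.1
      · linarith
  have htail : ∫ v in Set.Ici (1 : ℝ), g v ≤ (1 + c) * Real.exp (1 - z) := by
    have hdom : ∀ v ∈ Set.Ici (1 : ℝ), g v ≤
        (1 + c) * Real.exp (1 - z) * (Real.exp (-v) * v) := by
      intro v hv
      have hv1 : 1 ≤ v := hv
      -- This is (z - 1)(v - 1) ≥ 0. It leaves e^{-v} v, whose integral over the half-line is 1.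
      have e1 : Real.exp (-(z * v)) ≤ Real.exp (1 - z) * Real.exp (-v) := by
        rw [← Real.exp_add, Real.exp_le_exp]
        nlinarith
      have e2 : v ^ (-(1 / 2) : ℝ) ≤ 1 := Real.rpow_le_one_of_one_le_of_nonpos hv1 (by norm_num)
      have e3 : v ^ (1 / 2 : ℝ) ≤ v := by
        conv_rhs => rw [← Real.rpow_one v]
        exact Real.rpow_le_rpow_of_exponent_le hv1 (by norm_num)
      calc g v = Real.exp (-(z * v)) * (v ^ (-(1 / 2) : ℝ) + c * v ^ (1 / 2 : ℝ)) := by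
            rw [hg]; ring
        _ ≤ Real.exp (1 - z) * Real.exp (-v) * (v + c * v) := by
            gcongr
            exact e2.trans hv1
        _ = _ := by ring
    have h7' : IntegrableOn (fun v => (1 + c) * Real.exp (1 - z) * (Real.exp (-v) * v))
        (Set.Ioi 0) := by
      rw [IntegrableOn]
      simpa using h7.const_mul ((1 + c) * Real.exp (1 - z))
    calc _ ≤ ∫ v in Set.Ici (1 : ℝ), (1 + c) * Real.exp (1 - z) * (Real.exp (-v) * v) :=
          setIntegral_mono_on (hgi.mono_set hsub) (h7'.mono_set hsub) measurableSet_Ici hdom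
      _ ≤ ∫ v in Set.Ioi (0 : ℝ), (1 + c) * Real.exp (1 - z) * (Real.exp (-v) * v) := by
          refine setIntegral_mono_set h7' ?_ hsub.eventuallyLE
          filter_upwards [ae_restrict_mem measurableSet_Ioi] with v hv
          have : (0 : ℝ) < v := hv
          simp only [Pi.zero_apply]
          positivity
      _ = _ := by rw [integral_const_mul, h8, mul_one]
  have hlow : ∫ v in Set.Ioo (0 : ℝ) 1, g v ≤ ∫ v in Set.Ioo (0 : ℝ) 1,
      Real.exp (-(z * v)) * (v ^ (-(1 / 2) : ℝ) * (1 - v) ^ (b - 1 / 2)) := by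
    refine setIntegral_mono_on (hgi.mono_set Set.Ioo_subset_Ioi_self) h1 measurableSet_Ioo
      fun v hv => ?_
    have hv0 : 0 < v := hv.1
    have hv1 : 0 < 1 - v := by linarith [hv.2]
    -- Both inequalities come from the exponential: 1 + cv ≤ e^{cv}, and 1 - v ≤ e^{-v} raised to
    -- the nonpositive power -c.
    have e1 : 1 + c * v ≤ (1 - v) ^ (b - 1 / 2) := by
      rw [show b - 1 / 2 = -c by rw [hc]; ring]
      calc 1 + c * v ≤ Real.exp (c * v) := by linarith [Real.add_one_le_exp (c * v)]
        _ = Real.exp (-v) ^ (-c) := by rw [← Real.exp_mul]; ring_nf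
        _ ≤ (1 - v) ^ (-c) := Real.rpow_le_rpow_of_nonpos hv1
            (by linarith [Real.add_one_le_exp (-v)]) (by linarith)
    have e2 : v ^ (1 / 2 : ℝ) = v ^ (-(1 / 2) : ℝ) * v := by
      conv_rhs => rw [← Real.rpow_add_one hv0.ne']
      norm_num
    calc g v = Real.exp (-(z * v)) * (v ^ (-(1 / 2) : ℝ) * (1 + c * v)) := by
          simp only [hg, e2]; ring
      _ ≤ _ := by gcongr
  rw [h2]
  calc _ = √z / √Real.pi * (√Real.pi / √z + c * (1 / 2 * √Real.pi / (z * √z)) -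
        (1 + c) * Real.exp (1 - z)) := by field_simp
    _ ≤ _ := by
        gcongr
        linarith

theorem exists_one_lt_modifiedMass {b : ℝ} (hb : -1 / 2 < b) (hb' : b < 1 / 2) :
    ∃ κ p, 1 < κ ∧ 0 < p ∧ ∀ z, p < z → z < p + 1 → κ ≤ modifiedMass b z := by
  set c := 1 / 2 - b with hc
  have hc0 : 0 < c := by linarith
  have hlim := Real.tendsto_pow_mul_exp_neg_atTop_nhds_zero 2
  have hε : 0 < c / (4 * (1 + c) * Real.exp 1) := by positivity
  -- The threshold is chosen so that the tail error is at most c/(4z), half of the gain c/(2z). On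
  -- an interval of length 1 the remaining gain is bounded below by c/(4(p + 1)).
  obtain ⟨p, hp⟩ := ((hlim.eventually_lt_const hε).and (eventually_ge_atTop 1)).exists_forall_of_atTop
  have hp1 := (hp p le_rfl).2
  refine ⟨1 + c / (4 * (p + 1)), p, ?_, by linarith, fun z hz hz' => ?_⟩
  · have : 0 < c / (4 * (p + 1)) := by positivity
    linarith
  obtain ⟨h1, h2⟩ := hp z hz.le
  have hz0 : 0 < z := by linarith
  refine le_trans ?_ (le_modifiedMass hb hb'.le h2)
  rw [← hc]
  have h3 : √z / √Real.pi ≤ z := by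
    have hpi : 1 ≤ √Real.pi := Real.one_le_sqrt.2 (by linarith [Real.pi_gt_three])
    rw [div_le_iff₀ (by linarith)]
    calc √z ≤ z := Real.sqrt_le_iff.2 ⟨hz0.le, by nlinarith⟩
      _ ≤ _ := le_mul_of_one_le_right hz0.le hpi
  have h4 : √z / √Real.pi * ((1 + c) * Real.exp (1 - z)) ≤ c / (4 * z) := by
    refine (mul_le_mul_of_nonneg_right h3 (by positivity)).trans ?_
    rw [lt_div_iff₀ (by positivity)] at h1
    rw [le_div_iff₀ (by positivity), show (1 : ℝ) - z = 1 + -z by ring, Real.exp_add]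
    linarith
  have h5 : c / (2 * z) = c / (4 * z) + c / (4 * z) := by field_simp; norm_num
  have h6 : c / (4 * (p + 1)) ≤ c / (4 * z) := by gcongr
  linarith

/-! ### Variance of the Mehler kernel -/

theorem hasSum_pow_div_factorial_mul (z : ℝ) :
    HasSum (fun m : ℕ => z ^ m / m.factorial * m) (z * Real.exp z) := by
  rw [← hasSum_nat_add_iff' 1]
  simp only [Finset.sum_range_one, Nat.cast_zero, mul_zero, sub_zero]
  refine ((Real.hasSum_exp' z).mul_left z).congr_fun fun m => ?_
  rw [Nat.factorial_succ]
  push_cast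
  field_simp
  ring

theorem hasSum_pow_div_factorial_mul_mul (z : ℝ) :
    HasSum (fun m : ℕ => z ^ m / m.factorial * (m * (m - 1))) (z ^ 2 * Real.exp z) := by
  rw [← hasSum_nat_add_iff' 1]
  simp only [Finset.sum_range_one, Nat.cast_zero, zero_mul, mul_zero, sub_zero]
  rw [show z ^ 2 * Real.exp z = z * (z * Real.exp z) by ring]
  refine ((hasSum_pow_div_factorial_mul z).mul_left z).congr_fun fun m => ?_
  rw [Nat.factorial_succ]
  push_cast
  field_simp
  ring

/-- The moments of the kernel reduce to the factorial moments of the Poisson weights z^m/m!, which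
give polynomials in z. What matters later is the factor 1 - r: the mean square distance from x
vanishes as r → 1. -/
theorem integral_sq_sub_mul_mehlerKernel {a r x : ℝ} (ha : -1 < a) (hr0 : 0 ≤ r) (hr : r < 1)
    (hx : 0 ≤ x) :
    Integrable (fun y => (y - x) ^ 2 * mehlerKernel a r x y) (laguerreMeasureReal a) ∧
    ∫ y, (y - x) ^ 2 * mehlerKernel a r x y ∂laguerreMeasureReal a =
      (1 - r) * ((1 - r) * (x ^ 2 + (a + 1) * (a + 2)) + (2 * a + 4) * r * x -
        2 * (a + 1) * x) := by
  have h1r : 0 < 1 - r := by linarith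
  obtain ⟨h1, h2⟩ := integral_mehlerKernel_self ha hr0 hr x
  set z := r * |x| / (1 - r) with hz
  have hzx : (1 - r) * z = r * x := by rw [hz, abs_of_nonneg hx]; field_simp
  have hG : ∀ m : ℕ, (0 : ℝ) < m + a + 1 := fun m => by
    have : (0 : ℝ) ≤ m := by positivity
    linarith
  obtain ⟨h3, h4⟩ := integral_mehlerKernel (x := x) ha (show -1 < a + 1 by linarith) hr0 hr
    (((hasSum_pow_div_factorial_mul z).add ((Real.hasSum_exp' z).mul_right (a + 1))).congr_fun
      fun m => by
        rw [← add_assoc, Real.Gamma_add_one (hG m).ne',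
          mul_div_cancel_right₀ _ (Gamma_natCast_add_pos ha m).ne']
        ring)
  obtain ⟨h5, h6⟩ := integral_mehlerKernel (x := x) ha (show -1 < a + 2 by linarith) hr0 hr
    (((hasSum_pow_div_factorial_mul_mul z).add (((hasSum_pow_div_factorial_mul z).mul_right
      (2 * a + 4)).add ((Real.hasSum_exp' z).mul_right ((a + 1) * (a + 2))))).congr_fun
      fun m => by
        rw [show (m : ℝ) + (a + 2) + 1 = m + a + 1 + 1 + 1 by ring,
          Real.Gamma_add_one (by linarith [hG m]), Real.Gamma_add_one (hG m).ne', ← mul_assoc,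
          mul_div_cancel_right₀ _ (Gamma_natCast_add_pos ha m).ne']
        ring)
  rw [← integrable_rpow_mul_laguerreMeasureReal_iff] at h3 h5
  rw [← integral_rpow_mul_laguerreMeasureReal] at h4 h6
  simp only [Real.rpow_one, Real.rpow_two] at h3 h4 h5 h6
  have he : (fun y => (y - x) ^ 2 * mehlerKernel a r x y) = fun y =>
      y ^ 2 * mehlerKernel a r x y - 2 * x * (y * mehlerKernel a r x y) +
        x ^ 2 * mehlerKernel a r x y := by
    ext y
    ring
  have hi : Integrable (fun y => y ^ 2 * mehlerKernel a r x y -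
      2 * x * (y * mehlerKernel a r x y)) (laguerreMeasureReal a) := h5.sub (h3.const_mul _)
  rw [he]
  refine ⟨hi.add (h1.const_mul _), ?_⟩
  rw [integral_add hi (h1.const_mul _),
    integral_sub h5 (h3.const_mul _), integral_const_mul, integral_const_mul, h2, h4, h6,
    add_sub_cancel_left, add_sub_cancel_left, Real.rpow_one, Real.rpow_two, ← hz]
  have hexp : Real.exp (-z) * Real.exp z = 1 := by rw [← Real.exp_add]; simp
  linear_combination ((1 - r) ^ 2 * (z ^ 2 + (2 * a + 4) * z + (a + 1) * (a + 2)) -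
    2 * x * (1 - r) * (z + (a + 1))) * hexp + ((1 - r) * z + r * x +
      (2 * a + 4) * (1 - r) - 2 * x) * hzx

/-! ### Products over coordinates -/

theorem lintegral_fin_prod_eq_prod {n : ℕ} {X : Type*} [MeasurableSpace X]
    {μ : Fin n → Measure X} [∀ i, SigmaFinite (μ i)] {f : Fin n → X → ℝ≥0∞}
    (hf : ∀ i, Measurable (f i)) :
    ∫⁻ x : Fin n → X, ∏ i, f i (x i) ∂(Measure.pi μ) = ∏ i, ∫⁻ x, f i x ∂(μ i) := by
  induction n with
  | zero => simp
  | succ n ih =>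
    have hm : Measurable fun x : Fin n → X => ∏ i, f i.succ (x i) :=
      Finset.measurable_prod _ fun i _ => (hf _).comp (measurable_pi_apply i)
    have h := (measurePreserving_piFinSuccAbove μ 0).lintegral_comp
      (f := fun p : X × (Fin n → X) => f 0 p.1 * ∏ i, f i.succ (p.2 i))
      (((hf 0).comp measurable_fst).mul (hm.comp measurable_snd))
    rw [Fin.prod_univ_succ, ← ih fun i => hf _,
      ← lintegral_prod_mul (hf 0).aemeasurable hm.aemeasurable]
    refine Eq.trans (lintegral_congr fun x => ?_) h
    rw [Fin.prod_univ_succ]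
    rfl

theorem measurableSet_posOrthant (d : ℕ) : MeasurableSet (posOrthant d) := by
  have : posOrthant d = Set.univ.pi fun _ => Set.Ioi 0 := by ext x; simp [posOrthant]
  rw [this]
  exact MeasurableSet.univ_pi fun _ => measurableSet_Ioi

theorem isOpen_posOrthant (d : ℕ) : IsOpen (posOrthant d) := by
  have : posOrthant d = Set.univ.pi fun _ => Set.Ioi 0 := by ext x; simp [posOrthant]
  rw [this]
  exact isOpen_set_pi Set.finite_univ fun _ _ => isOpen_Ioi

theorem laguerreMeasure_eq_pi {d : ℕ} (α : Fin d → ℝ) :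
    laguerreMeasure α = Measure.pi fun i => laguerreMeasureReal (α i) := by
  refine (Measure.pi_eq fun s hs => ?_).symm
  have h1 : (volume.restrict (posOrthant d)) =
      Measure.pi fun _ : Fin d => (volume : Measure ℝ).restrict (Set.Ioi 0) := by
    rw [← Measure.restrict_pi_pi, volume_pi]
    congr 1
    ext x
    simp [posOrthant]
  have hw : ∀ i, Measurable fun y : ℝ =>
      (s i).indicator (fun y => ENNReal.ofReal (y ^ α i * Real.exp (-y))) y := fun i =>
    Measurable.indicator (by fun_prop) (hs i)
  rw [laguerreMeasure, withDensity_apply _ (MeasurableSet.univ_pi hs),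
    ← lintegral_indicator (MeasurableSet.univ_pi hs)]
  have h2 : ∀ᵐ x ∂volume.restrict (posOrthant d), (Set.univ.pi s).indicator
      (fun x => ENNReal.ofReal (∏ i, x i ^ α i * Real.exp (-x i))) x =
      ∏ i, (s i).indicator (fun y => ENNReal.ofReal (y ^ α i * Real.exp (-y))) (x i) := by
    filter_upwards [ae_restrict_mem (measurableSet_posOrthant d)] with x hx
    by_cases hxs : x ∈ Set.univ.pi s
    · rw [Set.indicator_of_mem hxs, ENNReal.ofReal_prod_of_nonneg fun i _ => by
        have := hx i
        positivity]
      exact Finset.prod_congr rfl fun i _ => by rw [Set.indicator_of_mem (hxs i (Set.mem_univ i))]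
    · rw [Set.indicator_of_notMem hxs]
      obtain ⟨i, hi⟩ : ∃ i, x i ∉ s i := by simpa using hxs
      exact (Finset.prod_eq_zero (Finset.mem_univ i) (Set.indicator_of_notMem hi _)).symm
  rw [lintegral_congr_ae h2, h1, lintegral_fin_prod_eq_prod hw]
  refine Finset.prod_congr rfl fun i _ => ?_
  rw [lintegral_indicator (hs i), laguerreMeasureReal, withDensity_apply _ (hs i)]

instance {d : ℕ} (α : Fin d → ℝ) : SigmaFinite (laguerreMeasure α) := by
  rw [laguerreMeasure_eq_pi]
  infer_instance

theorem ae_laguerreMeasure_mem_posOrthant {d : ℕ} (α : Fin d → ℝ) :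
    ∀ᵐ x ∂laguerreMeasure α, x ∈ posOrthant d :=
  (withDensity_absolutelyContinuous _ _).ae_le (ae_restrict_mem (measurableSet_posOrthant d))

/-- The density is strictly positive on the orthant, so an almost everywhere property holds at some
point of every open set meeting the orthant. Both negative results are obtained by evaluating at
such a point. -/
theorem exists_mem_of_ae_laguerreMeasure {d : ℕ} {α : Fin d → ℝ} {P : (Fin d → ℝ) → Prop}
    (hP : ∀ᵐ x ∂laguerreMeasure α, P x) {U : Set (Fin d → ℝ)} (hU : IsOpen U)
    (hne : (U ∩ posOrthant d).Nonempty) : ∃ x ∈ U, x ∈ posOrthant d ∧ P x := by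
  rw [laguerreMeasure, ae_withDensity_iff (by fun_prop),
    ae_restrict_iff' (measurableSet_posOrthant d)] at hP
  by_contra! h
  have h1 : ∀ᵐ x : Fin d → ℝ, x ∉ U ∩ posOrthant d := by
    filter_upwards [hP] with x hx hxU
    refine h x hxU.1 hxU.2 (hx hxU.2 ?_)
    rw [ENNReal.ofReal_ne_zero_iff]
    exact Finset.prod_pos fun i _ => mul_pos (Real.rpow_pos_of_pos (hxU.2 i) _) (Real.exp_pos _)
  exact ((hU.inter (isOpen_posOrthant d)).measure_pos volume hne).ne' (by
    simpa [ae_iff] using h1)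

theorem hasSum_prod_pi {d : ℕ} {g : Fin d → ℕ → ℝ} {S : Fin d → ℝ}
    (hg : ∀ i, Summable fun n => |g i n|) (hS : ∀ i, HasSum (g i) (S i)) :
    (Summable fun k : Fin d → ℕ => |∏ i, g i (k i)|) ∧
    HasSum (fun k : Fin d → ℕ => ∏ i, g i (k i)) (∏ i, S i) := by
  induction d with
  | zero =>
    simp only [Finset.univ_eq_empty, Finset.prod_empty]
    exact ⟨(hasSum_fintype _).summable, by simp⟩
  | succ d ih =>
    obtain ⟨h1, h2⟩ := ih (fun i => hg i.succ) (fun i => hS i.succ)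
    let e : ℕ × (Fin d → ℕ) ≃ (Fin (d + 1) → ℕ) := Fin.consEquiv fun _ => ℕ
    have he : ∀ p, ∏ i, g i (e p i) = g 0 p.1 * ∏ i, g i.succ (p.2 i) := fun p => by
      rw [Fin.prod_univ_succ]
      rfl
    have hA := summable_mul_of_summable_norm (f := g 0)
      (g := fun k : Fin d → ℕ => ∏ i, g i.succ (k i))
      (by simpa only [Real.norm_eq_abs] using hg 0) (by simpa only [Real.norm_eq_abs] using h1)
    constructor
    · rw [← e.summable_iff]
      refine hA.abs.congr fun p => ?_
      rw [Function.comp_apply, he]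
    · rw [← e.hasSum_iff, Fin.prod_univ_succ]
      exact ((hS 0).mul h2 hA).congr_fun fun p => he p

theorem hasSum_sum_piAntidiag {d : ℕ} {f : (Fin d → ℕ) → ℝ} {S : ℝ} (h : HasSum f S) :
    HasSum (fun n => ∑ k ∈ Finset.piAntidiag Finset.univ n, f k) S := by
  have h' := (Equiv.sigmaFiberEquiv fun k : Fin d → ℕ => ∑ i, k i).hasSum_iff.2 h
  refine h'.sigma fun n => ?_
  have hs := (Finset.piAntidiag (Finset.univ : Finset (Fin d)) n).hasSum f
  rw [← (Equiv.subtypeEquivRight (p := fun k : Fin d → ℕ => ∑ i, k i = n)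
    (q := fun k => k ∈ (Finset.piAntidiag (Finset.univ : Finset (Fin d)) n : Set (Fin d → ℕ)))
    (fun k => by simp)).hasSum_iff] at hs
  exact hs

/-- The one-dimensional Hille–Hardy series converge absolutely, so their product may be regrouped by
total degree |k| = n, where the powers of e^{-t} multiply to e^{-tn}. -/
theorem laguerreHeatKernel_eq_prod {d : ℕ} {β : Fin d → ℝ} (hβ : ∀ i, -1 < β i) {t : ℝ}
    (ht : 0 < t) {x y : Fin d → ℝ} (hx : x ∈ posOrthant d) (hy : y ∈ posOrthant d) :
    laguerreHeatKernel β t x y = ∏ i, mehlerKernel (β i) (Real.exp (-t)) (x i) (y i) := by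
  have hr : Real.exp (-t) < 1 := Real.exp_lt_one_iff.2 (by linarith)
  have h := fun i => hasSum_normLaguerre_mul (hβ i) (Real.exp_pos (-t)).le hr (hx i).le (hy i).le
  have h2 := hasSum_sum_piAntidiag (hasSum_prod_pi (fun i => (h i).1) (fun i => (h i).2)).2
  rw [laguerreHeatKernel, ← h2.tsum_eq]
  refine tsum_congr fun n => ?_
  rw [Finset.mul_sum]
  refine Finset.sum_congr rfl fun k hk => ?_
  have hkn : ∑ i, k i = n := by simpa using hk
  rw [Finset.prod_mul_distrib, Finset.prod_pow_eq_pow_sum, hkn, Finset.prod_mul_distrib,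
    normLaguerreProd, normLaguerreProd, ← Real.exp_nat_mul, mul_comm (n : ℝ)]

/-! ### Integral operators with positive symmetric kernels -/

section KernelOperators

variable {X : Type*} [MeasurableSpace X] {𝕜 : Type*} [RCLike 𝕜] {μ : Measure X}

/-- Measurable, nonnegative, symmetric kernels with integral at most `C` and bounded slices. -/
structure IsSymmKernel (μ : Measure X) (k : X → X → ℝ) (C : ℝ) : Prop where
  measurable : Measurable (Function.uncurry k)
  nonneg : ∀ x y, 0 ≤ k x y
  symm : ∀ x y, k x y = k y x
  integrable : ∀ x, Integrable (k x) μ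
  integral_le : ∀ x, ∫ y, k x y ∂μ ≤ C
  bounded : ∀ x, ∃ M, ∀ y, k x y ≤ M

/-- The integral operator with kernel `k`. -/
noncomputable def kernelOp (μ : Measure X) (k : X → X → ℝ) (f : X → 𝕜) (x : X) : 𝕜 :=
  ∫ y, (k x y : 𝕜) * f y ∂μ

namespace IsSymmKernel

variable {k : X → X → ℝ} {C : ℝ}

theorem measurable_slice (hk : IsSymmKernel μ k C) (x : X) : Measurable (k x) :=
  hk.measurable.comp measurable_prodMk_left

theorem mono (hk : IsSymmKernel μ k C) {C' : ℝ} (h : C ≤ C') : IsSymmKernel μ k C' :=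
  { hk with integral_le := fun x => (hk.integral_le x).trans h }

theorem lintegral_le (hk : IsSymmKernel μ k C) (x : X) :
    ∫⁻ y, ENNReal.ofReal (k x y) ∂μ ≤ ENNReal.ofReal C := by
  rw [← ofReal_integral_eq_lintegral_ofReal (hk.integrable x) (ae_of_all _ (hk.nonneg x))]
  exact ENNReal.ofReal_le_ofReal (hk.integral_le x)

/-- Integrability of the slice takes care of the constant B, boundedness of the slice takes care of
g. This covers L^1 + L^∞, and also L^p, through |f| ≤ 1 + |f|^p. -/
theorem integrable_mul_of_bound (hk : IsSymmKernel μ k C) (x : X) {f : X → 𝕜}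
    (hf : AEStronglyMeasurable f μ) {g : X → ℝ} (hg : Integrable g μ) {B : ℝ}
    (hb : ∀ᵐ y ∂μ, ‖f y‖ ≤ B + g y) (hg0 : ∀ᵐ y ∂μ, 0 ≤ g y) :
    Integrable (fun y => (k x y : 𝕜) * f y) μ := by
  obtain ⟨M, hM⟩ := hk.bounded x
  refine Integrable.mono' (((hk.integrable x).mul_const B).add (hg.const_mul M)) ?_ ?_
  · exact (RCLike.measurable_ofReal.comp (hk.measurable_slice x)).aestronglyMeasurable.mul hf
  · filter_upwards [hb, hg0] with y hy hy0
    rw [norm_mul, RCLike.norm_ofReal, abs_of_nonneg (hk.nonneg x y)]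
    calc k x y * ‖f y‖ ≤ k x y * (B + g y) := mul_le_mul_of_nonneg_left hy (hk.nonneg x y)
      _ = k x y * B + k x y * g y := mul_add _ _ _
      _ ≤ k x y * B + M * g y := by gcongr; exact hM y

theorem integrable_mul_of_inL1AddLinfty (hk : IsSymmKernel μ k C) (x : X) {f : X → 𝕜}
    (hf : InL1AddLinfty μ f) : Integrable (fun y => (k x y : 𝕜) * f y) μ := by
  obtain ⟨g, h, hg, hh, rfl⟩ := hf
  refine hk.integrable_mul_of_bound x (hg.1.add hh.1) (memLp_one_iff_integrable.1 hg).norm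
    (B := (eLpNormEssSup h μ).toReal) ?_ (ae_of_all _ fun _ => norm_nonneg _)
  have hfin : eLpNormEssSup h μ ≠ ∞ := by
    have := hh.2.ne
    rwa [eLpNorm_exponent_top] at this
  filter_upwards [ae_le_eLpNormEssSup (f := h) (μ := μ)] with y hy
  have : ‖h y‖ ≤ (eLpNormEssSup h μ).toReal := by
    rw [← toReal_enorm]
    exact ENNReal.toReal_mono hfin hy
  calc _ ≤ ‖g y‖ + ‖h y‖ := norm_add_le _ _
    _ ≤ _ := by linarith

theorem integrable_mul_of_memLp (hk : IsSymmKernel μ k C) (x : X) {p : ℝ≥0∞} (hp : 1 ≤ p)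
    {f : X → 𝕜} (hf : MemLp f p μ) : Integrable (fun y => (k x y : 𝕜) * f y) μ := by
  rcases eq_or_ne p ∞ with rfl | hp'
  · exact hk.integrable_mul_of_inL1AddLinfty x
      ⟨0, f, MemLp.zero, hf, by simp⟩
  · have h1 : 1 ≤ p.toReal := by
      rw [← ENNReal.toReal_one]
      exact ENNReal.toReal_mono hp' hp
    refine hk.integrable_mul_of_bound x hf.1 (B := 1)
      (hf.integrable_norm_rpow (by positivity) hp')
      (ae_of_all _ fun y => ?_) (ae_of_all _ fun y => by positivity)
    rcases le_total ‖f y‖ 1 with h | h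
    · have : 0 ≤ ‖f y‖ ^ p.toReal := by positivity
      linarith
    · have : ‖f y‖ ≤ ‖f y‖ ^ p.toReal := by
        conv_lhs => rw [← Real.rpow_one ‖f y‖]
        exact Real.rpow_le_rpow_of_exponent_le h h1
      linarith

theorem aestronglyMeasurable_kernelOp [SFinite μ] (hk : IsSymmKernel μ k C) {f : X → 𝕜}
    (hf : AEStronglyMeasurable f μ) : AEStronglyMeasurable (kernelOp μ k f) μ := by
  have h : AEStronglyMeasurable (fun p : X × X => (k p.1 p.2 : 𝕜) * f p.2) (μ.prod μ) :=
    (RCLike.measurable_ofReal.comp hk.measurable).aestronglyMeasurable.mul hf.comp_snd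
  exact h.integral_prod_right'

theorem enorm_kernelOp_le (hk : IsSymmKernel μ k C) (f : X → 𝕜) (x : X) :
    ‖kernelOp μ k f x‖ₑ ≤ ∫⁻ y, ENNReal.ofReal (k x y) * ‖f y‖ₑ ∂μ := by
  refine (enorm_integral_le_lintegral_enorm _).trans_eq (lintegral_congr fun y => ?_)
  rw [enorm_mul]
  congr 1
  rw [← ofReal_norm, RCLike.norm_ofReal, abs_of_nonneg (hk.nonneg x y)]

/-- For finite p, Hölder's inequality against the measure k(x, ·)μ, of mass at most C, gives
|Tf(x)|^p ≤ C^{p-1} ∫ k(x, y) |f(y)|^p dμ(y). Integrating in x, Tonelli and the symmetry of k supply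
the last factor C. For p = ∞ the mass bound suffices. -/
theorem lpNormLE_kernelOp [SFinite μ] (hk : IsSymmKernel μ k C) {p : ℝ≥0∞} (hp : 1 ≤ p) :
    LpNormLE μ (kernelOp μ k : (X → 𝕜) → (X → 𝕜)) p C := by
  intro f hf
  have key : eLpNorm (kernelOp μ k f) p μ ≤ ENNReal.ofReal C * eLpNorm f p μ := by
    have hm : ∀ x, Measurable fun y => ENNReal.ofReal (k x y) := fun x =>
      (hk.measurable_slice x).ennreal_ofReal
    have hν : ∀ x, ∫⁻ y, ENNReal.ofReal (k x y) * ‖f y‖ₑ ∂μ =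
        eLpNorm f 1 (μ.withDensity fun y => ENNReal.ofReal (k x y)) := fun x => by
      rw [eLpNorm_one_eq_lintegral_enorm, lintegral_withDensity_eq_lintegral_mul₀
        (hm x).aemeasurable hf.1.enorm]
      rfl
    have huniv : ∀ x, (μ.withDensity fun y => ENNReal.ofReal (k x y)) Set.univ ≤
        ENNReal.ofReal C := fun x => by
      rw [withDensity_apply _ MeasurableSet.univ, Measure.restrict_univ]
      exact hk.lintegral_le x
    have hac : ∀ x, (μ.withDensity fun y => ENNReal.ofReal (k x y)) ≪ μ := fun x =>
      withDensity_absolutelyContinuous _ _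
    have hjensen := fun x => eLpNorm_le_eLpNorm_mul_rpow_measure_univ
      (μ := μ.withDensity fun y => ENNReal.ofReal (k x y)) hp (hf.1.mono_ac (hac x))
    rcases eq_or_ne p ∞ with rfl | hp'
    · rw [eLpNorm_exponent_top, eLpNorm_exponent_top]
      refine eLpNormEssSup_le_of_ae_enorm_bound (ae_of_all _ fun x => ?_)
      refine (hk.enorm_kernelOp_le f x).trans ?_
      rw [hν]
      refine (hjensen x).trans ?_
      simp only [ENNReal.toReal_one, div_one, ENNReal.toReal_top, div_zero, sub_zero,
        ENNReal.rpow_one, eLpNorm_exponent_top]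
      rw [mul_comm]
      gcongr
      · exact huniv x
      · exact hac x
    · have h1 : 1 ≤ p.toReal := by
        rw [← ENNReal.toReal_one]
        exact ENNReal.toReal_mono hp' hp
      have h0 : 0 < p.toReal := by linarith
      have hp0 : p ≠ 0 := (zero_lt_one.trans_le hp).ne'
      rw [← ENNReal.rpow_le_rpow_iff h0, ENNReal.mul_rpow_of_nonneg _ _ h0.le,
        eLpNorm_eq_lintegral_rpow_enorm_toReal hp0 hp', eLpNorm_eq_lintegral_rpow_enorm_toReal hp0 hp',
        ← ENNReal.rpow_mul, ← ENNReal.rpow_mul, one_div, inv_mul_cancel₀ h0.ne', ENNReal.rpow_one,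
        ENNReal.rpow_one]
      have hpt : ∀ x, ‖kernelOp μ k f x‖ₑ ^ p.toReal ≤ ENNReal.ofReal C ^ (p.toReal - 1) *
          ∫⁻ y, ENNReal.ofReal (k x y) * ‖f y‖ₑ ^ p.toReal ∂μ := by
        intro x
        have h2 := ((hk.enorm_kernelOp_le f x).trans_eq (hν x)).trans (hjensen x)
        refine (ENNReal.rpow_le_rpow h2 h0.le).trans ?_
        rw [ENNReal.mul_rpow_of_nonneg _ _ h0.le, eLpNorm_eq_lintegral_rpow_enorm_toReal hp0 hp',
          ← ENNReal.rpow_mul, ← ENNReal.rpow_mul, one_div, inv_mul_cancel₀ h0.ne',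
          ENNReal.rpow_one, lintegral_withDensity_eq_lintegral_mul₀ (hm x).aemeasurable
            (hf.1.enorm.pow_const _), mul_comm, ENNReal.toReal_one]
        have h3 : (1 / 1 - p.toReal⁻¹) * p.toReal = p.toReal - 1 := by field_simp
        rw [h3]
        gcongr
        · exact huniv x
        · rfl
      calc ∫⁻ x, ‖kernelOp μ k f x‖ₑ ^ p.toReal ∂μ
          ≤ ∫⁻ x, ENNReal.ofReal C ^ (p.toReal - 1) *
              ∫⁻ y, ENNReal.ofReal (k x y) * ‖f y‖ₑ ^ p.toReal ∂μ ∂μ := lintegral_mono hpt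
        _ = ENNReal.ofReal C ^ (p.toReal - 1) *
              ∫⁻ x, ∫⁻ y, ENNReal.ofReal (k x y) * ‖f y‖ₑ ^ p.toReal ∂μ ∂μ :=
            lintegral_const_mul' _ _ (by
              exact ENNReal.rpow_ne_top_of_nonneg (by linarith) ENNReal.ofReal_ne_top)
        _ = ENNReal.ofReal C ^ (p.toReal - 1) *
              ∫⁻ y, ‖f y‖ₑ ^ p.toReal * ∫⁻ x, ENNReal.ofReal (k y x) ∂μ ∂μ := by
            rw [lintegral_lintegral_swap]
            · congr 1
              refine lintegral_congr fun y => ?_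
              rw [← lintegral_const_mul _ (hm y)]
              refine lintegral_congr fun x => ?_
              rw [hk.symm x y, mul_comm]
            · exact hk.measurable.ennreal_ofReal.aemeasurable.mul
                ((hf.1.enorm.pow_const _).comp_snd)
        _ ≤ ENNReal.ofReal C ^ (p.toReal - 1) *
              ∫⁻ y, ‖f y‖ₑ ^ p.toReal * ENNReal.ofReal C ∂μ := by
            gcongr with y
            exact hk.lintegral_le y
        _ = ENNReal.ofReal C ^ p.toReal * ∫⁻ y, ‖f y‖ₑ ^ p.toReal ∂μ := by
            rw [lintegral_mul_const' _ _ ENNReal.ofReal_ne_top, mul_comm (∫⁻ y, _ ∂μ), ← mul_assoc]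
            congr 1
            conv_lhs => rw [← ENNReal.rpow_one (ENNReal.ofReal C), ← ENNReal.rpow_mul]
            rw [← ENNReal.rpow_add_of_nonneg _ _ (by linarith) zero_le_one]
            congr 1
            ring
  exact ⟨⟨hk.aestronglyMeasurable_kernelOp hf.1,
    key.trans_lt (ENNReal.mul_lt_top ENNReal.ofReal_lt_top hf.2)⟩, key⟩

/-- Fubini. Joint integrability holds because integrating the absolute value in y first gives k₃
|f|, already known to be integrable. -/
theorem kernelOp_comp [SFinite μ] {k₁ k₂ k₃ : X → X → ℝ} {C₁ C₂ C₃ : ℝ}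
    (h₁ : IsSymmKernel μ k₁ C₁) (h₂ : IsSymmKernel μ k₂ C₂) (h₃ : IsSymmKernel μ k₃ C₃)
    (h : ∀ x z, ∫ y, k₁ x y * k₂ y z ∂μ = k₃ x z) {p : ℝ≥0∞} (hp : 1 ≤ p) {f : X → 𝕜}
    (hf : MemLp f p μ) (x : X) : kernelOp μ k₃ f x = kernelOp μ k₁ (kernelOp μ k₂ f) x := by
  have hint : ∀ z, Integrable (fun y => k₁ x y * k₂ y z) μ := fun z => by
    obtain ⟨M, hM⟩ := h₂.bounded z
    have hm : Measurable fun y => k₂ y z := h₂.measurable.comp measurable_prodMk_right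
    refine (h₁.integrable x).mul_bdd hm.aestronglyMeasurable (c := M) (ae_of_all _ fun y => ?_)
    rw [Real.norm_of_nonneg (h₂.nonneg y z), h₂.symm]
    exact hM y
  have hm : AEStronglyMeasurable (fun q : X × X => ((k₁ x q.1 * k₂ q.1 q.2 : ℝ) : 𝕜) * f q.2)
      (μ.prod μ) := by
    refine AEStronglyMeasurable.mul ?_ hf.1.comp_snd
    exact (RCLike.measurable_ofReal.comp (((h₁.measurable_slice x).comp measurable_fst).mul
      h₂.measurable)).aestronglyMeasurable
  have hI : Integrable (fun q : X × X => ((k₁ x q.1 * k₂ q.1 q.2 : ℝ) : 𝕜) * f q.2)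
      (μ.prod μ) := by
    refine (integrable_prod_iff' hm).2 ⟨ae_of_all _ fun z => ?_, ?_⟩
    · exact Integrable.mul_const (f := fun y => ((k₁ x y * k₂ y z : ℝ) : 𝕜)) (hint z).ofReal (f z)
    · refine (h₃.integrable_mul_of_memLp x hp hf).norm.congr (ae_of_all _ fun z => ?_)
      simp only [norm_mul, RCLike.norm_ofReal]
      rw [integral_mul_const, ← h x z, abs_of_nonneg
        (integral_nonneg fun y => mul_nonneg (h₁.nonneg x y) (h₂.nonneg y z))]
      congr 1
      refine integral_congr_ae (ae_of_all _ fun y => ?_)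
      exact (abs_of_nonneg (mul_nonneg (h₁.nonneg x y) (h₂.nonneg y z))).symm
  calc kernelOp μ k₃ f x = ∫ z, ∫ y, ((k₁ x y * k₂ y z : ℝ) : 𝕜) * f z ∂μ ∂μ := by
        refine integral_congr_ae (ae_of_all _ fun z => ?_)
        simp only
        rw [integral_mul_const, integral_ofReal, h]
    _ = ∫ y, ∫ z, ((k₁ x y * k₂ y z : ℝ) : 𝕜) * f z ∂μ ∂μ := (integral_integral_swap hI).symm
    _ = _ := by
        refine integral_congr_ae (ae_of_all _ fun y => ?_)
        simp only [kernelOp]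
        rw [← integral_const_mul]
        refine integral_congr_ae (ae_of_all _ fun z => ?_)
        simp only
        push_cast
        ring

theorem integrable_prod_mul_norm_sq [SFinite μ] (hk : IsSymmKernel μ k C) {g : X → 𝕜}
    (hg : MemLp g 2 μ) : Integrable (fun q : X × X => k q.1 q.2 * ‖g q.1‖ ^ 2) (μ.prod μ) := by
  have hm : AEStronglyMeasurable (fun q : X × X => k q.1 q.2 * ‖g q.1‖ ^ 2) (μ.prod μ) :=
    hk.measurable.aestronglyMeasurable.mul (hg.1.comp_fst.norm.pow 2)
  refine (integrable_prod_iff hm).2 ⟨ae_of_all _ fun x => (hk.integrable x).mul_const (‖g x‖ ^ 2), ?_⟩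
  refine Integrable.mono' (hg.integrable_norm_pow (by norm_num)|>.const_mul C)
    hm.norm.integral_prod_right' (ae_of_all _ fun x => ?_)
  have : ∀ y, ‖k x y * ‖g x‖ ^ 2‖ = k x y * ‖g x‖ ^ 2 := fun y =>
    Real.norm_of_nonneg (mul_nonneg (hk.nonneg x y) (by positivity))
  simp only [this]
  rw [integral_mul_const, Real.norm_of_nonneg (mul_nonneg
    (integral_nonneg (hk.nonneg x)) (by positivity))]
  exact mul_le_mul_of_nonneg_right (hk.integral_le x) (by positivity)

/-- Fubini and symmetry of the kernel; the double integrand is dominated by k(x, y)(|g(x)|² +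
|f(y)|²). -/
theorem integral_inner_kernelOp [SFinite μ] (hk : IsSymmKernel μ k C) {f g : X → 𝕜}
    (hf : MemLp f 2 μ) (hg : MemLp g 2 μ) :
    ∫ x, inner 𝕜 (kernelOp μ k f x) (g x) ∂μ = ∫ x, inner 𝕜 (f x) (kernelOp μ k g x) ∂μ := by
  have hI : Integrable (fun q : X × X => g q.1 * ((k q.1 q.2 : 𝕜) * starRingEnd 𝕜 (f q.2)))
      (μ.prod μ) := by
    have h1 := hk.integrable_prod_mul_norm_sq hg
    have h2 := (hk.integrable_prod_mul_norm_sq hf).swap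
    refine Integrable.mono' (h1.add h2) ?_ (ae_of_all _ fun q => ?_)
    · refine hg.1.comp_fst.mul (AEStronglyMeasurable.mul ?_ ?_)
      · exact (RCLike.measurable_ofReal.comp hk.measurable).aestronglyMeasurable
      · exact RCLike.continuous_conj.comp_aestronglyMeasurable hf.1.comp_snd
    · simp only [Pi.add_apply, Function.comp_apply, Prod.fst_swap, Prod.snd_swap, norm_mul,
        RCLike.norm_ofReal, RCLike.norm_conj, abs_of_nonneg (hk.nonneg _ _), hk.symm q.2 q.1]
      nlinarith [mul_nonneg (hk.nonneg q.1 q.2) (sq_nonneg (‖g q.1‖ - ‖f q.2‖)),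
        mul_nonneg (hk.nonneg q.1 q.2) (sq_nonneg (‖g q.1‖ + ‖f q.2‖))]
  calc _ = ∫ x, ∫ y, g x * ((k x y : 𝕜) * starRingEnd 𝕜 (f y)) ∂μ ∂μ := by
        refine integral_congr_ae (ae_of_all _ fun x => ?_)
        simp only [RCLike.inner_apply, kernelOp]
        rw [integral_const_mul, ← integral_conj]
        simp
    _ = ∫ y, ∫ x, g x * ((k x y : 𝕜) * starRingEnd 𝕜 (f y)) ∂μ ∂μ := integral_integral_swap hI
    _ = _ := by
        refine integral_congr_ae (ae_of_all _ fun y => ?_)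
        simp only [RCLike.inner_apply, kernelOp]
        rw [← integral_mul_const]
        refine integral_congr_ae (ae_of_all _ fun x => ?_)
        simp only [hk.symm x y]
        ring

end IsSymmKernel

end KernelOperators

/-! ### The kernel of the modified semigroup in several variables -/

section ProductKernel

variable {d : ℕ} {α : Fin d → ℝ} {j : Fin d} {r s : ℝ}

/-- The `i`-th factor of the modified kernel. -/
noncomputable def modifiedFactor (α : Fin d → ℝ) (j : Fin d) (r : ℝ) (i : Fin d) (x y : ℝ) : ℝ :=
  if i = j then modifiedMehlerKernel (α i) r x y else mehlerKernel (α i) r x y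

/-- The modified kernel in product form. -/
noncomputable def modifiedProdKernel (α : Fin d → ℝ) (j : Fin d) (r : ℝ) (x y : Fin d → ℝ) : ℝ :=
  ∏ i, modifiedFactor α j r i (x i) (y i)

/-- The Mehler kernel in several variables. -/
noncomputable def mehlerProdKernel (β : Fin d → ℝ) (r : ℝ) (x y : Fin d → ℝ) : ℝ :=
  ∏ i, mehlerKernel (β i) r (x i) (y i)

theorem IsAdmissible.neg_one_lt_add_single (hα : IsAdmissible α j) (i : Fin d) :
    -1 < (α + Pi.single j 1 : Fin d → ℝ) i := by
  by_cases h : i = j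
  · subst h
    have := hα.1
    simp only [Pi.add_apply, Pi.single_eq_same]
    linarith
  · simpa [Pi.single_apply, h] using hα.2 i h

theorem modifiedProdKernel_eq (α : Fin d → ℝ) (j : Fin d) (r : ℝ) (x y : Fin d → ℝ) :
    modifiedProdKernel α j r x y =
      r * (√|x j| * √|y j| * mehlerProdKernel (α + Pi.single j 1) r x y) := by
  rw [modifiedProdKernel, mehlerProdKernel, ← Finset.mul_prod_erase _ _ (Finset.mem_univ j),
    ← Finset.mul_prod_erase _ _ (Finset.mem_univ j)]
  have h : ∏ i ∈ Finset.univ.erase j, modifiedFactor α j r i (x i) (y i) =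
      ∏ i ∈ Finset.univ.erase j, mehlerKernel ((α + Pi.single j 1 : Fin d → ℝ) i) r (x i) (y i) := by
    refine Finset.prod_congr rfl fun i hi => ?_
    have hij := Finset.ne_of_mem_erase hi
    simp [modifiedFactor, hij]
  rw [h, modifiedFactor, if_pos rfl, modifiedMehlerKernel]
  simp only [Pi.add_apply, Pi.single_eq_same]
  ring

theorem modifiedKernel_eq_modifiedProdKernel (hα : IsAdmissible α j) {t : ℝ} (ht : 0 < t)
    {x y : Fin d → ℝ} (hx : x ∈ posOrthant d) (hy : y ∈ posOrthant d) :
    modifiedKernel α j t x y = modifiedProdKernel α j (Real.exp (-t)) x y := by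
  rw [modifiedKernel, laguerreHeatKernel_eq_prod hα.neg_one_lt_add_single ht hx hy,
    modifiedProdKernel_eq, mehlerProdKernel, abs_of_pos (hx j), abs_of_pos (hy j),
    Real.sqrt_mul (hx j).le]

theorem modifiedFactor_nonneg (hα : IsAdmissible α j) (hr0 : 0 ≤ r) (hr : r < 1) (i : Fin d)
    (x y : ℝ) : 0 ≤ modifiedFactor α j r i x y := by
  unfold modifiedFactor
  split_ifs with h
  · subst h
    have := mehlerKernel_nonneg (a := α i + 1) (by linarith [hα.1]) hr0 hr x y
    unfold modifiedMehlerKernel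
    positivity
  · exact mehlerKernel_nonneg (hα.2 i h) hr0 hr x y

theorem modifiedFactor_symm (α : Fin d → ℝ) (j : Fin d) (r : ℝ) (i : Fin d) (x y : ℝ) :
    modifiedFactor α j r i x y = modifiedFactor α j r i y x := by
  simp only [modifiedFactor, modifiedMehlerKernel, mehlerKernel_symm _ r x y, mul_comm √|x|]

theorem measurable_modifiedFactor (α : Fin d → ℝ) (j : Fin d) (r : ℝ) (i : Fin d) :
    Measurable fun p : ℝ × ℝ => modifiedFactor α j r i p.1 p.2 := by
  have h1 := measurable_mehlerKernel (α i) r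
  have h2 := measurable_mehlerKernel (α i + 1) r
  unfold modifiedFactor
  split_ifs
  · unfold modifiedMehlerKernel
    fun_prop
  · exact h1

theorem integral_modifiedFactor (hα : IsAdmissible α j) (hr0 : 0 ≤ r) (hr : r < 1) (i : Fin d)
    (x : ℝ) : Integrable (modifiedFactor α j r i x) (laguerreMeasureReal (α i)) ∧
    ∫ y, modifiedFactor α j r i x y ∂laguerreMeasureReal (α i) =
      if i = j then √r * modifiedMass (α j + 1) (r * |x| / (1 - r)) else 1 := by
  unfold modifiedFactor
  split_ifs with h
  · subst h
    exact integral_modifiedMehlerKernel hα.1 hr0 hr x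
  · exact integral_mehlerKernel_self (hα.2 i h) hr0 hr x

theorem exists_modifiedFactor_le (hα : IsAdmissible α j) (hr0 : 0 < r) (hr : r < 1) (i : Fin d)
    (x : ℝ) : ∃ M, ∀ y, modifiedFactor α j r i x y ≤ M := by
  unfold modifiedFactor
  split_ifs with h
  · subst h
    obtain ⟨M, hM⟩ := exists_sqrt_mul_mehlerKernel_le (a := α i + 1) (by linarith [hα.1]) hr0 hr x
    refine ⟨r * (√|x| * M), fun y => ?_⟩
    rw [modifiedMehlerKernel, mul_assoc √|x|]
    gcongr
    exact (hM y).2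
  · obtain ⟨M, hM⟩ := exists_sqrt_mul_mehlerKernel_le (hα.2 i h) hr0 hr x
    exact ⟨M, fun y => (hM y).1⟩

theorem integral_modifiedProdKernel (hα : IsAdmissible α j) (hr0 : 0 ≤ r) (hr : r < 1)
    (x : Fin d → ℝ) : Integrable (modifiedProdKernel α j r x) (laguerreMeasure α) ∧
    ∫ y, modifiedProdKernel α j r x y ∂laguerreMeasure α =
      √r * modifiedMass (α j + 1) (r * |x j| / (1 - r)) := by
  have h := fun i => integral_modifiedFactor hα hr0 hr i (x i)
  rw [laguerreMeasure_eq_pi]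
  refine ⟨Integrable.fintype_prod fun i => (h i).1, ?_⟩
  unfold modifiedProdKernel
  rw [integral_fintype_prod_eq_prod (fun i y => modifiedFactor α j r i (x i) y)]
  simp only [fun i => (h i).2]
  rw [Finset.prod_ite_eq' Finset.univ j fun i => √r * modifiedMass (α j + 1) (r * |x i| / (1 - r))]
  simp

theorem measurable_modifiedProdKernel (α : Fin d → ℝ) (j : Fin d) (r : ℝ) :
    Measurable fun p : (Fin d → ℝ) × (Fin d → ℝ) => modifiedProdKernel α j r p.1 p.2 := by
  have h (i : Fin d) : Measurable fun p : (Fin d → ℝ) × (Fin d → ℝ) =>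
      modifiedFactor α j r i (p.1 i) (p.2 i) := by
    have hi : Measurable fun p : (Fin d → ℝ) × (Fin d → ℝ) => (p.1 i, p.2 i) := by fun_prop
    exact (measurable_modifiedFactor α j r i).comp hi
  exact Finset.measurable_fun_prod _ fun i _ => h i

theorem isSymmKernel_modifiedProdKernel (hα : IsAdmissible α j) (hr0 : 0 < r) (hr : r < 1)
    {c : ℝ} (hc : ∀ z, 0 ≤ z → modifiedMass (α j + 1) z ≤ c) :
    IsSymmKernel (laguerreMeasure α) (modifiedProdKernel α j r) (√r * c) where
  measurable := by
    exact measurable_modifiedProdKernel α j r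
  nonneg x y := Finset.prod_nonneg fun i _ => modifiedFactor_nonneg hα hr0.le hr i _ _
  symm x y := Finset.prod_congr rfl fun i _ => modifiedFactor_symm α j r i _ _
  integrable x := (integral_modifiedProdKernel hα hr0.le hr x).1
  integral_le x := by
    have h1r : 0 < 1 - r := by linarith
    rw [(integral_modifiedProdKernel hα hr0.le hr x).2]
    exact mul_le_mul_of_nonneg_left (hc _ (by positivity)) (Real.sqrt_nonneg r)
  bounded x := by
    choose M hM using fun i => exists_modifiedFactor_le hα hr0 hr i (x i)
    exact ⟨∏ i, M i, fun y => Finset.prod_le_prod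
      (fun i _ => modifiedFactor_nonneg hα hr0.le hr i _ _) fun i _ => hM i _⟩

/-- The Chapman–Kolmogorov identity holds in each coordinate, and the integral of a product over the
product measure factors. -/
theorem integral_modifiedProdKernel_mul (hα : IsAdmissible α j) (hr0 : 0 ≤ r) (hr : r < 1)
    (hs0 : 0 ≤ s) (hs : s < 1) (x z : Fin d → ℝ) :
    ∫ y, modifiedProdKernel α j r x y * modifiedProdKernel α j s y z ∂laguerreMeasure α =
      modifiedProdKernel α j (r * s) x z := by
  rw [laguerreMeasure_eq_pi]
  unfold modifiedProdKernel
  simp only [← Finset.prod_mul_distrib]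
  rw [integral_fintype_prod_eq_prod
    (fun i y => modifiedFactor α j r i (x i) y * modifiedFactor α j s i y (z i))]
  refine Finset.prod_congr rfl fun i _ => ?_
  unfold modifiedFactor
  split_ifs with h
  · subst h
    exact integral_modifiedMehlerKernel_mul (by linarith [hα.1]) hr0 hr hs0 hs _ _
  · exact (integral_mehlerKernel_mul_mehlerKernel (hα.2 i h) hr0 hr hs0 hs _ _).2

theorem modifiedSemigroup_eq_kernelOp {𝕜 : Type*} [RCLike 𝕜] (hα : IsAdmissible α j) {t : ℝ}
    (ht : 0 < t) (f : (Fin d → ℝ) → 𝕜) {x : Fin d → ℝ} (hx : x ∈ posOrthant d) :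
    modifiedSemigroup 𝕜 α j t f x =
      kernelOp (laguerreMeasure α) (modifiedProdKernel α j (Real.exp (-t))) f x := by
  rw [modifiedSemigroup, if_neg ht.ne', kernelOp]
  refine integral_congr_ae ?_
  filter_upwards [ae_laguerreMeasure_mem_posOrthant α] with y hy
  rw [modifiedKernel_eq_modifiedProdKernel hα ht hx hy]

theorem modifiedSemigroup_ae_eq {𝕜 : Type*} [RCLike 𝕜] (hα : IsAdmissible α j) {t : ℝ}
    (ht : 0 < t) (f : (Fin d → ℝ) → 𝕜) : modifiedSemigroup 𝕜 α j t f =ᵐ[laguerreMeasure α]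
      kernelOp (laguerreMeasure α) (modifiedProdKernel α j (Real.exp (-t))) f := by
  filter_upwards [ae_laguerreMeasure_mem_posOrthant α] with x hx
  exact modifiedSemigroup_eq_kernelOp hα ht f hx

end ProductKernel

/-! ### Approximate identities -/

section Approximation

variable {d : ℕ} {E : Type*} [NormedAddCommGroup E] [NormedSpace ℝ E]

theorem integral_laguerreMeasure_add_single (α : Fin d → ℝ) (j : Fin d) (f : (Fin d → ℝ) → E) :
    ∫ y, f y ∂laguerreMeasure (α + Pi.single j 1) = ∫ y, y j • f y ∂laguerreMeasure α := by
  rw [laguerreMeasure, laguerreMeasure,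
    integral_withDensity_eq_integral_toReal_smul (by fun_prop) (by simp),
    integral_withDensity_eq_integral_toReal_smul (by fun_prop) (by simp)]
  refine integral_congr_ae ?_
  filter_upwards [ae_restrict_mem (measurableSet_posOrthant d)] with y hy
  have hpos : ∀ γ : Fin d → ℝ, 0 ≤ ∏ i, y i ^ γ i * Real.exp (-y i) := fun γ =>
    Finset.prod_nonneg fun i _ => by
      have := hy i
      positivity
  rw [ENNReal.toReal_ofReal (hpos _), ENNReal.toReal_ofReal (hpos _), smul_smul]
  congr 1
  rw [← Finset.mul_prod_erase _ _ (Finset.mem_univ j),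
    ← Finset.mul_prod_erase Finset.univ (fun i => y i ^ α i * Real.exp (-y i)) (Finset.mem_univ j)]
  have h : ∏ i ∈ Finset.univ.erase j, y i ^ (α + Pi.single j 1 : Fin d → ℝ) i * Real.exp (-y i) =
      ∏ i ∈ Finset.univ.erase j, y i ^ α i * Real.exp (-y i) := by
    refine Finset.prod_congr rfl fun i hi => ?_
    simp [Finset.ne_of_mem_erase hi]
  rw [h]
  simp only [Pi.add_apply, Pi.single_eq_same, Real.rpow_add (hy j), Real.rpow_one]
  ring

variable {β : Fin d → ℝ} {r : ℝ}

theorem mehlerProdKernel_nonneg (hβ : ∀ i, -1 < β i) (hr0 : 0 ≤ r) (hr : r < 1)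
    (x y : Fin d → ℝ) : 0 ≤ mehlerProdKernel β r x y :=
  Finset.prod_nonneg fun i _ => mehlerKernel_nonneg (hβ i) hr0 hr _ _

theorem integral_mehlerProdKernel (hβ : ∀ i, -1 < β i) (hr0 : 0 ≤ r) (hr : r < 1)
    (x : Fin d → ℝ) : Integrable (mehlerProdKernel β r x) (laguerreMeasure β) ∧
    ∫ y, mehlerProdKernel β r x y ∂laguerreMeasure β = 1 := by
  have h := fun i => integral_mehlerKernel_self (hβ i) hr0 hr (x i)
  rw [laguerreMeasure_eq_pi]
  refine ⟨Integrable.fintype_prod fun i => (h i).1, ?_⟩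
  unfold mehlerProdKernel
  rw [integral_fintype_prod_eq_prod (fun i y => mehlerKernel (β i) r (x i) y)]
  simp only [fun i => (h i).2, Finset.prod_const_one]

/-- Only the i-th factor sees the weight; the other coordinates integrate to 1. -/
theorem integral_sq_sub_mul_mehlerProdKernel (hβ : ∀ i, -1 < β i) (hr0 : 0 ≤ r) (hr : r < 1)
    {x : Fin d → ℝ} (hx : x ∈ posOrthant d) (i : Fin d) :
    Integrable (fun y => (y i - x i) ^ 2 * mehlerProdKernel β r x y) (laguerreMeasure β) ∧
    ∫ y, (y i - x i) ^ 2 * mehlerProdKernel β r x y ∂laguerreMeasure β =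
      ∫ y, (y - x i) ^ 2 * mehlerKernel (β i) r (x i) y ∂laguerreMeasureReal (β i) := by
  set F : Fin d → ℝ → ℝ := fun l y =>
    (if l = i then (y - x i) ^ 2 else 1) * mehlerKernel (β l) r (x l) y with hF
  have he : (fun y => (y i - x i) ^ 2 * mehlerProdKernel β r x y) = fun y => ∏ l, F l (y l) := by
    ext y
    rw [hF, Finset.prod_mul_distrib,
      Finset.prod_ite_eq' Finset.univ i fun l => (y l - x i) ^ 2, if_pos (Finset.mem_univ i)]
    rfl
  have hI : ∀ l, Integrable (F l) (laguerreMeasureReal (β l)) ∧ ∫ y, F l y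
      ∂laguerreMeasureReal (β l) = if l = i then
        ∫ y, (y - x i) ^ 2 * mehlerKernel (β i) r (x i) y ∂laguerreMeasureReal (β i) else 1 := by
    intro l
    by_cases h : l = i
    · subst h
      simp only [hF, if_true]
      exact ⟨(integral_sq_sub_mul_mehlerKernel (hβ l) hr0 hr (hx l).le).1, trivial⟩
    · simp only [hF, if_neg h, one_mul]
      exact integral_mehlerKernel_self (hβ l) hr0 hr (x l)
  rw [he, laguerreMeasure_eq_pi]
  refine ⟨Integrable.fintype_prod fun l => (hI l).1, ?_⟩
  rw [integral_fintype_prod_eq_prod F]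
  simp only [fun l => (hI l).2]
  rw [Finset.prod_ite_eq' Finset.univ i fun _ =>
    ∫ y, (y - x i) ^ 2 * mehlerKernel (β i) r (x i) y ∂laguerreMeasureReal (β i)]
  simp

/-- Chebyshev's argument. Near x continuity gives ε / 2; at distance at least δ some coordinate
differs by at least δ, so the increment of h, at most 2M, is bounded by 2M/δ² times the squared
Euclidean distance, whose mean V r tends to 0. -/
theorem tendsto_integral_mehlerProdKernel_smul (hβ : ∀ i, -1 < β i) {x : Fin d → ℝ}
    (hx : x ∈ posOrthant d) {h : (Fin d → ℝ) → E} [CompleteSpace E]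
    (hm : AEStronglyMeasurable h (laguerreMeasure β)) {M : ℝ} (hM : ∀ y, ‖h y‖ ≤ M)
    (hc : ContinuousAt h x) :
    Tendsto (fun r => ∫ y, mehlerProdKernel β r x y • h y ∂laguerreMeasure β) (𝓝[<] 1)
      (𝓝 (h x)) := by
  rw [Metric.tendsto_nhds]
  intro ε hε
  obtain ⟨δ, hδ, hδc⟩ := Metric.continuousAt_iff.1 hc (ε / 2) (by positivity)
  have hM0 : 0 ≤ M := (norm_nonneg _).trans (hM x)
  set V : ℝ → ℝ := fun r => ∑ i, (1 - r) * ((1 - r) * (x i ^ 2 + (β i + 1) * (β i + 2)) +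
    (2 * β i + 4) * r * x i - 2 * (β i + 1) * x i) with hV
  have hlim : Tendsto (fun r => ε / 2 + 2 * M / δ ^ 2 * V r) (𝓝[<] 1) (𝓝 (ε / 2)) := by
    have hcont : Continuous fun r => ε / 2 + 2 * M / δ ^ 2 * V r := by fun_prop
    have := hcont.tendsto 1
    simp only [hV, sub_self, zero_mul, Finset.sum_const_zero, mul_zero, add_zero] at this
    exact this.mono_left nhdsWithin_le_nhds
  have hpos : ∀ᶠ r : ℝ in 𝓝[<] 1, 0 < r :=
    (eventually_gt_nhds zero_lt_one).filter_mono nhdsWithin_le_nhds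
  filter_upwards [hlim.eventually_lt_const (by linarith : ε / 2 < ε), hpos,
    self_mem_nhdsWithin] with r hr hr0 hr1
  have hr1' : r < 1 := hr1
  obtain ⟨h1, h2⟩ := integral_mehlerProdKernel hβ hr0.le hr1' x
  have h3 := fun i => integral_sq_sub_mul_mehlerProdKernel hβ hr0.le hr1' hx i
  have hkn := mehlerProdKernel_nonneg hβ hr0.le hr1' x
  have hint : Integrable (fun y => mehlerProdKernel β r x y • h y) (laguerreMeasure β) := by
    exact h1.smul_bdd M hm (ae_of_all _ hM)
  have he : (∫ y, mehlerProdKernel β r x y • h y ∂laguerreMeasure β) - h x =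
      ∫ y, mehlerProdKernel β r x y • (h y - h x) ∂laguerreMeasure β := by
    simp only [smul_sub]
    rw [integral_sub hint (h1.smul_const _), integral_smul_const, h2, one_smul]
  rw [dist_eq_norm, he]
  refine lt_of_le_of_lt ?_ hr
  have hbi : Integrable (fun y => ε / 2 * mehlerProdKernel β r x y + 2 * M / δ ^ 2 *
      ∑ i, (y i - x i) ^ 2 * mehlerProdKernel β r x y) (laguerreMeasure β) :=
    (h1.const_mul _).add ((integrable_finsetSum _ fun i _ => (h3 i).1).const_mul _)
  refine (norm_integral_le_of_norm_le hbi (ae_of_all _ fun y => ?_)).trans_eq ?_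
  · rw [norm_smul, Real.norm_of_nonneg (hkn y), ← Finset.sum_mul]
    have hb : ‖h y - h x‖ ≤ ε / 2 + 2 * M / δ ^ 2 * ∑ i, (y i - x i) ^ 2 := by
      have hsum : 0 ≤ ∑ i, (y i - x i) ^ 2 := Finset.sum_nonneg fun i _ => sq_nonneg _
      by_cases hy : dist y x < δ
      · have h4 := (hδc hy).le
        rw [dist_eq_norm] at h4
        have : 0 ≤ 2 * M / δ ^ 2 * ∑ i, (y i - x i) ^ 2 := by positivity
        linarith
      · have h5 : ∃ i, δ ≤ dist (y i) (x i) := by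
          by_contra! h5
          exact hy ((dist_pi_lt_iff hδ).2 h5)
        obtain ⟨i, hi⟩ := h5
        have h6 : δ ^ 2 ≤ ∑ i, (y i - x i) ^ 2 := by
          refine le_trans ?_ (Finset.single_le_sum (f := fun i => (y i - x i) ^ 2)
            (fun i _ => sq_nonneg _) (Finset.mem_univ i))
          rw [Real.dist_eq] at hi
          rw [← sq_abs (y i - x i)]
          gcongr
        have h7 : 2 * M ≤ 2 * M / δ ^ 2 * ∑ i, (y i - x i) ^ 2 := by
          rw [div_mul_eq_mul_div, le_div_iff₀ (by positivity)]
          gcongr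
        have h8 := norm_sub_le (h y) (h x)
        linarith [hM y, hM x]
    calc _ ≤ mehlerProdKernel β r x y * (ε / 2 + 2 * M / δ ^ 2 * ∑ i, (y i - x i) ^ 2) :=
          mul_le_mul_of_nonneg_left hb (hkn y)
      _ = _ := by ring
  · rw [integral_add (h1.const_mul _) ((integrable_finsetSum _ fun i _ => (h3 i).1).const_mul _),
      integral_const_mul, integral_const_mul, h2, integral_finsetSum _ fun i _ => (h3 i).1, mul_one,
      hV]
    simp only [fun i => (h3 i).2]
    congr 2
    exact Finset.sum_congr rfl fun i _ =>
      (integral_sq_sub_mul_mehlerKernel (hβ i) hr0.le hr1' (hx i).le).2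

end Approximation

/-! ### Strong continuity -/

section StrongContinuity

variable {𝕜 : Type*} [RCLike 𝕜]

theorem IsSymmKernel.norm_kernelOp_le {X : Type*} [MeasurableSpace X] {μ : Measure X}
    {k : X → X → ℝ} {C : ℝ} (hk : IsSymmKernel μ k C) {f : X → 𝕜} {B : ℝ} (hB0 : 0 ≤ B)
    (hB : ∀ᵐ y ∂μ, ‖f y‖ ≤ B) (x : X) : ‖kernelOp μ k f x‖ ≤ C * B := by
  refine (norm_integral_le_of_norm_le ((hk.integrable x).mul_const B) ?_).trans ?_
  · filter_upwards [hB] with y hy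
    rw [norm_mul, RCLike.norm_ofReal, abs_of_nonneg (hk.nonneg x y)]
    exact mul_le_mul_of_nonneg_left hy (hk.nonneg x y)
  · rw [integral_mul_const]
    exact mul_le_mul_of_nonneg_right (hk.integral_le x) hB0

theorem IsSymmKernel.kernelOp_sub {X : Type*} [MeasurableSpace X] {μ : Measure X}
    {k : X → X → ℝ} {C : ℝ} (hk : IsSymmKernel μ k C) {p : ℝ≥0∞} (hp : 1 ≤ p) {f g : X → 𝕜}
    (hf : MemLp f p μ) (hg : MemLp g p μ) :
    kernelOp μ k (f - g) = kernelOp μ k f - kernelOp μ k g := by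
  ext x
  simp only [kernelOp, Pi.sub_apply, mul_sub]
  exact integral_sub (hk.integrable_mul_of_memLp x hp hf) (hk.integrable_mul_of_memLp x hp hg)

variable {d : ℕ} {α : Fin d → ℝ} {j : Fin d}

/-- The modified operator is the Mehler operator of order α + e_j conjugated by √(x_j), times r.
Boundedness of g / √(y_j) is therefore the natural condition for pointwise convergence. -/
theorem kernelOp_modifiedProdKernel_eq (α : Fin d → ℝ) (j : Fin d) (r : ℝ)
    (g : (Fin d → ℝ) → 𝕜) {x : Fin d → ℝ} (hx : x ∈ posOrthant d) :
    kernelOp (laguerreMeasure α) (modifiedProdKernel α j r) g x =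
      (r * √(x j)) • ∫ y, mehlerProdKernel (α + Pi.single j 1) r x y • ((√(y j))⁻¹ • g y)
        ∂laguerreMeasure (α + Pi.single j 1) := by
  rw [integral_laguerreMeasure_add_single, ← integral_smul, kernelOp]
  refine integral_congr_ae ?_
  filter_upwards [ae_laguerreMeasure_mem_posOrthant α] with y hy
  have h1 := Real.mul_self_sqrt (hy j).le
  have h2 := (Real.sqrt_pos.2 (hy j)).ne'
  rw [modifiedProdKernel_eq, abs_of_pos (hx j), abs_of_pos (hy j), ← RCLike.real_smul_eq_coe_mul,
    smul_smul, smul_smul, smul_smul]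
  congr 1
  nth_rw 2 [← h1]
  field_simp

theorem tendsto_kernelOp_modifiedProdKernel (hα : IsAdmissible α j) {x : Fin d → ℝ}
    (hx : x ∈ posOrthant d) {g : (Fin d → ℝ) → 𝕜} (hg : Continuous g) {M : ℝ} (hM0 : 0 ≤ M)
    (hM : ∀ y, ‖g y‖ ≤ M * √(y j)) :
    Tendsto (fun r => kernelOp (laguerreMeasure α) (modifiedProdKernel α j r) g x) (𝓝[<] 1)
      (𝓝 (g x)) := by
  simp only [fun r => kernelOp_modifiedProdKernel_eq α j r g hx]
  have hs := Real.sqrt_pos.2 (hx j)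
  have h1 : Tendsto (fun r : ℝ => r * √(x j)) (𝓝[<] 1) (𝓝 (1 * √(x j))) :=
    ((continuous_id.mul continuous_const).tendsto 1).mono_left nhdsWithin_le_nhds
  have h2 := tendsto_integral_mehlerProdKernel_smul hα.neg_one_lt_add_single hx
    (h := fun y => (√(y j))⁻¹ • g y) (by
      have : Measurable fun y : Fin d → ℝ => (√(y j))⁻¹ := by fun_prop
      exact this.aestronglyMeasurable.smul hg.aestronglyMeasurable) (M := M) (fun y => by
      rw [norm_smul, Real.norm_of_nonneg (by positivity)]
      rcases (Real.sqrt_nonneg (y j)).eq_or_lt with h | h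
      · rw [← h]; simpa using hM0
      · calc _ ≤ (√(y j))⁻¹ * (M * √(y j)) := by gcongr; exact hM y
          _ = M := by field_simp) (by
      refine ContinuousAt.smul (ContinuousAt.inv₀ ?_ hs.ne') hg.continuousAt
      exact (Real.continuous_sqrt.comp (continuous_apply j)).continuousAt)
  have h3 := h1.smul h2
  rwa [one_mul, smul_smul, mul_inv_cancel₀ hs.ne', one_smul] at h3

theorem tendsto_eLpNorm_kernelOp_sub_of_bounded [IsFiniteMeasure (laguerreMeasure α)]
    (hα : IsAdmissible α j)
    (hk : ∀ r, 0 < r → r < 1 → IsSymmKernel (laguerreMeasure α) (modifiedProdKernel α j r) 1)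
    {g : (Fin d → ℝ) → 𝕜} (hg : Continuous g) {M B : ℝ} (hM0 : 0 ≤ M)
    (hM : ∀ y, ‖g y‖ ≤ M * √(y j)) (hB0 : 0 ≤ B) (hB : ∀ y, ‖g y‖ ≤ B) :
    Tendsto (fun r => eLpNorm (kernelOp (laguerreMeasure α) (modifiedProdKernel α j r) g - g) 2
      (laguerreMeasure α)) (𝓝[<] 1) (𝓝 0) := by
  have hev : ∀ᶠ r : ℝ in 𝓝[<] 1, 0 < r ∧ r < 1 :=
    ((eventually_gt_nhds zero_lt_one).filter_mono nhdsWithin_le_nhds).and self_mem_nhdsWithin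
  have hlim : Tendsto (fun r => ∫⁻ x, ‖(kernelOp (laguerreMeasure α) (modifiedProdKernel α j r) g -
      g) x‖ₑ ^ (2 : ℝ) ∂laguerreMeasure α) (𝓝[<] 1) (𝓝 (∫⁻ _, 0 ∂laguerreMeasure α)) := by
    refine tendsto_lintegral_filter_of_dominated_convergence' (fun _ =>
      (ENNReal.ofReal (B + B)) ^ (2 : ℝ)) ?_ ?_ ?_ ?_
    · filter_upwards [hev] with r hr
      exact (((hk r hr.1 hr.2).aestronglyMeasurable_kernelOp
        hg.aestronglyMeasurable).sub hg.aestronglyMeasurable).enorm.pow_const _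
    · filter_upwards [hev] with r hr
      refine ae_of_all _ fun x => ?_
      gcongr
      rw [← ofReal_norm]
      refine ENNReal.ofReal_le_ofReal ((norm_sub_le _ _).trans (add_le_add ?_ (hB x)))
      simpa using (hk r hr.1 hr.2).norm_kernelOp_le hB0 (ae_of_all _ hB) x
    · rw [lintegral_const]
      exact ENNReal.mul_ne_top (ENNReal.rpow_ne_top_of_nonneg (by norm_num)
        ENNReal.ofReal_ne_top) (measure_ne_top _ _)
    · filter_upwards [ae_laguerreMeasure_mem_posOrthant α] with x hx
      have h1 := (tendsto_kernelOp_modifiedProdKernel hα hx hg hM0 hM).sub_const (g x)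
      rw [sub_self] at h1
      have h2 := (h1.enorm).ennrpow_const (2 : ℝ)
      simpa using h2
  rw [lintegral_zero] at hlim
  have h3 := hlim.ennrpow_const (1 / 2 : ℝ)
  rw [ENNReal.zero_rpow_of_pos (by norm_num)] at h3
  refine h3.congr fun r => ?_
  rw [eLpNorm_eq_lintegral_rpow_enorm_toReal (by norm_num) (by norm_num)]
  simp

/-- Bounded continuous functions are dense in L². Multiplying one by the cutoff min(1, n √(y_j))
makes it at most nB √(y_j), and the cutoff tends to 1 on the orthant, which carries the measure. -/
theorem exists_continuous_le_sqrt_eLpNorm_sub_le [IsFiniteMeasure (laguerreMeasure α)] (j : Fin d)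
    {f : (Fin d → ℝ) → 𝕜} (hf : MemLp f 2 (laguerreMeasure α)) {ε : ℝ≥0∞} (hε : ε ≠ 0) :
    ∃ (g : (Fin d → ℝ) → 𝕜) (M B : ℝ), Continuous g ∧ 0 ≤ M ∧ (∀ y, ‖g y‖ ≤ M * √(y j)) ∧ 0 ≤ B ∧
      (∀ y, ‖g y‖ ≤ B) ∧ MemLp g 2 (laguerreMeasure α) ∧
      eLpNorm (f - g) 2 (laguerreMeasure α) ≤ ε := by
  have hε2 : ε / 2 ≠ 0 := (ENNReal.half_pos hε).ne'
  obtain ⟨g, hfg, hg2⟩ := hf.exists_boundedContinuous_eLpNorm_sub_le (by norm_num) hε2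
  set B := ‖g‖
  have hgB : ∀ y, ‖g y‖ ≤ B := g.norm_coe_le_norm
  set w : ℕ → (Fin d → ℝ) → ℝ := fun n y => min 1 (n * √(y j)) with hw
  have hw0 : ∀ n y, 0 ≤ w n y := fun n y => le_min zero_le_one (by positivity)
  have hw1 : ∀ n y, w n y ≤ 1 := fun n y => min_le_left _ _
  have hwc : ∀ n, Continuous (w n) := fun n => by
    simp only [hw]
    fun_prop
  have hgc : ∀ n, Continuous fun y => w n y • g y := fun n => (hwc n).smul g.continuous
  have hgn : ∀ n y, ‖w n y • g y‖ ≤ B := fun n y => by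
    rw [norm_smul, Real.norm_of_nonneg (hw0 n y)]
    exact (mul_le_of_le_one_left (norm_nonneg _) (hw1 n y)).trans (hgB y)
  have hlim : Tendsto (fun n => ∫⁻ y, ‖(⇑g - fun y => w n y • g y) y‖ₑ ^ (2 : ℝ)
      ∂laguerreMeasure α) atTop (𝓝 (∫⁻ _, 0 ∂laguerreMeasure α)) := by
    refine tendsto_lintegral_of_dominated_convergence' (fun _ =>
      (ENNReal.ofReal (B + B)) ^ (2 : ℝ)) (fun n => ?_) (fun n => ae_of_all _ fun y => ?_) ?_ ?_
    · exact (g.continuous.sub (hgc n)).aestronglyMeasurable.enorm.pow_const _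
    · refine ENNReal.rpow_le_rpow ?_ (by norm_num)
      rw [← ofReal_norm]
      exact ENNReal.ofReal_le_ofReal ((norm_sub_le _ _).trans (add_le_add (hgB y) (hgn n y)))
    · rw [lintegral_const]
      exact ENNReal.mul_ne_top (ENNReal.rpow_ne_top_of_nonneg (by norm_num)
        ENNReal.ofReal_ne_top) (measure_ne_top _ _)
    · filter_upwards [ae_laguerreMeasure_mem_posOrthant α] with y hy
      have hs := Real.sqrt_pos.2 (hy j)
      obtain ⟨N, hN⟩ := exists_nat_gt (√(y j))⁻¹
      refine tendsto_const_nhds.congr' ?_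
      filter_upwards [eventually_ge_atTop N] with n hn
      have h1 : w n y = 1 := by
        refine min_eq_left ?_
        have h2 : (√(y j))⁻¹ ≤ n := hN.le.trans (by exact_mod_cast hn)
        calc (1 : ℝ) = (√(y j))⁻¹ * √(y j) := (inv_mul_cancel₀ hs.ne').symm
          _ ≤ n * √(y j) := by gcongr
      simp [h1]
  rw [lintegral_zero] at hlim
  have h3 := hlim.ennrpow_const (1 / 2 : ℝ)
  rw [ENNReal.zero_rpow_of_pos (by norm_num)] at h3
  obtain ⟨n, hn⟩ := ((ENNReal.tendsto_nhds_zero.1 h3) (ε / 2) (pos_iff_ne_zero.2 hε2)).exists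
  have hL : eLpNorm (⇑g - fun y => w n y • g y) 2 (laguerreMeasure α) ≤ ε / 2 := by
    rw [eLpNorm_eq_lintegral_rpow_enorm_toReal (by norm_num) (by norm_num)]
    simpa using hn
  have hmem : MemLp (fun y => w n y • g y) 2 (laguerreMeasure α) :=
    MemLp.of_bound (hgc n).aestronglyMeasurable B (ae_of_all _ (hgn n))
  refine ⟨fun y => w n y • g y, n * B, B, hgc n, by positivity, fun y => ?_, norm_nonneg _, hgn n,
    hmem, ?_⟩
  · rw [norm_smul, Real.norm_of_nonneg (hw0 n y)]
    calc _ ≤ n * √(y j) * B := mul_le_mul (min_le_right _ _) (hgB y) (norm_nonneg _) (by positivity)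
      _ = _ := by ring
  · have he : f - (fun y => w n y • g y) = (f - ⇑g) + (⇑g - fun y => w n y • g y) := by
      rw [sub_add_sub_cancel]
    rw [he]
    refine (eLpNorm_add_le (hf.1.sub hg2.1) (hg2.1.sub hmem.1) (by norm_num)).trans ?_
    calc _ ≤ ε / 2 + ε / 2 := add_le_add hfg hL
      _ = ε := ENNReal.add_halves ε

/-- Contractivity on L² extends convergence from the dense class to all of L², with three errors of
ε / 3. -/
theorem tendsto_eLpNorm_kernelOp_sub [IsFiniteMeasure (laguerreMeasure α)]
    (hα : IsAdmissible α j)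
    (hk : ∀ r, 0 < r → r < 1 → IsSymmKernel (laguerreMeasure α) (modifiedProdKernel α j r) 1)
    {f : (Fin d → ℝ) → 𝕜} (hf : MemLp f 2 (laguerreMeasure α)) :
    Tendsto (fun r => eLpNorm (kernelOp (laguerreMeasure α) (modifiedProdKernel α j r) f - f) 2
      (laguerreMeasure α)) (𝓝[<] 1) (𝓝 0) := by
  rw [ENNReal.tendsto_nhds_zero]
  intro ε hε
  have hε3 : ε / 3 ≠ 0 := (ENNReal.div_pos hε.ne' (by norm_num)).ne'
  obtain ⟨g, M, B, hg, hM0, hM, hB0, hB, hg2, hfg⟩ :=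
    exists_continuous_le_sqrt_eLpNorm_sub_le j hf hε3
  have hev : ∀ᶠ r : ℝ in 𝓝[<] 1, 0 < r ∧ r < 1 :=
    ((eventually_gt_nhds zero_lt_one).filter_mono nhdsWithin_le_nhds).and self_mem_nhdsWithin
  filter_upwards [hev, ENNReal.tendsto_nhds_zero.1
    (tendsto_eLpNorm_kernelOp_sub_of_bounded hα hk hg hM0 hM hB0 hB) (ε / 3)
    (pos_iff_ne_zero.2 hε3)] with r hr hrg
  have hkr := hk r hr.1 hr.2
  set T : ((Fin d → ℝ) → 𝕜) → (Fin d → ℝ) → 𝕜 :=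
    kernelOp (laguerreMeasure α) (modifiedProdKernel α j r) with hT
  have h1 : eLpNorm (T (f - g)) 2 (laguerreMeasure α) ≤ ε / 3 := by
    have := (hkr.lpNormLE_kernelOp (𝕜 := 𝕜) one_le_two (f - g) (hf.sub hg2)).2
    rw [ENNReal.ofReal_one, one_mul] at this
    exact this.trans hfg
  have h2 : eLpNorm (g - f) 2 (laguerreMeasure α) ≤ ε / 3 := by
    rwa [← neg_sub, eLpNorm_neg]
  have he : T f - f = T (f - g) + ((T g - g) + (g - f)) := by
    rw [hT, hkr.kernelOp_sub one_le_two hf hg2]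
    abel
  have hTg : AEStronglyMeasurable (T g) (laguerreMeasure α) :=
    hkr.aestronglyMeasurable_kernelOp hg2.1
  have hTfg : AEStronglyMeasurable (T (f - g)) (laguerreMeasure α) :=
    hkr.aestronglyMeasurable_kernelOp (hf.1.sub hg2.1)
  rw [he]
  calc _ ≤ eLpNorm (T (f - g)) 2 (laguerreMeasure α) +
        eLpNorm ((T g - g) + (g - f)) 2 (laguerreMeasure α) :=
        eLpNorm_add_le hTfg ((hTg.sub hg2.1).add (hg2.1.sub hf.1)) one_le_two
    _ ≤ ε / 3 + (ε / 3 + ε / 3) := by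
        gcongr
        exact (eLpNorm_add_le (hTg.sub hg2.1) (hg2.1.sub hf.1) one_le_two).trans
          (add_le_add hrg h2)
    _ = ε := by rw [← add_assoc, ENNReal.add_thirds]

end StrongContinuity

/-! ### Operators equal almost everywhere to a kernel operator -/

section AlmostEverywhere

variable {X : Type*} [MeasurableSpace X] {μ : Measure X} {𝕜 : Type*} [RCLike 𝕜]
  {A B : (X → 𝕜) → (X → 𝕜)} {k : X → X → ℝ} {C : ℝ}

theorem LpNormLE.congr {p : ℝ≥0∞} {c : ℝ} (h : LpNormLE μ B p c) (hAB : ∀ f, A f =ᵐ[μ] B f) :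
    LpNormLE μ A p c := fun f hf => by
  rw [memLp_congr_ae (hAB f), eLpNorm_congr_ae (hAB f)]
  exact h f hf

theorem lpNormLE_id (p : ℝ≥0∞) : LpNormLE μ (fun f : X → 𝕜 => f) p 1 := fun f hf => by
  simpa using hf

theorem InL1AddLinfty.aestronglyMeasurable {f : X → 𝕜} (hf : InL1AddLinfty μ f) :
    AEStronglyMeasurable f μ := by
  obtain ⟨g, h, hg, hh, rfl⟩ := hf
  exact hg.1.add hh.1

theorem isLinearOnL1AddLinfty_id : IsLinearOnL1AddLinfty μ (fun f : X → 𝕜 => f) where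
  measurable _ hf := hf.aestronglyMeasurable
  congr _ _ _ _ h := h
  add _ _ _ _ := ae_eq_rfl
  smul _ _ _ := ae_eq_rfl

theorem IsSymmKernel.isLinearOnL1AddLinfty [SFinite μ] (hk : IsSymmKernel μ k C)
    (hA : ∀ f, A f =ᵐ[μ] kernelOp μ k f) : IsLinearOnL1AddLinfty μ A where
  measurable f hf :=
    (hk.aestronglyMeasurable_kernelOp hf.aestronglyMeasurable).congr (hA f).symm
  congr f g _ _ h := by
    filter_upwards [hA f, hA g] with x hf hg
    rw [hf, hg]
    exact integral_congr_ae (h.mono fun y hy => by simp only [hy])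
  add f g hf hg := by
    filter_upwards [hA f, hA g, hA (f + g)] with x h1 h2 h3
    rw [Pi.add_apply, h1, h2, h3]
    simp only [kernelOp, Pi.add_apply, mul_add]
    exact integral_add (hk.integrable_mul_of_inL1AddLinfty x hf)
      (hk.integrable_mul_of_inL1AddLinfty x hg)
  smul c f _ := by
    filter_upwards [hA f, hA (c • f)] with x h1 h2
    rw [Pi.smul_apply, h1, h2, kernelOp, kernelOp, ← integral_smul]
    refine integral_congr_ae (ae_of_all _ fun y => ?_)
    simp only [Pi.smul_apply, smul_eq_mul]
    ring

theorem kernelOp_ofReal (k : X → X → ℝ) (w : X → ℝ) (x : X) :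
    kernelOp μ k (fun y => (w y : 𝕜)) x = ((∫ y, k x y * w y ∂μ : ℝ) : 𝕜) := by
  rw [kernelOp, ← integral_ofReal]
  simp

/-- In the order of `𝕜`, being nonnegative includes being real, so f may be replaced by its real
part and the integral is a real one. -/
theorem IsSymmKernel.kernelOp_nonneg (hk : IsSymmKernel μ k C) {f : X → 𝕜}
    (hf : ∀ᵐ y ∂μ, 0 ≤ f y) (x : X) : 0 ≤ kernelOp μ k f x := by
  have h : kernelOp μ k f x = kernelOp μ k (fun y => ((RCLike.re (f y) : ℝ) : 𝕜)) x := by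
    refine integral_congr_ae (hf.mono fun y hy => ?_)
    have := RCLike.nonneg_iff.1 hy
    simp only
    congr 1
    refine RCLike.ext (by simp) (by simp [this.2])
  rw [h, kernelOp_ofReal, RCLike.ofReal_nonneg]
  refine integral_nonneg_of_ae (hf.mono fun y hy => ?_)
  exact mul_nonneg (hk.nonneg x y) (RCLike.nonneg_iff.1 hy).1

theorem kernelOp_one (k : X → X → ℝ) (x : X) :
    kernelOp μ k (fun _ => (1 : 𝕜)) x = ((∫ y, k x y ∂μ : ℝ) : 𝕜) := by
  simpa using kernelOp_ofReal (𝕜 := 𝕜) (μ := μ) k (fun _ => 1) x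

end AlmostEverywhere

/-! ### The modified Laguerre polynomial semigroup -/

section ModifiedSemigroup

variable {d : ℕ} {α : Fin d → ℝ} {j : Fin d} {𝕜 : Type*} [RCLike 𝕜]

theorem Real.exp_neg_pos_and_lt_one {t : ℝ} (ht : 0 < t) : 0 < Real.exp (-t) ∧ Real.exp (-t) < 1 :=
  ⟨Real.exp_pos _, Real.exp_lt_one_iff.2 (by linarith)⟩

theorem isSymmKernel_modifiedProdKernel_exp (hα : IsAdmissible α j) {t c : ℝ} (ht : 0 < t)
    (hc : ∀ z, 0 ≤ z → modifiedMass (α j + 1) z ≤ c) :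
    IsSymmKernel (laguerreMeasure α) (modifiedProdKernel α j (Real.exp (-t)))
      (c * Real.exp (-t / 2)) := by
  rw [Real.exp_half, mul_comm]
  exact isSymmKernel_modifiedProdKernel hα (Real.exp_neg_pos_and_lt_one ht).1 (Real.exp_neg_pos_and_lt_one ht).2 hc

theorem lpNormLE_modifiedSemigroup (hα : IsAdmissible α j) {t c : ℝ} (ht : 0 < t)
    (hc : ∀ z, 0 ≤ z → modifiedMass (α j + 1) z ≤ c) {p : ℝ≥0∞} (hp : 1 ≤ p) :
    LpNormLE (laguerreMeasure α) (modifiedSemigroup 𝕜 α j t) p (c * Real.exp (-t / 2)) :=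
  ((isSymmKernel_modifiedProdKernel_exp hα ht hc).lpNormLE_kernelOp hp).congr
    (modifiedSemigroup_ae_eq hα ht)

theorem integrable_modifiedKernel_mul (hα : IsAdmissible α j) {t : ℝ} (ht : 0 < t)
    {x : Fin d → ℝ} (hx : x ∈ posOrthant d) {f : (Fin d → ℝ) → 𝕜}
    (hf : InL1AddLinfty (laguerreMeasure α) f) :
    Integrable (fun y => (modifiedKernel α j t x y : 𝕜) * f y) (laguerreMeasure α) := by
  have hb : -1 / 2 < α j + 1 := by linarith [hα.1]
  refine ((isSymmKernel_modifiedProdKernel_exp hα ht fun z hz =>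
    modifiedMass_le hb hz).integrable_mul_of_inL1AddLinfty x hf).congr ?_
  filter_upwards [ae_laguerreMeasure_mem_posOrthant α] with y hy
  rw [modifiedKernel_eq_modifiedProdKernel hα ht hx hy]

theorem modifiedSemigroup_zero (f : (Fin d → ℝ) → 𝕜) : modifiedSemigroup 𝕜 α j 0 f = f :=
  if_pos rfl

theorem modifiedSemigroup_congr {t : ℝ} {f g : (Fin d → ℝ) → 𝕜} (ht : 0 < t)
    (h : f =ᵐ[laguerreMeasure α] g) :
    modifiedSemigroup 𝕜 α j t f = modifiedSemigroup 𝕜 α j t g := by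
  ext x
  rw [modifiedSemigroup, modifiedSemigroup, if_neg ht.ne', if_neg ht.ne']
  exact integral_congr_ae (h.mono fun y hy => by simp only [hy])

theorem isFiniteMeasure_laguerreMeasure (h : ∀ i, -1 < α i) :
    IsFiniteMeasure (laguerreMeasure α) := by
  have (i : Fin d) : IsFiniteMeasure (laguerreMeasureReal (α i)) := by
    have h0 := integrable_pow_laguerreMeasureReal (h i) 0
    simp only [pow_zero] at h0
    exact (integrable_const_iff_isFiniteMeasure one_ne_zero).1 h0
  rw [laguerreMeasure_eq_pi]
  infer_instance

theorem isSymmKernel_one_of_neg_half_le (hα : IsAdmissible α j) (hj : -1 / 2 ≤ α j) {r : ℝ}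
    (hr0 : 0 < r) (hr : r < 1) :
    IsSymmKernel (laguerreMeasure α) (modifiedProdKernel α j r) 1 :=
  (isSymmKernel_modifiedProdKernel hα hr0 hr fun z hz =>
    modifiedMass_le_one (by linarith) hz).mono (by simpa using hr.le)

theorem isSymmetricDiffusionSemigroup_modifiedSemigroup (hα : IsAdmissible α j)
    (hj : -1 / 2 ≤ α j) :
    IsSymmetricDiffusionSemigroup (laguerreMeasure α) (modifiedSemigroup 𝕜 α j) := by
  have hk : ∀ t : ℝ, 0 < t → IsSymmKernel (laguerreMeasure α)
      (modifiedProdKernel α j (Real.exp (-t))) 1 := fun t ht =>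
    isSymmKernel_one_of_neg_half_le hα hj (Real.exp_neg_pos_and_lt_one ht).1 (Real.exp_neg_pos_and_lt_one ht).2
  have h0 : modifiedSemigroup 𝕜 α j 0 = fun f => f := funext modifiedSemigroup_zero
  refine ⟨fun t ht => ?_, fun f _ => by rw [h0], fun p hp t ht => ?_,
    fun p hp s t hs ht f hf => ?_, fun t ht f g hf hg => ?_, fun f hf => ?_⟩
  · rcases ht.eq_or_lt with rfl | ht
    · rw [h0]
      exact isLinearOnL1AddLinfty_id
    · exact (hk t ht).isLinearOnL1AddLinfty (modifiedSemigroup_ae_eq hα ht)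
  · rcases ht.eq_or_lt with rfl | ht
    · rw [h0]
      exact lpNormLE_id p
    · exact ((hk t ht).lpNormLE_kernelOp hp).congr (modifiedSemigroup_ae_eq hα ht)
  · rcases hs.eq_or_lt with rfl | hs
    · rw [zero_add, h0]
    rcases ht.eq_or_lt with rfl | ht
    · rw [add_zero, h0]
    refine (modifiedSemigroup_ae_eq hα (add_pos hs ht) f).trans ?_
    rw [modifiedSemigroup_congr hs (modifiedSemigroup_ae_eq hα ht f)]
    refine EventuallyEq.trans (Eq.eventuallyEq (funext fun x => ?_))
      (modifiedSemigroup_ae_eq hα hs _).symm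
    refine (hk s hs).kernelOp_comp (hk t ht) (hk (s + t) (add_pos hs ht)) (fun x z => ?_) hp hf x
    obtain ⟨hs0, hs1⟩ := Real.exp_neg_pos_and_lt_one hs
    obtain ⟨ht0, ht1⟩ := Real.exp_neg_pos_and_lt_one ht
    rw [integral_modifiedProdKernel_mul hα hs0.le hs1 ht0.le ht1, ← Real.exp_add, neg_add]
  · rcases ht.eq_or_lt with rfl | ht
    · rw [h0]
    · have h1 := (hk t ht).integral_inner_kernelOp hf hg
      rw [integral_congr_ae (g := fun x => inner 𝕜 (kernelOp (laguerreMeasure α)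
          (modifiedProdKernel α j (Real.exp (-t))) f x) (g x)), h1]
      · refine integral_congr_ae ?_
        filter_upwards [modifiedSemigroup_ae_eq hα ht g] with x hx
        rw [hx]
      · filter_upwards [modifiedSemigroup_ae_eq hα ht f] with x hx
        rw [hx]
  · have : IsFiniteMeasure (laguerreMeasure α) := isFiniteMeasure_laguerreMeasure fun i => by
      by_cases h : i = j
      · subst h
        linarith
      · exact hα.2 i h
    have hexp : Tendsto (fun t : ℝ => Real.exp (-t)) (𝓝[>] 0) (𝓝[<] 1) := by
      refine tendsto_nhdsWithin_iff.2 ⟨?_, ?_⟩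
      · have : Continuous fun t : ℝ => Real.exp (-t) := by fun_prop
        have := this.tendsto 0
        rw [neg_zero, Real.exp_zero] at this
        exact this.mono_left nhdsWithin_le_nhds
      · filter_upwards [self_mem_nhdsWithin] with t ht
        exact (Real.exp_neg_pos_and_lt_one ht).2
    refine ((tendsto_eLpNorm_kernelOp_sub hα (fun r hr0 hr =>
      isSymmKernel_one_of_neg_half_le hα hj hr0 hr) hf).comp hexp).congr' ?_
    filter_upwards [self_mem_nhdsWithin] with t ht
    exact eLpNorm_congr_ae ((modifiedSemigroup_ae_eq hα ht f).symm.sub ae_eq_rfl)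

theorem isSubmarkovian_modifiedSemigroup (hα : IsAdmissible α j) (hj : -1 / 2 ≤ α j) :
    IsSubmarkovian (laguerreMeasure α) (modifiedSemigroup 𝕜 α j) := by
  refine ⟨isSymmetricDiffusionSemigroup_modifiedSemigroup hα hj, fun t ht f _ hf0 => ?_,
    fun t ht => ?_⟩
  · rcases ht.eq_or_lt with rfl | ht
    · rwa [modifiedSemigroup_zero]
    · have hk := isSymmKernel_one_of_neg_half_le hα hj (Real.exp_neg_pos_and_lt_one ht).1
        (Real.exp_neg_pos_and_lt_one ht).2
      filter_upwards [modifiedSemigroup_ae_eq hα ht f] with x hx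
      rw [hx]
      exact hk.kernelOp_nonneg hf0 x
  · rcases ht.eq_or_lt with rfl | ht
    · rw [modifiedSemigroup_zero]
      exact ae_of_all _ fun _ => le_rfl
    · have hk := isSymmKernel_one_of_neg_half_le hα hj (Real.exp_neg_pos_and_lt_one ht).1
        (Real.exp_neg_pos_and_lt_one ht).2
      filter_upwards [modifiedSemigroup_ae_eq (𝕜 := 𝕜) hα ht fun _ => 1] with x hx
      rw [hx, kernelOp_one, ← RCLike.ofReal_one, RCLike.ofReal_le_ofReal]
      exact hk.integral_le x

/-- At time 1 the image of the constant 1 is at most e^{-1/2} < 1. -/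
theorem not_isMarkovian_modifiedSemigroup (hα : IsAdmissible α j) (hj : -1 / 2 ≤ α j) :
    ¬ IsMarkovian (laguerreMeasure α) (modifiedSemigroup 𝕜 α j) := by
  rintro ⟨-, -, h⟩
  obtain ⟨x, -, hx, h1⟩ := exists_mem_of_ae_laguerreMeasure (h 1 zero_le_one) isOpen_univ
    ⟨1, Set.mem_univ _, fun _ => one_pos⟩
  have hk := isSymmKernel_modifiedProdKernel_exp hα one_pos fun z hz =>
    modifiedMass_le_one (b := α j + 1) (by linarith) hz
  rw [modifiedSemigroup_eq_kernelOp hα (zero_lt_one' ℝ) _ hx, kernelOp_one] at h1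
  replace h1 := RCLike.ofReal_inj.1 (h1.trans RCLike.ofReal_one.symm)
  have h2 := hk.integral_le x
  have h3 : Real.exp (-1 / 2) < 1 := Real.exp_lt_one_iff.2 (by norm_num)
  linarith

/-- The factor |y_j| raises the exponent to α_j + 1 > -1/2, so the integral is finite even when α_j
≤ -1 and the measure itself is infinite. -/
theorem integrable_abs_apply_laguerreMeasure (hα : IsAdmissible α j) :
    Integrable (fun y : Fin d → ℝ => |y j|) (laguerreMeasure α) := by
  set F : Fin d → ℝ → ℝ := fun i y => if i = j then |y| else 1 with hF
  have he : (fun y : Fin d → ℝ => |y j|) = fun y => ∏ i, F i (y i) := by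
    ext y
    rw [hF, Finset.prod_ite_eq' Finset.univ j fun i => |y i|, if_pos (Finset.mem_univ j)]
  rw [he, laguerreMeasure_eq_pi]
  refine Integrable.fintype_prod fun i => ?_
  by_cases h : i = j
  · subst h
    have h1 := integrable_pow_laguerreMeasureReal (a := α i + 1) (by linarith [hα.1]) 0
    simp only [pow_zero] at h1
    have h2 := integrable_rpow_mul_laguerreMeasureReal_iff.2 h1
    simp only [Real.rpow_one, mul_one] at h2
    simpa [hF] using h2.abs
  · have h1 := integrable_pow_laguerreMeasureReal (hα.2 i h) 0
    simpa [hF, h] using h1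

/-- Contractivity on L^∞ applied to 1 would bound the total mass of the kernel by 1. As 1 need not
lie in L², it is approximated by cutoffs, and the resulting bound contradicts a mass above 1 on an
open set. -/
theorem not_isLpContractive_modifiedSemigroup (hα : IsAdmissible α j) (hj : α j < -1 / 2) :
    ¬ IsLpContractive (laguerreMeasure α) (modifiedSemigroup 𝕜 α j) := by
  intro h
  have hb : -1 / 2 < α j + 1 := by linarith [hα.1]
  obtain ⟨κ, p, hκ, hp, hmass⟩ := exists_one_lt_modifiedMass hb (by linarith)
  -- With r = 1/κ the mass is at least √r κ = e^{t/2} > 1 wherever p < z < p + 1.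
  set t := Real.log κ with ht'
  have ht : 0 < t := Real.log_pos hκ
  obtain ⟨hr0, hr1⟩ := Real.exp_neg_pos_and_lt_one ht
  set r := Real.exp (-t) with hr
  have hk := isSymmKernel_modifiedProdKernel_exp hα ht fun z hz => modifiedMass_le hb hz
  -- The cutoff lies in L^∞, and in L² because w² ≤ w ≤ n |y_j|, which is integrable.
  set w : ℕ → (Fin d → ℝ) → ℝ := fun n y => min 1 (n * |y j|) with hw
  have hw0 : ∀ n y, 0 ≤ w n y := fun n y => le_min zero_le_one (by positivity)
  have hw1 : ∀ n y, w n y ≤ 1 := fun n y => min_le_left _ _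
  have hwc : ∀ n, Continuous (w n) := fun n => by
    simp only [hw]
    fun_prop
  have hwm : ∀ n, AEStronglyMeasurable (fun y => (w n y : 𝕜)) (laguerreMeasure α) := fun n =>
    (RCLike.continuous_ofReal.comp (hwc n)).aestronglyMeasurable
  have hwn : ∀ n y, ‖(w n y : 𝕜)‖ = w n y := fun n y => by
    rw [RCLike.norm_ofReal, abs_of_nonneg (hw0 n y)]
  have hwtop : ∀ n, MemLp (fun y => (w n y : 𝕜)) ∞ (laguerreMeasure α) := fun n =>
    memLp_top_of_bound (hwm n) 1 (ae_of_all _ fun y => (hwn n y).trans_le (hw1 n y))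
  have hw2 : ∀ n, MemLp (fun y => (w n y : 𝕜)) 2 (laguerreMeasure α) := fun n => by
    refine (memLp_two_iff_integrable_sq_norm (hwm n)).2 ?_
    refine ((integrable_abs_apply_laguerreMeasure hα).const_mul (n : ℝ)).mono'
      ((hwm n).norm.pow 2) (ae_of_all _ fun y => ?_)
    rw [hwn, Real.norm_of_nonneg (by positivity), sq]
    exact (mul_le_of_le_one_left (hw0 n y) (hw1 n y)).trans (min_le_right _ _)
  have hle : ∀ᵐ x ∂laguerreMeasure α, ∀ n, ∫ y, modifiedProdKernel α j r x y * w n y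
      ∂laguerreMeasure α ≤ 1 := by
    refine ae_all_iff.2 fun n => ?_
    have h1 := h ∞ le_top t ht.le _ (hw2 n) (hwtop n)
    have h2 : eLpNorm (fun y => (w n y : 𝕜)) ∞ (laguerreMeasure α) ≤ ENNReal.ofReal 1 := by
      rw [eLpNorm_exponent_top]
      exact eLpNormEssSup_le_of_ae_bound
        (ae_of_all _ fun y => (hwn n y).trans_le (hw1 n y))
    rw [eLpNorm_exponent_top] at h1
    filter_upwards [ae_le_eLpNormEssSup (f := modifiedSemigroup 𝕜 α j t fun y => (w n y : 𝕜))
      (μ := laguerreMeasure α), modifiedSemigroup_ae_eq hα ht fun y => (w n y : 𝕜)] with x hx1 hx2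
    rw [hx2, kernelOp_ofReal, ← ofReal_norm] at hx1
    have h3 := (ENNReal.ofReal_le_ofReal_iff zero_le_one).1 (hx1.trans (h1.trans h2))
    rw [RCLike.norm_ofReal] at h3
    exact (le_abs_self _).trans h3
  have hle' : ∀ᵐ x ∂laguerreMeasure α, ∫ y, modifiedProdKernel α j r x y
      ∂laguerreMeasure α ≤ 1 := by
    filter_upwards [hle] with x hx
    refine le_of_tendsto' (f := fun n => ∫ y, modifiedProdKernel α j r x y * w n y
      ∂laguerreMeasure α) (tendsto_integral_of_dominated_convergence (modifiedProdKernel α j r x)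
      (fun n => ?_) (hk.integrable x) (fun n => ae_of_all _ fun y => ?_) ?_) hx
    · exact (hk.measurable_slice x).aestronglyMeasurable.mul (hwc n).aestronglyMeasurable
    · rw [Real.norm_of_nonneg (mul_nonneg (hk.nonneg x y) (hw0 n y))]
      exact mul_le_of_le_one_right (hk.nonneg x y) (hw1 n y)
    · filter_upwards [ae_laguerreMeasure_mem_posOrthant α] with y hy
      obtain ⟨N, hN⟩ := exists_nat_gt (y j)⁻¹
      refine tendsto_const_nhds.congr' ?_
      filter_upwards [eventually_ge_atTop N] with n hn
      have h1 : w n y = 1 := by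
        refine min_eq_left ?_
        have h2 : (y j)⁻¹ ≤ n := hN.le.trans (by exact_mod_cast hn)
        have h3 := hy j
        rw [abs_of_pos h3]
        calc (1 : ℝ) = (y j)⁻¹ * y j := (inv_mul_cancel₀ h3.ne').symm
          _ ≤ n * y j := by gcongr
      rw [h1, mul_one]
  have h1r : 0 < 1 - r := by linarith
  have hU : IsOpen {x : Fin d → ℝ | p < r * |x j| / (1 - r) ∧ r * |x j| / (1 - r) < p + 1} := by
    have hc : Continuous fun x : Fin d → ℝ => r * |x j| / (1 - r) := by fun_prop
    exact (isOpen_lt continuous_const hc).inter (isOpen_lt hc continuous_const)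
  have hne : ({x : Fin d → ℝ | p < r * |x j| / (1 - r) ∧ r * |x j| / (1 - r) < p + 1} ∩
      posOrthant d).Nonempty := by
    -- This is the value of x_j for which z = r x_j / (1 - r) is the midpoint p + 1/2 of the window.
    have hpos : 0 < (p + 1 / 2) * (1 - r) / r := by positivity
    have he : r * |(p + 1 / 2) * (1 - r) / r| / (1 - r) = p + 1 / 2 := by
      rw [abs_of_pos hpos]
      field_simp
    refine ⟨fun _ => (p + 1 / 2) * (1 - r) / r, ?_, fun _ => hpos⟩
    rw [Set.mem_ofPred_eq, he]
    constructor <;> linarith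
  obtain ⟨x, hx, -, hx1⟩ := exists_mem_of_ae_laguerreMeasure hle' hU hne
  rw [(integral_modifiedProdKernel hα hr0.le hr1 x).2] at hx1
  have h1 : √r * κ ≤ 1 := (mul_le_mul_of_nonneg_left (hmass _ hx.1 hx.2)
    (Real.sqrt_nonneg r)).trans hx1
  have h2 : √r * κ = Real.exp (t / 2) := by
    rw [hr, ← Real.exp_half, ← Real.exp_log (zero_lt_one.trans hκ), ← ht', ← Real.exp_add]
    congr 1
    ring
  have h3 : 1 < Real.exp (t / 2) := Real.one_lt_exp_iff.2 (by linarith)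
  linarith

end ModifiedSemigroup

theorem mainTheorem4 (𝕜 : Type*) [RCLike 𝕜] (d : ℕ) (j : Fin d) (α : Fin d → ℝ)
    (hα : IsAdmissible α j) :
    (∀ t : ℝ, 0 < t → ∀ x ∈ posOrthant d, ∀ f : (Fin d → ℝ) → 𝕜,
      InL1AddLinfty (laguerreMeasure α) f →
        Integrable (fun y => (modifiedKernel α j t x y : 𝕜) * f y) (laguerreMeasure α)) ∧
    (-1 / 2 ≤ α j →
      IsSubmarkovian (laguerreMeasure α) (modifiedSemigroup 𝕜 α j) ∧
      ¬ IsMarkovian (laguerreMeasure α) (modifiedSemigroup 𝕜 α j) ∧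
      ∀ p : ℝ≥0∞, 1 ≤ p → ∀ t : ℝ, 0 < t →
        LpNormLE (laguerreMeasure α) (modifiedSemigroup 𝕜 α j t) p (Real.exp (-t / 2))) ∧
    (α j < -1 / 2 →
      ¬ IsLpContractive (laguerreMeasure α) (modifiedSemigroup 𝕜 α j) ∧
      ∃ c : ℝ, 1 < c ∧ ∀ p : ℝ≥0∞, 1 ≤ p → ∀ t : ℝ, 0 < t →
        LpNormLE (laguerreMeasure α) (modifiedSemigroup 𝕜 α j t) p
          (c * Real.exp (-t / 2))) := by
  have hb : -1 / 2 < α j + 1 := by linarith [hα.1]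
  refine ⟨fun t ht x hx f hf => integrable_modifiedKernel_mul hα ht hx hf, fun hj => ?_,
    fun hj => ?_⟩
  · refine ⟨isSubmarkovian_modifiedSemigroup hα hj, not_isMarkovian_modifiedSemigroup hα hj,
      fun p hp t ht => ?_⟩
    simpa using lpNormLE_modifiedSemigroup (𝕜 := 𝕜) hα ht
      (fun z hz => modifiedMass_le_one (by linarith) hz) hp
  -- The constant is (b + 1)/(b + 1/2) with b = α_j + 1, the bound of `modifiedMass_le`.
  · refine ⟨not_isLpContractive_modifiedSemigroup hα hj,
      (α j + 1 + 1) / (α j + 1 + 1 / 2), ?_, fun p hp t ht =>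
        lpNormLE_modifiedSemigroup hα ht (fun z hz => modifiedMass_le hb hz) hp⟩
    rw [one_lt_div (by linarith)]
    linarith
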